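/- Let $n\ge 1$, let $F$ be a field of characteristic $0$, and let $v,l\in F$ be algebraically independent over $\mathbb Q$ (for instance $F=\mathbb Q(v,l)$, the quotient field of $\mathbb Q[v^{\pm1},l^{\pm1}]$). Put $m=v-v^{-1}$ and $\tau=\frac{l-l^{-1}}{m}+1$. Write $[ab\ldots]_N$ (resp. $[\ldots ab]_N$) for the alternating product of $a$ and $b$ with $N$ factors that begins with $a$ (resp. ends with $b$). Let $B=B_{I_2(2n+1)}(m,l)$ be the unital associative $F$-algebra generated by $X_0^{\pm1},X_1^{\pm1},E_0,E_1$ with the relations ($i\in\{0,1\}$, $1\le k\le n$) $$[X_0X_1\ldots]_{2n+1}=[X_1X_0\ldots]_{2n+1},\quad X_i-X_i^{-1}=m(E_i-1),\quad X_iE_i=E_iX_i=lE_i,\quad E_i^2=\tau E_i,$$ $$E_i[X_{1-i}X_i\ldots]_{2k-1}E_i=l^{-1}E_i,\qquad E_i[X_{1-i}^{-1}X_i^{-1}\ldots]_{2k-1}E_i=lE_i,$$ $$[X_0X_1\ldots]_{2n}E_0=E_1[X_0X_1\ldots]_{2n},\qquad E_0[X_1X_0\ldots]_{2n}=[X_1X_0\ldots]_{2n}E_1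 .$$ Let $H=H_{I_2(2n+1)}(v)$ be the dihedral Hecke algebra over $F$, generated by $x_0,x_1$ with the relations $[x_0x_1\ldots]_{2n+1}=[x_1x_0\ldots]_{2n+1}$ and $(x_i+v)(x_i-v^{-1})=0$. Let $\pi:B\to H$ be the algebra homomorphism with $\pi(X_i)=x_i$ and $\pi(E_i)=0$. On both algebras let $*$ be the $F$-linear anti-involution that reverses words in the generators (in the letters $X_i^{\pm1},E_i$, respectively $x_i$). A cell datum (Graham–Lehrer) on an $F$-algebra $A$ is a tuple $(\Lambda,M,C,*)$, where $\Lambda$ is a poset, $M(\lambda)$ is a finite set for each $\lambda\in\Lambda$, and $C:\coprod_{\lambda}M(\lambda)\times M(\lambda)\to A$, written $(S,T)\mapsto C^\lambda_{S,T}$, is injective with image an $F$-basis of $A$; $*$ is an $F$-linear anti-involution of $A$ with $(C^\lambda_{S,T})^*=C^\lambda_{T,S}$; and for all $a\in A$, $\lambda\in\Lambda$ there are $r_a(S',S)\in F$, independent of $T$, such that $aC^\lambda_{S,T}-\sum_{S'\in M(\lambda)}r_a(S',S)C^\lambda_{S',T}$ lies in the span of the $C^\mu_{P,Q}$ with $\mu<\lambda$.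 An algebra with a cell datum is called cellular. 1. Let $(\Lambda',M',C',*)$ be any cell datum on $H$ whose anti-involution is word reversal. Let $\Lambda=\Lambda'\sqcup\{\lambda_{LK}\}$ with the order of $\Lambda'$ and $\lambda_{LK}<\lambda$ for all $\lambda\in\Lambda'$; let $M(\lambda)=M'(\lambda)$ for $\lambda\in\Lambda'$ and $M(\lambda_{LK})=\{0,1,\ldots,2n\}$. Choose a total order on each $M'(\lambda)$ and, for $S\le T$ in $M'(\lambda)$, any $D^\lambda_{S,T}\in\pi^{-1}(C'^{\lambda}_{S,T})$; put $C^\lambda_{S,T}=D^\lambda_{S,T}$ if $S<T$, $C^\lambda_{S,T}=(D^\lambda_{T,S})^*$ if $T<S$, and $C^\lambda_{S,S}=\frac12\bigl(D^\lambda_{S,S}+(D^\lambda_{S,S})^*\bigr)$. For $0\le i,j\le 2n$ put $$C^{\lambda_{LK}}_{i,j}=[\ldots X_0X_1]_i\,E_0\,[X_1X_0\ldots]_j .$$ Then $(\Lambda,M,C,*)$, with $*$ the word reversal of $B$, is a cell datum on $B$, and $\pi(C^\lambda_{S,T})=C'^{\lambda}_{S,T}$ for all $\lambda\in\Lambda'$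 and $S,T\in M'(\lambda)$. 2. If moreover $F$ contains $\zeta+\zeta^{-1}$ for some primitive $(2n+1)$-st root of unity $\zeta$ in an algebraic closure of $F$, then $H$ has a cell datum whose anti-involution is word reversal; hence $B$ is a cellular algebra with word reversal as its anti-involution. -/

import Mathlib

namespace DihedralBMW

universe u w

section Cellular

variable {R : Type*} [CommRing R] {A : Type*} [Ring A] [Algebra R A]

/-- The data `(Λ, M, C, star)` form a cell datum (in the sense of Graham and Lehrer) on the
`R`-algebra `A`: `Λ` is a partially ordered set, every `M μ` is a finite set, and
* (C1) `(μ, S, T) ↦ C μ S T` is injective and its image is an `R`-basis of `A`;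
* (C2) `star` is an `R`-linear anti-involution of `A` with `star (C μ S T) = C μ T S`;
* (C3) `a * C μ S T ≡ ∑ S', r S' S • C μ S' T` modulo the span of the `C κ P Q` with `κ < μ`,
  where the coefficients `r S' S` do not depend on `T`. -/
structure IsCellDatum (Λ : Type*) [PartialOrder Λ] (M : Λ → Type*) [∀ μ, Fintype (M μ)]
    (C : ∀ μ, M μ → M μ → A) (star : A →ₗ[R] A) : Prop where
  injective : Function.Injective
    (fun x : (Σ μ : Λ, M μ × M μ) => C x.1 x.2.1 x.2.2)
  linearIndependent : LinearIndependent R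
    (fun x : (Σ μ : Λ, M μ × M μ) => C x.1 x.2.1 x.2.2)
  span_eq_top : Submodule.span R
    (Set.range (fun x : (Σ μ : Λ, M μ × M μ) => C x.1 x.2.1 x.2.2)) = ⊤
  star_mul : ∀ a b : A, star (a * b) = star b * star a
  star_star : ∀ a : A, star (star a) = a
  star_C : ∀ (μ : Λ) (S T : M μ), star (C μ S T) = C μ T S
  mul_C : ∀ (a : A) (μ : Λ), ∃ r : M μ → M μ → R, ∀ S T : M μ,
    a * C μ S T - ∑ S' : M μ, r S' S • C μ S' T ∈
      Submodule.span R {x : A | ∃ κ : Λ, κ < μ ∧ ∃ P Q : M κ, x = C κ P Q}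

/-- `A` is a cellular algebra, with `star` as the anti-involution of a cell datum. -/
def IsCellularWith (star : A →ₗ[R] A) : Prop :=
  ∃ (Λ : Type) (_ : PartialOrder Λ) (M : Λ → Type) (_ : ∀ μ, Fintype (M μ))
    (C : ∀ μ, M μ → M μ → A), IsCellDatum Λ M C star

end Cellular

section Words

variable {A : Type*} [Monoid A]

/-- `[a b a ⋯]_N`: the alternating product with `N` factors whose first factor is `a`. -/
def altL : A → A → ℕ → A
  | _, _, 0 => 1
  | a, b, N + 1 => a * altL b a N

/-- `[⋯ b a b]_N`: the alternating product of `a` and `b` with `N` factors whose last factor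
is `b`. -/
def altR : A → A → ℕ → A
  | _, _, 0 => 1
  | a, b, N + 1 => altR b a N * b

theorem map_altL {B F : Type*} [Monoid B] [FunLike F A B] [MonoidHomClass F A B] (f : F)
    (a b : A) (N : ℕ) : f (altL a b N) = altL (f a) (f b) N := by
  induction N generalizing a b with
  | zero => simp [altL]
  | succ N ih => simp [altL, ih]

theorem altL_op (a b : A) (N : ℕ) :
    altL (MulOpposite.op a) (MulOpposite.op b) N = MulOpposite.op (altR b a N) := by
  induction N generalizing a b with
  | zero => simp [altL, altR]
  | succ N ih => simp [altL, altR, ih]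

theorem altR_aux (a b : A) (k : ℕ) :
    altR a b (2 * k) = altL a b (2 * k) ∧ altR b a (2 * k + 1) = altL a b (2 * k + 1) := by
  have hL : ∀ (k : ℕ) (a b : A), altL a b (2 * k) * a = altL a b (2 * k + 1) ∧
      altL a b (2 * k + 1) * b = altL a b (2 * (k + 1)) := by
    intro k
    induction k with
    | zero => intro a b; simp [altL]
    | succ k ih =>
      intro a b
      have h1 : altL a b (2 * (k + 1)) * a = altL a b (2 * (k + 1) + 1) := by
        have := (ih b a).2
        change a * altL b a (2 * k + 1) * a = a * altL b a (2 * (k + 1))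
        rw [mul_assoc, this]
      refine ⟨h1, ?_⟩
      have h2 : altL b a (2 * (k + 1)) * b = altL b a (2 * (k + 1) + 1) := by
        have := (ih a b).2
        change b * altL a b (2 * k + 1) * b = b * altL a b (2 * (k + 1))
        rw [mul_assoc, this]
      change a * altL b a (2 * (k + 1)) * b = a * altL b a (2 * (k + 1) + 1)
      rw [mul_assoc, h2]
  induction k generalizing a b with
  | zero => simp [altL, altR]
  | succ k ih =>
    have h1 : altR a b (2 * (k + 1)) = altL a b (2 * (k + 1)) := by
      change altR b a (2 * k + 1) * b = _
      rw [(ih a b).2, (hL k a b).2]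
    refine ⟨h1, ?_⟩
    change altR a b (2 * (k + 1)) * a = _
    rw [h1, (hL (k + 1) a b).1]

theorem altR_even (a b : A) (k : ℕ) : altR a b (2 * k) = altL a b (2 * k) :=
  (altR_aux a b k).1

theorem altR_odd (a b : A) (k : ℕ) : altR b a (2 * k + 1) = altL a b (2 * k + 1) :=
  (altR_aux a b k).2

end Words

section BMW

variable {F : Type*} [Field F]

/-- The symbols `X_i`, `X_i⁻¹` (written `Y i`) and `E_i`, `i = 0, 1`. -/
inductive BMWGen : Type
  | X (i : Fin 2)
  | Y (i : Fin 2)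
  | E (i : Fin 2)

/-- The letters in the free algebra. -/
abbrev fX (F : Type*) [Field F] (i : Fin 2) : FreeAlgebra F BMWGen :=
  FreeAlgebra.ι F (BMWGen.X i)

abbrev fY (F : Type*) [Field F] (i : Fin 2) : FreeAlgebra F BMWGen :=
  FreeAlgebra.ι F (BMWGen.Y i)

abbrev fE (F : Type*) [Field F] (i : Fin 2) : FreeAlgebra F BMWGen :=
  FreeAlgebra.ι F (BMWGen.E i)

/-- The defining relations of the dihedral BMW algebra of type `I_2(2n+1)`, with
`τ = (l - l⁻¹) / m + 1`. In a relation with one index `i`, the other index is `1 - i`. -/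
inductive BMWRel (n : ℕ) (m l : F) : FreeAlgebra F BMWGen → FreeAlgebra F BMWGen → Prop
  | mul_inv (i : Fin 2) : BMWRel n m l (fX F i * fY F i) 1
  | inv_mul (i : Fin 2) : BMWRel n m l (fY F i * fX F i) 1
  | braid : BMWRel n m l
      (altL (fX F 0) (fX F 1) (2 * n + 1)) (altL (fX F 1) (fX F 0) (2 * n + 1))
  | skein (i : Fin 2) : BMWRel n m l (fX F i - fY F i) (m • (fE F i - 1))
  | X_mul_E (i : Fin 2) : BMWRel n m l (fX F i * fE F i) (l • fE F i)
  | E_mul_X (i : Fin 2) : BMWRel n m l (fE F i * fX F i) (l • fE F i)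
  | E_mul_E (i : Fin 2) : BMWRel n m l (fE F i * fE F i) (((l - l⁻¹) / m + 1) • fE F i)
  | E_X_E (i : Fin 2) (k : ℕ) (h1 : 1 ≤ k) (h2 : k ≤ n) : BMWRel n m l
      (fE F i * altL (fX F (1 - i)) (fX F i) (2 * k - 1) * fE F i) (l⁻¹ • fE F i)
  | E_Y_E (i : Fin 2) (k : ℕ) (h1 : 1 ≤ k) (h2 : k ≤ n) : BMWRel n m l
      (fE F i * altL (fY F (1 - i)) (fY F i) (2 * k - 1) * fE F i) (l • fE F i)
  | X_E : BMWRel n m l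
      (altL (fX F 0) (fX F 1) (2 * n) * fE F 0) (fE F 1 * altL (fX F 0) (fX F 1) (2 * n))
  | E_X : BMWRel n m l
      (fE F 0 * altL (fX F 1) (fX F 0) (2 * n)) (altL (fX F 1) (fX F 0) (2 * n) * fE F 1)

/-- The dihedral BMW algebra `B_{I_2(2n+1)}(m, l)` over `F`. -/
def BMW (n : ℕ) (m l : F) : Type _ := RingQuot (BMWRel n m l)

noncomputable instance (n : ℕ) (m l : F) : Ring (BMW n m l) :=
  inferInstanceAs (Ring (RingQuot (BMWRel n m l)))

noncomputable instance (n : ℕ) (m l : F) : Algebra F (BMW n m l) :=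
  inferInstanceAs (Algebra F (RingQuot (BMWRel n m l)))

/-- The quotient map from the free algebra. -/
noncomputable def BMW.mk (n : ℕ) (m l : F) : FreeAlgebra F BMWGen →ₐ[F] BMW n m l :=
  RingQuot.mkAlgHom F (BMWRel n m l)

theorem BMW.mk_rel {n : ℕ} {m l : F} {x y : FreeAlgebra F BMWGen} (h : BMWRel n m l x y) :
    BMW.mk n m l x = BMW.mk n m l y :=
  RingQuot.mkAlgHom_rel F h

/-- The universal property of the presentation. -/
noncomputable def BMW.lift (n : ℕ) (m l : F) {A : Type*} [Semiring A] [Algebra F A]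
    (f : BMWGen → A)
    (hf : ∀ x y, BMWRel n m l x y → FreeAlgebra.lift F f x = FreeAlgebra.lift F f y) :
    BMW n m l →ₐ[F] A :=
  RingQuot.liftAlgHom F ⟨FreeAlgebra.lift F f, hf⟩

theorem BMW.lift_mk (n : ℕ) (m l : F) {A : Type*} [Semiring A] [Algebra F A]
    (f : BMWGen → A)
    (hf : ∀ x y, BMWRel n m l x y → FreeAlgebra.lift F f x = FreeAlgebra.lift F f y)
    (x : FreeAlgebra F BMWGen) :
    BMW.lift n m l f hf (BMW.mk n m l x) = FreeAlgebra.lift F f x :=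
  RingQuot.liftAlgHom_mkAlgHom_apply F _ _ x

/-- The canonical generators of `B_{I_2(2n+1)}(m, l)`, and the inverses of the `X_i`. -/
noncomputable def BMW.gen (n : ℕ) (m l : F) (g : BMWGen) : BMW n m l :=
  BMW.mk n m l (FreeAlgebra.ι F g)

noncomputable abbrev BMW.X (n : ℕ) (m l : F) (i : Fin 2) : BMW n m l := BMW.gen n m l (.X i)

noncomputable abbrev BMW.E (n : ℕ) (m l : F) (i : Fin 2) : BMW n m l := BMW.gen n m l (.E i)

/-- The homomorphism `B → Bᵐᵒᵖ` fixing every letter `X_i`, `X_i⁻¹`, `E_i`. -/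
noncomputable def BMW.revHom (n : ℕ) (m l : F) : BMW n m l →ₐ[F] (BMW n m l)ᵐᵒᵖ :=
  BMW.lift n m l (fun g => MulOpposite.op (BMW.gen n m l g)) (by
      have key : ∀ {x y}, BMWRel n m l x y → BMW.mk n m l x = BMW.mk n m l y := BMW.mk_rel
      rintro x y h
      apply MulOpposite.unop_injective
      cases h with
      | mul_inv i => simpa [BMW.gen] using key (.inv_mul i)
      | inv_mul i => simpa [BMW.gen] using key (.mul_inv i)
      | braid => simpa [BMW.gen, map_altL, altL_op, altR_odd] using key .braid
      | skein i => simpa [BMW.gen] using key (.skein i)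
      | X_mul_E i => simpa [BMW.gen] using key (.E_mul_X i)
      | E_mul_X i => simpa [BMW.gen] using key (.X_mul_E i)
      | E_mul_E i => simpa [BMW.gen] using key (.E_mul_E i)
      | E_X_E i k h1 h2 =>
        have hk := key (.E_X_E (n := n) (m := m) (l := l) i k h1 h2)
        obtain ⟨k, rfl⟩ := Nat.exists_eq_add_of_le' h1
        rw [show 2 * (k + 1) - 1 = 2 * k + 1 by omega] at hk ⊢
        simpa [BMW.gen, map_altL, altL_op, altR_odd, mul_assoc] using hk
      | E_Y_E i k h1 h2 =>
        have hk := key (.E_Y_E (n := n) (m := m) (l := l) i k h1 h2)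
        obtain ⟨k, rfl⟩ := Nat.exists_eq_add_of_le' h1
        rw [show 2 * (k + 1) - 1 = 2 * k + 1 by omega] at hk ⊢
        simpa [BMW.gen, map_altL, altL_op, altR_odd, mul_assoc] using hk
      | X_E => simpa [BMW.gen, map_altL, altL_op, altR_even] using key .E_X
      | E_X => simpa [BMW.gen, map_altL, altL_op, altR_even] using key .X_E)

/-- Word reversal on `B_{I_2(2n+1)}(m, l)`: the `F`-linear anti-endomorphism that reverses
every word in the letters `X_i`, `X_i⁻¹`, `E_i`. -/
noncomputable def BMW.rev (n : ℕ) (m l : F) : BMW n m l →ₗ[F] BMW n m l :=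
  (MulOpposite.opLinearEquiv F).symm.toLinearMap ∘ₗ (BMW.revHom n m l).toLinearMap

/-- The defining relations of the Hecke algebra of type `I_2(2n+1)` with parameter `v`. -/
inductive HeckeRel (n : ℕ) (v : F) : FreeAlgebra F (Fin 2) → FreeAlgebra F (Fin 2) → Prop
  | braid : HeckeRel n v
      (altL (FreeAlgebra.ι F 0) (FreeAlgebra.ι F 1) (2 * n + 1))
      (altL (FreeAlgebra.ι F 1) (FreeAlgebra.ι F 0) (2 * n + 1))
  | quadratic (i : Fin 2) : HeckeRel n v
      ((FreeAlgebra.ι F i + algebraMap F _ v) * (FreeAlgebra.ι F i - algebraMap F _ v⁻¹)) 0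

/-- The Hecke algebra `H_{I_2(2n+1)}(v)` over `F`. -/
def Hecke (n : ℕ) (v : F) : Type _ := RingQuot (HeckeRel n v)

noncomputable instance (n : ℕ) (v : F) : Ring (Hecke n v) :=
  inferInstanceAs (Ring (RingQuot (HeckeRel n v)))

noncomputable instance (n : ℕ) (v : F) : Algebra F (Hecke n v) :=
  inferInstanceAs (Algebra F (RingQuot (HeckeRel n v)))

/-- The quotient map from the free algebra. -/
noncomputable def Hecke.mk (n : ℕ) (v : F) : FreeAlgebra F (Fin 2) →ₐ[F] Hecke n v :=
  RingQuot.mkAlgHom F (HeckeRel n v)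

theorem Hecke.mk_rel {n : ℕ} {v : F} {x y : FreeAlgebra F (Fin 2)} (h : HeckeRel n v x y) :
    Hecke.mk n v x = Hecke.mk n v y :=
  RingQuot.mkAlgHom_rel F h

/-- The universal property of the presentation. -/
noncomputable def Hecke.lift (n : ℕ) (v : F) {A : Type*} [Semiring A] [Algebra F A]
    (f : (Fin 2) → A)
    (hf : ∀ x y, HeckeRel n v x y → FreeAlgebra.lift F f x = FreeAlgebra.lift F f y) :
    Hecke n v →ₐ[F] A :=
  RingQuot.liftAlgHom F ⟨FreeAlgebra.lift F f, hf⟩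

theorem Hecke.lift_mk (n : ℕ) (v : F) {A : Type*} [Semiring A] [Algebra F A]
    (f : (Fin 2) → A)
    (hf : ∀ x y, HeckeRel n v x y → FreeAlgebra.lift F f x = FreeAlgebra.lift F f y)
    (x : FreeAlgebra F (Fin 2)) :
    Hecke.lift n v f hf (Hecke.mk n v x) = FreeAlgebra.lift F f x :=
  RingQuot.liftAlgHom_mkAlgHom_apply F _ _ x

/-- The canonical generators `x_0`, `x_1` of `H_{I_2(2n+1)}(v)`. -/
noncomputable def Hecke.x (n : ℕ) (v : F) (i : Fin 2) : Hecke n v :=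
  Hecke.mk n v (FreeAlgebra.ι F i)

theorem Hecke.x_quadratic (n : ℕ) (v : F) (i : Fin 2) :
    (Hecke.x n v i + algebraMap F _ v) * (Hecke.x n v i - algebraMap F _ v⁻¹) = 0 := by
  have h := Hecke.mk_rel (HeckeRel.quadratic (n := n) (v := v) i)
  simpa only [Hecke.x, map_mul, map_add, map_sub, map_zero, AlgHom.commutes] using h

theorem Hecke.x_braid (n : ℕ) (v : F) :
    altL (Hecke.x n v 0) (Hecke.x n v 1) (2 * n + 1) =
      altL (Hecke.x n v 1) (Hecke.x n v 0) (2 * n + 1) := by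
  have h := Hecke.mk_rel (HeckeRel.braid (n := n) (v := v))
  simpa only [Hecke.x, map_altL] using h

/-- The homomorphism `H → Hᵐᵒᵖ` fixing `x_0` and `x_1`. -/
noncomputable def Hecke.revHom (n : ℕ) (v : F) : Hecke n v →ₐ[F] (Hecke n v)ᵐᵒᵖ :=
  Hecke.lift n v (fun i => MulOpposite.op (Hecke.x n v i)) (by
      rintro x y h
      apply MulOpposite.unop_injective
      cases h with
      | braid => simpa [map_altL, altL_op, altR_odd] using Hecke.x_braid n v
      | quadratic i =>
        have h := Hecke.x_quadratic n v i
        have hc : (Hecke.x n v i - algebraMap F _ v⁻¹) * (Hecke.x n v i + algebraMap F _ v)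
            = (Hecke.x n v i + algebraMap F _ v) * (Hecke.x n v i - algebraMap F _ v⁻¹) := by
          have c1 := Algebra.commutes v (Hecke.x n v i)
          have c2 := Algebra.commutes v⁻¹ (Hecke.x n v i)
          have c3 := Algebra.commutes v (algebraMap F (Hecke n v) v⁻¹)
          simp only [mul_add, add_mul, mul_sub, sub_mul, c1, c2, c3]
          abel
        rw [← hc] at h
        simpa only [map_mul, map_add, map_sub, map_zero, AlgHom.commutes,
          FreeAlgebra.lift_ι_apply, MulOpposite.unop_mul, MulOpposite.unop_add,
          MulOpposite.unop_sub, MulOpposite.unop_op, MulOpposite.unop_zero,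
          MulOpposite.algebraMap_apply] using h)

/-- Word reversal on `H_{I_2(2n+1)}(v)`: the `F`-linear anti-endomorphism that reverses every
word in `x_0`, `x_1`. -/
noncomputable def Hecke.rev (n : ℕ) (v : F) : Hecke n v →ₗ[F] Hecke n v :=
  (MulOpposite.opLinearEquiv F).symm.toLinearMap ∘ₗ (Hecke.revHom n v).toLinearMap

/-- The images `x_i`, `x_i⁻¹ = x_i + (v - v⁻¹)` and `0` of `X_i`, `X_i⁻¹` and `E_i`. -/
noncomputable def toHeckeGen (n : ℕ) (v : F) : BMWGen → Hecke n v
  | .X i => Hecke.x n v i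
  | .Y i => Hecke.x n v i + algebraMap F _ (v - v⁻¹)
  | .E _ => 0

/-- The quotient map `π : B_{I_2(2n+1)}(v - v⁻¹, l) → H_{I_2(2n+1)}(v)` with `X_i ↦ x_i` and
`E_i ↦ 0`. -/
noncomputable def toHecke (n : ℕ) (v l : F) (hv : v ≠ 0) :
    BMW n (v - v⁻¹) l →ₐ[F] Hecke n v :=
  BMW.lift n (v - v⁻¹) l (toHeckeGen n v) (by
      have hq : ∀ i, Hecke.x n v i * (Hecke.x n v i + algebraMap F _ (v - v⁻¹)) = 1 := by
        intro i
        have h := Hecke.x_quadratic n v i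
        have c1 := Algebra.commutes v (Hecke.x n v i)
        have c3 : algebraMap F (Hecke n v) v * algebraMap F (Hecke n v) v⁻¹ = 1 := by
          rw [← map_mul, mul_inv_cancel₀ hv, map_one]
        rw [← sub_eq_zero, ← h]
        simp only [map_sub, mul_add, add_mul, mul_sub, c1, c3]
        abel
      have hq' : ∀ i, (Hecke.x n v i + algebraMap F _ (v - v⁻¹)) * Hecke.x n v i = 1 := by
        intro i
        rw [← hq i, add_mul, mul_add, Algebra.commutes]
      rintro x y h
      cases h with
      | mul_inv i => simpa [toHeckeGen] using hq i
      | inv_mul i => simpa [toHeckeGen] using hq' i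
      | braid => simpa [map_altL, toHeckeGen] using Hecke.x_braid n v
      | skein i => simp [toHeckeGen, Algebra.smul_def]
      | _ => simp [toHeckeGen])

end BMW

section Cells

variable {F : Type*} [Field F] {Λ : Type u}

/-- The index sets of the cells: those of the given cells, and `{0, 1, …, 2n}` for the extra
bottom cell. The poset of the cells is `WithBot Λ`, with the extra cell `⊥` below all others. -/
def cellIndex (n : ℕ) (M : Λ → Type) : WithBot Λ → Type :=
  WithBot.recBotCoe (Fin (2 * n + 1)) M

instance cellIndexFintype (n : ℕ) (M : Λ → Type) [h : ∀ μ, Fintype (M μ)] :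
    ∀ μ : WithBot Λ, Fintype (cellIndex n M μ) :=
  WithBot.recBotCoe (inferInstanceAs (Fintype (Fin (2 * n + 1)))) h

/-- The elements attached to one cell lying over a Hecke cell, from a choice `D S T` of lifts
(for `S ≤ T`): `C_{S,T} = D_{S,T}` for `S < T`, `C_{S,T} = rev C_{T,S}` for `T < S`, and
`C_{S,S} = (D_{S,S} + rev D_{S,S}) / 2`. -/
noncomputable def liftCell {M : Type*} [LinearOrder M] (n : ℕ) (m l : F)
    (D : M → M → BMW n m l) (S T : M) : BMW n m l :=
  if S < T then D S T
  else if T < S then BMW.rev n m l (D T S)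
  else (2⁻¹ : F) • (D S S + BMW.rev n m l (D S S))

/-- The full family: the lifted elements in the cells from `Λ`, and
`C_{i,j} = [⋯X_0 X_1]_i E_0 [X_1 X_0 ⋯]_j`, `0 ≤ i, j ≤ 2n`, in the extra cell `⊥`. -/
noncomputable def cellElement (n : ℕ) (m l : F) (M : Λ → Type) [∀ μ, LinearOrder (M μ)]
    (D : ∀ μ, M μ → M μ → BMW n m l) :
    ∀ μ : WithBot Λ, cellIndex n M μ → cellIndex n M μ → BMW n m l :=
  WithBot.recBotCoe
    (fun i j : Fin (2 * n + 1) =>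
      altR (BMW.X n m l 0) (BMW.X n m l 1) i * BMW.E n m l 0 *
        altL (BMW.X n m l 1) (BMW.X n m l 0) j)
    (fun μ => liftCell (M := M μ) n m l (D μ))

end Cells

end DihedralBMW

/-! Everything rests on one fact: the elements `C_{i,j} = [⋯X_0X_1]_i E_0 [X_1X_0⋯]_j` form a basis
of the kernel of `π`. Granting this, lifts of a cellular basis of the Hecke algebra together with a
basis of `ker π` form a basis of `B`. The symmetrised lifts are compatible with word reversal, and
(C3) for a lifted cell holds because it holds modulo `ker π`, which is the span of the bottom cell
(`isCellDatum_cellElement`).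

Spanning: the columns `[⋯X_0X_1]_k E_0` with `k ≤ 2n` span a left ideal (`BMW.mul_mem_colSpan`).
Hence the span of the `C_{i,j}` is a left ideal, and by reversal a two-sided one. It contains both
`E_i`, and modulo it the `X_i` satisfy the Hecke relations, so it is all of `ker π`
(`mem_lkSpan_of_toHecke_eq_zero`).

Independence: `B` acts on `F ^ (2n+1)` by the Lawrence–Krammer representation `lkRep`, in which
`X_0, X_1` move the basis vectors `e_k` as they should move the columns, and `E_0, E_1` have rank
one. There `C_{i,j}` is the operator `u ↦ g_j(u) e_i` with `g_j = f_0 ∘ [X_1X_0⋯]_j`, so it is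
enough that the `g_j` are independent. Their span contains the forms `f_j = f_0 ∘ [X_1⁻¹X_0⁻¹⋯]_j`,
whose coefficient matrix is explicit; its determinant is nonzero because, after clearing
denominators, the specialisation `v = 1`, `l = 2` gives three times the identity. The hard relations
of the representation are those carrying `e_{2n}` back to `e_0` by words that produce correction
terms; `altR_ladder` shows that these cancel.

For the Hecke algebra, the elements `b_i = x_i + v` satisfy `b_i² = δ b_i` with `δ = v + v⁻¹`. A
quadratic expression `t` in them is central, and the braid relation becomes `Q_n(t)(b_0 - b_1) = 0`
(`altL_sub_altL`). The roots of `Q_n` are `c_j = 2 + ζ^(j+1) + ζ^(-j-1)`, which lie in `F` when `ζ +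
ζ⁻¹` does. Filtering by the partial products of the `t - c_j` gives the cells: one for the unit, one
with four elements for each `c_j`, and a last one with one element. Representations adapted to these
cells prove independence. -/

namespace DihedralBMW

/-! ### Alternating words -/

section AlternatingWords

variable {A : Type*} [Monoid A]

/-- The recursive definition splits off the last factor. An induction on the action on a vector
needs the first one, whose letter depends on the parity of the length. -/
theorem altR_succ (a b : A) (N : ℕ) :
    altR a b (N + 1) = (if Even N then b else a) * altR a b N := by
  induction N generalizing a b with
  | zero => simp [altR]
  | succ N ih =>
    change altR b a (N + 1) * b = _ * (altR b a N * b)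
    rw [ih, mul_assoc]
    congr 1
    by_cases h : Even N <;> simp [h, Nat.even_add_one]

theorem altL_succ (a b : A) (N : ℕ) :
    altL a b (N + 1) = altL a b N * (if Even N then a else b) := by
  induction N generalizing a b with
  | zero => simp [altL]
  | succ N ih =>
    change a * altL b a (N + 1) = a * altL b a N * _
    rw [ih, ← mul_assoc]
    congr 1
    by_cases h : Even N <;> simp [h, Nat.even_add_one]

theorem altR_mul_altL_eq_one {x x' y y' : A} (hx : x * x' = 1) (hy : y * y' = 1) (N : ℕ) :
    altR x y N * altL y' x' N = 1 := by
  induction N generalizing x x' y y' with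
  | zero => simp [altR, altL]
  | succ N ih =>
    change altR y x N * y * (y' * altL x' y' N) = 1
    rw [mul_assoc, ← mul_assoc y, hy, one_mul, ih hy hx]

theorem map_altR {B G : Type*} [Monoid B] [FunLike G A B] [MonoidHomClass G A B] (f : G)
    (a b : A) (N : ℕ) : f (altR a b N) = altR (f a) (f b) N := by
  induction N generalizing a b with
  | zero => simp [altR]
  | succ N ih => simp [altR, ih]

end AlternatingWords

/-! ### Cancellation of the correction terms along an alternating word -/

section Ladder

/-- A sequence `w_0, …, w_{2n}` on which two operators act by the Lawrence–Krammer formulas is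
run through from `w_0` to `w_{2n}` also by the alternating product of the inverse operators. -/
theorem altR_ladder {F W : Type*} [Field F] [AddCommGroup W] [Module F W] (n : ℕ) (m l : F)
    (Y₀ Y₁ : Module.End F W) (w : ℕ → W)
    (h00 : Y₀ (w 0) = l • w 0)
    (h0e : ∀ k < n, Y₀ (w (2 * k + 2)) = w (2 * k + 1))
    (h0o : ∀ k < n, Y₀ (w (2 * k + 1)) = w (2 * k + 2) - (m * l) • w 0 + m • w (2 * k + 1))
    (h1o : ∀ k < n, Y₁ (w (2 * k + 1)) = w (2 * k))
    (h1e : ∀ k < n, Y₁ (w (2 * k)) = w (2 * k + 1) - m • w (2 * n) + m • w (2 * k)) :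
    altR Y₀ Y₁ (2 * n) (w 0) = w (2 * n) := by
  -- The accumulated corrections pair each odd index with its mirror image under `q ↦ n - 1 - q`, so
  -- at `p = n` their sum vanishes by reflection.
  have key : ∀ p ≤ n, altR Y₀ Y₁ (2 * p) (w 0) = w (2 * p) +
      m • ∑ q ∈ Finset.range p, (w (2 * q + 1) - w (2 * (n - 1 - q) + 1)) := by
    intro p
    induction p with
    | zero => intro _; simp [altR]
    | succ p ih =>
      intro hp
      have hp' : p < n := hp
      have ih := ih hp'.le
      -- After an odd number of letters the corrections sit at even indices, mirrored by `q ↦ n -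
      -- q`. The two terms that `h1e` adds, `w (2p)` and `-w (2n)`, extend the two sums at opposite
      -- ends.
      have h1 : altR Y₀ Y₁ (2 * p + 1) (w 0) = w (2 * p + 1) +
          m • ∑ q ∈ Finset.range (p + 1), (w (2 * q) - w (2 * (n - q))) := by
        rw [altR_succ, if_pos (even_two_mul p), Module.End.mul_apply, ih, map_add, map_smul,
          map_sum, h1e p hp']
        have e : ∑ q ∈ Finset.range p, Y₁ (w (2 * q + 1) - w (2 * (n - 1 - q) + 1)) =
            ∑ q ∈ Finset.range p, w (2 * q) - ∑ q ∈ Finset.range p, w (2 * (n - (q + 1))) := by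
          rw [← Finset.sum_sub_distrib]
          refine Finset.sum_congr rfl fun q hq => ?_
          have hq := Finset.mem_range.1 hq
          rw [map_sub, h1o q (by omega), h1o _ (by omega), Nat.sub_sub, add_comm 1 q]
        rw [e, Finset.sum_sub_distrib, Finset.sum_range_succ,
          Finset.sum_range_succ' (fun q => w (2 * (n - q)))]
        simp only [Nat.sub_zero]
        module
      rw [show 2 * (p + 1) = 2 * p + 1 + 1 by ring, altR_succ,
        if_neg (Nat.not_even_two_mul_add_one p), Module.End.mul_apply, h1, map_add, map_smul,
        map_sum, h0o p hp']
      have e : ∑ q ∈ Finset.range (p + 1), Y₀ (w (2 * q) - w (2 * (n - q))) =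
          l • w 0 + ∑ q ∈ Finset.range p, w (2 * q + 1) -
            ∑ q ∈ Finset.range (p + 1), w (2 * (n - 1 - q) + 1) := by
        simp only [map_sub, Finset.sum_sub_distrib]
        congr 1
        · rw [Finset.sum_range_succ', mul_zero, h00, add_comm]
          congr 1
          refine Finset.sum_congr rfl fun q hq => ?_
          have hq := Finset.mem_range.1 hq
          exact h0e q (by omega)
        · refine Finset.sum_congr rfl fun q hq => ?_
          have hq := Finset.mem_range.1 hq
          rw [← h0e _ (by omega)]
          congr 2
          omega
      rw [e, Finset.sum_sub_distrib, Finset.sum_range_succ (fun q => w (2 * q + 1))]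
      module
  rw [key n le_rfl, Finset.sum_sub_distrib,
    Finset.sum_range_reflect (fun q => w (2 * q + 1)), sub_self, smul_zero, add_zero]

end Ladder

/-! ### The Lawrence–Krammer operators, vectors and forms -/

section LawrenceKrammer

variable {F : Type*} [Field F]

/-- The standard basis vector with index `k` of `F ^ (2n+1)`, and `0` for `k > 2n`. -/
def lkVec (F : Type*) [Field F] (n k : ℕ) : Fin (2 * n + 1) → F :=
  fun i => if (i : ℕ) = k then 1 else 0

/-- The linear map with prescribed values on the standard basis. -/
noncomputable def lkMap {W : Type*} [AddCommGroup W] [Module F W] (n : ℕ) (g : ℕ → W) :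
    (Fin (2 * n + 1) → F) →ₗ[F] W :=
  ∑ i : Fin (2 * n + 1), (LinearMap.proj i : (Fin (2 * n + 1) → F) →ₗ[F] F).smulRight (g i)

theorem lkMap_vec {W : Type*} [AddCommGroup W] [Module F W] (n : ℕ) (g : ℕ → W) {k : ℕ}
    (hk : k < 2 * n + 1) : lkMap n g (lkVec F n k) = g k := by
  have h : ∀ i : Fin (2 * n + 1), ((i : ℕ) = k) ↔ i = ⟨k, hk⟩ := fun i => by
    rw [Fin.ext_iff]
  simp [lkMap, lkVec, h]

theorem lk_ext {W : Type*} [AddCommGroup W] [Module F W] {n : ℕ}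
    {f g : (Fin (2 * n + 1) → F) →ₗ[F] W}
    (h : ∀ k < 2 * n + 1, f (lkVec F n k) = g (lkVec F n k)) : f = g := by
  refine LinearMap.pi_ext' fun i => LinearMap.ext_ring ?_
  have e : lkVec F n i = Pi.single i 1 := by
    ext j
    simp [lkVec, Pi.single_apply, Fin.ext_iff]
  simpa [e] using h i i.2

/-- The operators with index `0` have `e_0` as an eigenvector and link the pairs `e_{2p+1},
e_{2p+2}`, so this is the case split that suits them. For index `1` the eigenvector is `e_{2n}` and
the pairs are `e_{2p}, e_{2p+1}`. -/
theorem lk_ext_zero {W : Type*} [AddCommGroup W] [Module F W] {n : ℕ}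
    {f g : (Fin (2 * n + 1) → F) →ₗ[F] W} (h0 : f (lkVec F n 0) = g (lkVec F n 0))
    (ho : ∀ p < n, f (lkVec F n (2 * p + 1)) = g (lkVec F n (2 * p + 1)))
    (he : ∀ p < n, f (lkVec F n (2 * p + 2)) = g (lkVec F n (2 * p + 2))) : f = g := by
  refine lk_ext fun k hk => ?_
  rcases Nat.even_or_odd' k with ⟨p, rfl | rfl⟩
  · cases p with
    | zero => exact h0
    | succ p => exact he p (by omega)
  · exact ho p (by omega)

theorem lk_ext_last {W : Type*} [AddCommGroup W] [Module F W] {n : ℕ}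
    {f g : (Fin (2 * n + 1) → F) →ₗ[F] W} (h0 : f (lkVec F n (2 * n)) = g (lkVec F n (2 * n)))
    (he : ∀ p < n, f (lkVec F n (2 * p)) = g (lkVec F n (2 * p)))
    (ho : ∀ p < n, f (lkVec F n (2 * p + 1)) = g (lkVec F n (2 * p + 1))) : f = g := by
  refine lk_ext fun k hk => ?_
  rcases Nat.even_or_odd' k with ⟨p, rfl | rfl⟩
  · rcases (show p ≤ n by omega).eq_or_lt with rfl | hp
    · exact h0
    · exact he p hp
  · exact ho p (by omega)

/-- The coefficients in `E_0 [X_1⁻¹ X_0⁻¹ ⋯]_j [⋯ X_0 X_1]_k E_0 = lkCoeff j k • E_0`. -/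
def lkCoeff (m l : F) (j k : ℕ) : F :=
  if k = j then (l - l⁻¹) / m + 1 else if k % 2 = j % 2 then 1 else if k < j then l else l⁻¹

/-- The linear form with coefficients `lkCoeff m l j`. -/
noncomputable def lkForm (n : ℕ) (m l : F) (j : ℕ) : (Fin (2 * n + 1) → F) →ₗ[F] F :=
  lkMap n (lkCoeff m l j)

theorem lkForm_vec (n : ℕ) (m l : F) (j : ℕ) {k : ℕ} (hk : k < 2 * n + 1) :
    lkForm n m l j (lkVec F n k) = lkCoeff m l j k :=
  lkMap_vec n _ hk

/-- The operators `E_0` and `E_1` of the Lawrence–Krammer representation. -/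
noncomputable def lkE (n : ℕ) (m l : F) (i : Fin 2) : Module.End F (Fin (2 * n + 1) → F) :=
  ![(lkForm n m l 0).smulRight (lkVec F n 0),
    (lkForm n m l (2 * n)).smulRight (lkVec F n (2 * n))] i

/-- The operators `X_0` and `X_1` of the Lawrence–Krammer representation. -/
noncomputable def lkX (n : ℕ) (m l : F) (i : Fin 2) : Module.End F (Fin (2 * n + 1) → F) :=
  ![lkMap n fun k => if k = 0 then l • lkVec F n 0 else if k % 2 = 1 then lkVec F n (k + 1) else
      lkVec F n (k - 1) + m • lkVec F n 0 - m • lkVec F n k,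
    lkMap n fun k => if k = 2 * n then l • lkVec F n (2 * n) else
      if k % 2 = 0 then lkVec F n (k + 1) else
      lkVec F n (k - 1) + (m * l) • lkVec F n (2 * n) - m • lkVec F n k] i

/-- The inverses of the operators `X_0` and `X_1` of the Lawrence–Krammer representation. -/
noncomputable def lkY (n : ℕ) (m l : F) (i : Fin 2) : Module.End F (Fin (2 * n + 1) → F) :=
  lkX n m l i - m • (lkE n m l i - 1)

theorem lkE_zero_apply (n : ℕ) (m l : F) (x : Fin (2 * n + 1) → F) :
    lkE n m l 0 x = lkForm n m l 0 x • lkVec F n 0 := rfl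

theorem lkE_one_apply (n : ℕ) (m l : F) (x : Fin (2 * n + 1) → F) :
    lkE n m l 1 x = lkForm n m l (2 * n) x • lkVec F n (2 * n) := rfl

theorem lkX_zero_zero (n : ℕ) (m l : F) : lkX n m l 0 (lkVec F n 0) = l • lkVec F n 0 := by
  simp [lkX, lkMap_vec]

theorem lkX_zero_odd (n : ℕ) (m l : F) (p : ℕ) (hp : p < n) :
    lkX n m l 0 (lkVec F n (2 * p + 1)) = lkVec F n (2 * p + 2) := by
  have : 2 * p + 1 < 2 * n + 1 := by omega
  simp [lkX, lkMap_vec, this, Nat.add_mod]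

theorem lkX_zero_even (n : ℕ) (m l : F) (p : ℕ) (hp : p < n) :
    lkX n m l 0 (lkVec F n (2 * p + 2)) =
      lkVec F n (2 * p + 1) + m • lkVec F n 0 - m • lkVec F n (2 * p + 2) := by
  have : 2 * p + 2 < 2 * n + 1 := by omega
  simp [lkX, lkMap_vec, this]

theorem lkX_one_last (n : ℕ) (m l : F) :
    lkX n m l 1 (lkVec F n (2 * n)) = l • lkVec F n (2 * n) := by
  simp [lkX, lkMap_vec]

theorem lkX_one_even (n : ℕ) (m l : F) (p : ℕ) (hp : p < n) :
    lkX n m l 1 (lkVec F n (2 * p)) = lkVec F n (2 * p + 1) := by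
  have h : 2 * p < 2 * n + 1 := by omega
  have h' : p ≠ n := hp.ne
  simp [lkX, lkMap_vec, h, h']

theorem lkX_one_odd (n : ℕ) (m l : F) (p : ℕ) (hp : p < n) :
    lkX n m l 1 (lkVec F n (2 * p + 1)) =
      lkVec F n (2 * p) + (m * l) • lkVec F n (2 * n) - m • lkVec F n (2 * p + 1) := by
  have h : 2 * p + 1 < 2 * n + 1 := by omega
  have h' : 2 * p + 1 ≠ 2 * n := by omega
  have h'' : (2 * p + 1) % 2 = 1 := by omega
  simp [lkX, lkMap_vec, h, h', h'']

theorem lkCoeff_self (m l : F) (j : ℕ) : lkCoeff m l j j = (l - l⁻¹) / m + 1 := if_pos rfl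

theorem lkCoeff_of_parity_eq (m l : F) {j k : ℕ} (h : k ≠ j) (h' : k % 2 = j % 2) :
    lkCoeff m l j k = 1 := by
  rw [lkCoeff, if_neg h, if_pos h']

theorem lkCoeff_of_lt (m l : F) {j k : ℕ} (h : k < j) (h' : k % 2 ≠ j % 2) :
    lkCoeff m l j k = l := by
  rw [lkCoeff, if_neg h.ne, if_neg h', if_pos h]

theorem lkCoeff_of_gt (m l : F) {j k : ℕ} (h : j < k) (h' : k % 2 ≠ j % 2) :
    lkCoeff m l j k = l⁻¹ := by
  rw [lkCoeff, if_neg h.ne', if_neg h', if_neg h.not_gt]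

theorem lkY_zero_zero (n : ℕ) {m : F} (hm : m ≠ 0) (l : F) :
    lkY n m l 0 (lkVec F n 0) = l⁻¹ • lkVec F n 0 := by
  have e : m • (((l - l⁻¹) / m + 1) • lkVec F n 0) = (l - l⁻¹ + m) • lkVec F n 0 := by
    rw [smul_smul]; congr 1; field_simp
  simp only [lkY, LinearMap.sub_apply, LinearMap.smul_apply, Module.End.one_apply,
    lkE_zero_apply, lkX_zero_zero, lkForm_vec n m l 0 (Nat.succ_pos _), lkCoeff_self, smul_sub, e]
  module

theorem lkY_zero_odd (n : ℕ) (m l : F) (p : ℕ) (hp : p < n) :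
    lkY n m l 0 (lkVec F n (2 * p + 1)) =
      lkVec F n (2 * p + 2) - (m * l⁻¹) • lkVec F n 0 + m • lkVec F n (2 * p + 1) := by
  simp only [lkY, LinearMap.sub_apply, LinearMap.smul_apply, Module.End.one_apply,
    lkE_zero_apply, lkX_zero_odd n m l p hp,
    lkForm_vec n m l 0 (show 2 * p + 1 < 2 * n + 1 by omega),
    lkCoeff_of_gt m l (show 0 < 2 * p + 1 by omega) (by omega)]
  module

theorem lkY_zero_even (n : ℕ) (m l : F) (p : ℕ) (hp : p < n) :
    lkY n m l 0 (lkVec F n (2 * p + 2)) = lkVec F n (2 * p + 1) := by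
  simp only [lkY, LinearMap.sub_apply, LinearMap.smul_apply, Module.End.one_apply,
    lkE_zero_apply, lkX_zero_even n m l p hp,
    lkForm_vec n m l 0 (show 2 * p + 2 < 2 * n + 1 by omega),
    lkCoeff_of_parity_eq m l (show 2 * p + 2 ≠ 0 by omega) (by omega)]
  module

theorem lkY_one_last (n : ℕ) {m : F} (hm : m ≠ 0) (l : F) :
    lkY n m l 1 (lkVec F n (2 * n)) = l⁻¹ • lkVec F n (2 * n) := by
  have e : m • (((l - l⁻¹) / m + 1) • lkVec F n (2 * n)) =
      (l - l⁻¹ + m) • lkVec F n (2 * n) := by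
    rw [smul_smul]; congr 1; field_simp
  simp only [lkY, LinearMap.sub_apply, LinearMap.smul_apply, Module.End.one_apply,
    lkE_one_apply, lkX_one_last, lkForm_vec n m l (2 * n) (Nat.lt_succ_self _), lkCoeff_self,
    smul_sub, e]
  module

theorem lkY_one_even (n : ℕ) (m l : F) (p : ℕ) (hp : p < n) :
    lkY n m l 1 (lkVec F n (2 * p)) =
      lkVec F n (2 * p + 1) - m • lkVec F n (2 * n) + m • lkVec F n (2 * p) := by
  simp only [lkY, LinearMap.sub_apply, LinearMap.smul_apply, Module.End.one_apply,
    lkE_one_apply, lkX_one_even n m l p hp,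
    lkForm_vec n m l (2 * n) (show 2 * p < 2 * n + 1 by omega),
    lkCoeff_of_parity_eq m l (show 2 * p ≠ 2 * n by omega) (by omega)]
  module

theorem lkY_one_odd (n : ℕ) (m l : F) (p : ℕ) (hp : p < n) :
    lkY n m l 1 (lkVec F n (2 * p + 1)) = lkVec F n (2 * p) := by
  simp only [lkY, LinearMap.sub_apply, LinearMap.smul_apply, Module.End.one_apply,
    lkE_one_apply, lkX_one_odd n m l p hp,
    lkForm_vec n m l (2 * n) (show 2 * p + 1 < 2 * n + 1 by omega),
    lkCoeff_of_lt m l (show 2 * p + 1 < 2 * n by omega) (by omega)]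
  module

theorem lkX_mul_lkY (n : ℕ) {m l : F} (hm : m ≠ 0) (hl : l ≠ 0) (i : Fin 2) :
    lkX n m l i * lkY n m l i = 1 := by
  fin_cases i
  · refine lk_ext_zero ?_ (fun p hp => ?_) (fun p hp => ?_)
    · simp [lkY_zero_zero n hm, lkX_zero_zero, smul_smul, hl]
    · simp only [Fin.zero_eta, Module.End.mul_apply, lkY_zero_odd n m l p hp, map_add, map_sub,
        map_smul, lkX_zero_odd n m l p hp, lkX_zero_even n m l p hp, lkX_zero_zero, smul_smul,
        Module.End.one_apply, mul_assoc, inv_mul_cancel₀ hl]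
      module
    · simp only [Fin.zero_eta, Module.End.mul_apply, lkY_zero_even n m l p hp,
        lkX_zero_odd n m l p hp, Module.End.one_apply]
  · refine lk_ext_last ?_ (fun p hp => ?_) (fun p hp => ?_)
    · simp [lkY_one_last n hm, lkX_one_last, smul_smul, hl]
    · simp only [Fin.mk_one, Module.End.mul_apply, lkY_one_even n m l p hp, map_add, map_sub,
        map_smul, lkX_one_odd n m l p hp, lkX_one_even n m l p hp, lkX_one_last, smul_smul,
        Module.End.one_apply]
      module
    · simp only [Fin.mk_one, Module.End.mul_apply, lkY_one_odd n m l p hp,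
        lkX_one_even n m l p hp, Module.End.one_apply]

theorem lkY_mul_lkX (n : ℕ) {m l : F} (hm : m ≠ 0) (hl : l ≠ 0) (i : Fin 2) :
    lkY n m l i * lkX n m l i = 1 :=
  mul_eq_one_comm.1 (lkX_mul_lkY n hm hl i)

theorem lkX_mul_lkE (n : ℕ) (m l : F) (i : Fin 2) :
    lkX n m l i * lkE n m l i = l • lkE n m l i := by
  fin_cases i <;> refine LinearMap.ext fun x => ?_
  · simp [lkE_zero_apply, lkX_zero_zero, smul_smul, mul_comm]
  · simp only [Fin.mk_one, Module.End.mul_apply, LinearMap.smul_apply, lkE_one_apply, map_smul,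
      lkX_one_last]
    module

theorem lkCoeff_even_even (m l : F) (q p : ℕ) :
    lkCoeff m l (2 * q) (2 * p) = if p = q then (l - l⁻¹) / m + 1 else 1 := by
  simp [lkCoeff]

theorem lkCoeff_odd_odd (m l : F) (q p : ℕ) :
    lkCoeff m l (2 * q + 1) (2 * p + 1) = if p = q then (l - l⁻¹) / m + 1 else 1 := by
  simp [lkCoeff, Nat.add_mod]

theorem lkCoeff_even_odd (m l : F) (q p : ℕ) :
    lkCoeff m l (2 * q) (2 * p + 1) = if p < q then l else l⁻¹ := by
  rw [lkCoeff, if_neg (by omega), if_neg (by omega)]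
  exact if_congr (by omega) rfl rfl

theorem lkCoeff_odd_even (m l : F) (q p : ℕ) :
    lkCoeff m l (2 * q + 1) (2 * p) = if p ≤ q then l else l⁻¹ := by
  rw [lkCoeff, if_neg (by omega), if_neg (by omega)]
  exact if_congr (by omega) rfl rfl

theorem lkForm_even_even (m l : F) {n p : ℕ} (q : ℕ) (hp : p ≤ n) :
    lkForm n m l (2 * q) (lkVec F n (2 * p)) = if p = q then (l - l⁻¹) / m + 1 else 1 := by
  rw [lkForm_vec n m l _ (by omega), lkCoeff_even_even]

theorem lkForm_odd_odd (m l : F) {n p : ℕ} (q : ℕ) (hp : p < n) :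
    lkForm n m l (2 * q + 1) (lkVec F n (2 * p + 1)) =
      if p = q then (l - l⁻¹) / m + 1 else 1 := by
  rw [lkForm_vec n m l _ (by omega), lkCoeff_odd_odd]

theorem lkForm_even_odd (m l : F) {n p : ℕ} (q : ℕ) (hp : p < n) :
    lkForm n m l (2 * q) (lkVec F n (2 * p + 1)) = if p < q then l else l⁻¹ := by
  rw [lkForm_vec n m l _ (by omega), lkCoeff_even_odd]

theorem lkForm_odd_even (m l : F) {n p : ℕ} (q : ℕ) (hp : p ≤ n) :
    lkForm n m l (2 * q + 1) (lkVec F n (2 * p)) = if p ≤ q then l else l⁻¹ := by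
  rw [lkForm_vec n m l _ (by omega), lkCoeff_odd_even]

theorem lkForm_zero_lkY (n : ℕ) {m l : F} (hm : m ≠ 0) (hl : l ≠ 0) :
    lkForm n m l 0 ∘ₗ lkY n m l 0 = l⁻¹ • lkForm n m l 0 := by
  have e0 : ∀ p ≤ n, lkForm n m l 0 (lkVec F n (2 * p)) = if p = 0 then (l - l⁻¹) / m + 1 else 1 :=
    fun p hp => lkForm_even_even m l 0 hp
  have e1 : ∀ p < n, lkForm n m l 0 (lkVec F n (2 * p + 1)) = l⁻¹ := fun p hp => by
    simpa using lkForm_even_odd m l 0 hp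
  refine lk_ext_zero ?_ (fun p hp => ?_) (fun p hp => ?_)
  · simp [lkY_zero_zero n hm]
  · have e00 := e0 0 n.zero_le
    have e02 := e0 (p + 1) hp
    simp only [mul_zero, Nat.succ_ne_zero, if_true, if_false, mul_add_one] at e00 e02
    simp only [LinearMap.comp_apply, lkY_zero_odd n m l p hp, map_add, map_sub, map_smul,
      LinearMap.smul_apply, smul_eq_mul, e00, e02, e1 p hp]
    field_simp
    ring
  · have e02 := e0 (p + 1) hp
    simp only [Nat.succ_ne_zero, if_false, mul_add_one] at e02
    simp [lkY_zero_even n m l p hp, e02, e1 p hp]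

theorem lkForm_last_lkY (n : ℕ) {m l : F} (hm : m ≠ 0) (hl : l ≠ 0) :
    lkForm n m l (2 * n) ∘ₗ lkY n m l 1 = l⁻¹ • lkForm n m l (2 * n) := by
  refine lk_ext_last ?_ (fun p hp => ?_) (fun p hp => ?_)
  · simp [lkY_one_last n hm]
  · simp only [LinearMap.comp_apply, lkY_one_even n m l p hp, map_add, map_sub, map_smul,
      LinearMap.smul_apply, smul_eq_mul, lkForm_even_even m l n le_rfl,
      lkForm_even_even m l n hp.le, lkForm_even_odd m l n hp, if_pos hp, if_neg hp.ne, if_true]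
    field_simp
    ring
  · simp [lkY_one_odd n m l p hp, lkForm_even_even m l n hp.le, lkForm_even_odd m l n hp, hp,
      hp.ne, hl]

/-- Inverse letters run upwards through the forms without correction terms, as the `X_i` run upwards
through the vectors. The comparison of `p` with `q` in the proof locates the place where the
coefficient changes from `l` to `l⁻¹`; the value of `τ` enters exactly at equality. -/
theorem lkForm_even_lkY (n : ℕ) {m l : F} (hm : m ≠ 0) (hl : l ≠ 0) {q : ℕ} (hq : q < n) :
    lkForm n m l (2 * q) ∘ₗ lkY n m l 1 = lkForm n m l (2 * q + 1) := by
  refine lk_ext_last ?_ (fun p hp => ?_) (fun p hp => ?_)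
  · simp [lkY_one_last n hm, lkForm_even_even, lkForm_odd_even, hq, hq.ne']
  · simp only [LinearMap.comp_apply, lkY_one_even n m l p hp, map_add, map_sub, map_smul,
      smul_eq_mul, lkForm_even_even m l q le_rfl, lkForm_even_even m l q hp.le,
      lkForm_even_odd m l q hp, lkForm_odd_even m l q hp.le, if_neg hq.ne']
    rcases lt_trichotomy p q with h | rfl | h
    · simp only [h, h.ne, h.le, if_true, if_false]
      ring
    · simp only [lt_irrefl, le_rfl, if_true, if_false]
      field_simp
      ring
    · simp only [h.ne', h.not_gt, h.not_ge, if_false]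
      ring
  · simp only [LinearMap.comp_apply, lkY_one_odd n m l p hp, lkForm_even_even m l q hp.le,
      lkForm_odd_odd m l q hp]

theorem lkForm_odd_lkY (n : ℕ) {m l : F} (hm : m ≠ 0) (hl : l ≠ 0) {q : ℕ} (hq : q < n) :
    lkForm n m l (2 * q + 1) ∘ₗ lkY n m l 0 = lkForm n m l (2 * q + 2) := by
  have e0 : ∀ q', lkForm n m l (2 * q') (lkVec F n 0) = _ := fun q' =>
    lkForm_even_even m l q' n.zero_le
  have e1 : ∀ q', lkForm n m l (2 * q' + 1) (lkVec F n 0) = _ := fun q' =>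
    lkForm_odd_even m l q' n.zero_le
  rw [show 2 * q + 2 = 2 * (q + 1) by ring]
  refine lk_ext_zero ?_ (fun p hp => ?_) (fun p hp => ?_)
  · simp [lkY_zero_zero n hm, e0, e1, hl]
  · simp only [LinearMap.comp_apply, lkY_zero_odd n m l p hp, map_add, map_sub, map_smul,
      smul_eq_mul, e1, show 2 * p + 2 = 2 * (p + 1) by ring,
      lkForm_odd_even m l q (show p + 1 ≤ n from hp), lkForm_odd_odd m l q hp,
      lkForm_even_odd m l (q + 1) hp, q.zero_le, if_true]
    rcases lt_trichotomy p q with h | rfl | h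
    · simp only [show p + 1 ≤ q from h, h.ne, show p < q + 1 by omega, if_true, if_false]
      field_simp
      ring
    · simp only [show ¬ p + 1 ≤ p by omega, show p < p + 1 by omega, if_true, if_false]
      field_simp
      ring
    · simp only [show ¬ p + 1 ≤ q by omega, h.ne', show ¬ p < q + 1 by omega, if_false]
      field_simp
      ring
  · rw [LinearMap.comp_apply, lkY_zero_even n m l p hp, lkForm_odd_odd m l q hp]
    simp only [show 2 * p + 2 = 2 * (p + 1) by ring, lkForm_even_even m l (q + 1) (show p + 1 ≤ n from hp),
      add_left_inj]

/-- Cancelling the inverse letter in the upward step gives the downward step. -/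
theorem lkForm_even_lkX (n : ℕ) {m l : F} (hm : m ≠ 0) (hl : l ≠ 0) {q : ℕ} (hq : q < n) :
    lkForm n m l (2 * q + 2) ∘ₗ lkX n m l 0 = lkForm n m l (2 * q + 1) := by
  rw [← lkForm_odd_lkY n hm hl hq, LinearMap.comp_assoc, ← Module.End.mul_eq_comp,
    lkY_mul_lkX n hm hl, Module.End.one_eq_id, LinearMap.comp_id]

theorem lkForm_odd_lkX (n : ℕ) {m l : F} (hm : m ≠ 0) (hl : l ≠ 0) {q : ℕ} (hq : q < n) :
    lkForm n m l (2 * q + 1) ∘ₗ lkX n m l 1 = lkForm n m l (2 * q) := by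
  rw [← lkForm_even_lkY n hm hl hq, LinearMap.comp_assoc, ← Module.End.mul_eq_comp,
    lkY_mul_lkX n hm hl, Module.End.one_eq_id, LinearMap.comp_id]

theorem lkForm_zero_lkX (n : ℕ) {m l : F} (hm : m ≠ 0) (hl : l ≠ 0) :
    lkForm n m l 0 ∘ₗ lkX n m l 0 = l • lkForm n m l 0 := by
  have h := congrArg (fun f => l • (f ∘ₗ lkX n m l 0)) (lkForm_zero_lkY n hm hl)
  simpa only [LinearMap.comp_assoc, ← Module.End.mul_eq_comp, lkY_mul_lkX n hm hl,
    Module.End.one_eq_id, LinearMap.comp_id, LinearMap.smul_comp, smul_smul,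
    mul_inv_cancel₀ hl, one_smul, eq_comm] using h

theorem lkForm_last_lkX (n : ℕ) {m l : F} (hm : m ≠ 0) (hl : l ≠ 0) :
    lkForm n m l (2 * n) ∘ₗ lkX n m l 1 = l • lkForm n m l (2 * n) := by
  have h := congrArg (fun f => l • (f ∘ₗ lkX n m l 1)) (lkForm_last_lkY n hm hl)
  simpa only [LinearMap.comp_assoc, ← Module.End.mul_eq_comp, lkY_mul_lkX n hm hl,
    Module.End.one_eq_id, LinearMap.comp_id, LinearMap.smul_comp, smul_smul,
    mul_inv_cancel₀ hl, one_smul, eq_comm] using h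

theorem lkE_mul_lkX (n : ℕ) {m l : F} (hm : m ≠ 0) (hl : l ≠ 0) (i : Fin 2) :
    lkE n m l i * lkX n m l i = l • lkE n m l i := by
  fin_cases i <;> refine LinearMap.ext fun x => ?_
  · have h := LinearMap.congr_fun (lkForm_zero_lkX n hm hl) x
    simp only [LinearMap.comp_apply, LinearMap.smul_apply] at h
    simp [lkE_zero_apply, h, smul_smul]
  · have h := LinearMap.congr_fun (lkForm_last_lkX n hm hl) x
    simp only [LinearMap.comp_apply, LinearMap.smul_apply] at h
    simp [lkE_one_apply, h, smul_smul]

end LawrenceKrammer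

/-! ### The defining relations in the Lawrence–Krammer representation -/

section LawrenceKrammerRelations

variable {F : Type*} [Field F]

/-- Transposition reverses products. This makes `altR_ladder` available for forms as well as for
vectors. -/
theorem altR_dualMap_apply {V : Type*} [AddCommGroup V] [Module F V] (a b : Module.End F V)
    (N : ℕ) (f : Module.Dual F V) :
    altR (A := Module.End F (Module.Dual F V)) a.dualMap b.dualMap N f = f ∘ₗ altL b a N := by
  induction N generalizing a b f with
  | zero => rfl
  | succ N ih =>
    change altR (A := Module.End F (Module.Dual F V)) b.dualMap a.dualMap N (b.dualMap f) = _
    rw [ih]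
    rfl

theorem altR_lkX_apply (n : ℕ) (m l : F) {j : ℕ} (hj : j ≤ 2 * n) :
    altR (lkX n m l 0) (lkX n m l 1) j (lkVec F n 0) = lkVec F n j := by
  induction j with
  | zero => rfl
  | succ j ih =>
    rw [altR_succ, Module.End.mul_apply, ih (by omega)]
    rcases Nat.even_or_odd' j with ⟨p, rfl | rfl⟩
    · rw [if_pos (even_two_mul p), lkX_one_even n m l p (by omega)]
    · rw [if_neg (Nat.not_even_two_mul_add_one p), lkX_zero_odd n m l p (by omega)]

theorem altR_lkY_apply (n : ℕ) (m l : F) {j : ℕ} (hj : j ≤ 2 * n) :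
    altR (lkY n m l 1) (lkY n m l 0) j (lkVec F n (2 * n)) = lkVec F n (2 * n - j) := by
  induction j with
  | zero => rfl
  | succ j ih =>
    rw [altR_succ, Module.End.mul_apply, ih (by omega)]
    rcases Nat.even_or_odd' j with ⟨p, rfl | rfl⟩
    · rw [if_pos (even_two_mul p), show 2 * n - 2 * p = 2 * (n - p - 1) + 2 by omega,
        lkY_zero_even n m l _ (by omega)]
      congr 1
      omega
    · rw [if_neg (Nat.not_even_two_mul_add_one p),
        show 2 * n - (2 * p + 1) = 2 * (n - p - 1) + 1 by omega, lkY_one_odd n m l _ (by omega)]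
      congr 1
      omega

theorem lkForm_comp_altL_lkY (n : ℕ) {m l : F} (hm : m ≠ 0) (hl : l ≠ 0) {j : ℕ}
    (hj : j ≤ 2 * n) :
    lkForm n m l 0 ∘ₗ altL (lkY n m l 1) (lkY n m l 0) j = lkForm n m l j := by
  induction j with
  | zero => rfl
  | succ j ih =>
    rw [altL_succ, Module.End.mul_eq_comp, ← LinearMap.comp_assoc, ih (by omega)]
    rcases Nat.even_or_odd' j with ⟨p, rfl | rfl⟩
    · rw [if_pos (even_two_mul p), lkForm_even_lkY n hm hl (by omega)]
    · rw [if_neg (Nat.not_even_two_mul_add_one p), lkForm_odd_lkY n hm hl (by omega)]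

theorem lkForm_comp_altL_lkX (n : ℕ) {m l : F} (hm : m ≠ 0) (hl : l ≠ 0) {j : ℕ}
    (hj : j ≤ 2 * n) :
    lkForm n m l (2 * n) ∘ₗ altL (lkX n m l 0) (lkX n m l 1) j = lkForm n m l (2 * n - j) := by
  induction j with
  | zero => rfl
  | succ j ih =>
    rw [altL_succ, Module.End.mul_eq_comp, ← LinearMap.comp_assoc, ih (by omega)]
    rcases Nat.even_or_odd' j with ⟨p, rfl | rfl⟩
    · rw [if_pos (even_two_mul p), show 2 * n - 2 * p = 2 * (n - p - 1) + 2 by omega,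
        lkForm_even_lkX n hm hl (by omega)]
      congr 1
      omega
    · rw [if_neg (Nat.not_even_two_mul_add_one p),
        show 2 * n - (2 * p + 1) = 2 * (n - p - 1) + 1 by omega, lkForm_odd_lkX n hm hl (by omega)]
      congr 1
      omega

/-- Going down by the `X_i` creates corrections. The ladder for the inverse operators, with `l⁻¹` in
place of `l`, climbs from `e_0` to `e_{2n}`, and inverting that word gives the claim. -/
theorem altL_lkX_apply_last (n : ℕ) {m l : F} (hm : m ≠ 0) (hl : l ≠ 0) :
    altL (lkX n m l 1) (lkX n m l 0) (2 * n) (lkVec F n (2 * n)) = lkVec F n 0 := by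
  have h := altR_ladder n m l⁻¹ (lkY n m l 0) (lkY n m l 1) (lkVec F n) (lkY_zero_zero n hm l)
    (lkY_zero_even n m l) (lkY_zero_odd n m l) (lkY_one_odd n m l) (lkY_one_even n m l)
  rw [altR_even] at h
  have h' := altR_mul_altL_eq_one (lkX_mul_lkY n hm hl 1) (lkX_mul_lkY n hm hl 0) (2 * n)
  rw [← h, ← altR_even, ← Module.End.mul_apply, h', Module.End.one_apply]

/-- This is the ladder on the dual space. Since `X_i = X_i⁻¹ + m E_i - m`, the transposed `X_i` act
on the forms by the same formulas as the inverses act on the vectors, with `-m` for `m`. -/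
theorem lkForm_zero_comp_altL_lkX (n : ℕ) {m l : F} (hm : m ≠ 0) (hl : l ≠ 0) :
    lkForm n m l 0 ∘ₗ altL (lkX n m l 1) (lkX n m l 0) (2 * n) = lkForm n m l (2 * n) := by
  have hX : ∀ i, lkX n m l i = lkY n m l i + m • lkE n m l i - m • 1 := fun i => by
    rw [lkY]; module
  rw [← altR_dualMap_apply]
  refine altR_ladder n (-m) l _ _ (lkForm n m l) (lkForm_zero_lkX n hm hl)
    (fun q hq => lkForm_even_lkX n hm hl hq) (fun q hq => ?_)
    (fun q hq => lkForm_odd_lkX n hm hl hq) (fun q hq => ?_)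
  · refine LinearMap.ext fun x => ?_
    have h := LinearMap.congr_fun (lkForm_odd_lkY n hm hl hq) x
    have e : lkForm n m l (2 * q + 1) (lkVec F n 0) = l := by
      simpa using lkForm_odd_even m l q n.zero_le
    rw [LinearMap.comp_apply] at h
    simp only [LinearMap.dualMap_apply, hX 0, LinearMap.sub_apply, LinearMap.add_apply,
      LinearMap.smul_apply, map_add, map_sub, map_smul, h, lkE_zero_apply, e,
      Module.End.one_apply, smul_eq_mul]
    ring
  · refine LinearMap.ext fun x => ?_
    have h := LinearMap.congr_fun (lkForm_even_lkY n hm hl hq) x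
    have e : lkForm n m l (2 * q) (lkVec F n (2 * n)) = 1 := by
      simpa [hq.ne'] using lkForm_even_even m l q (le_refl n)
    rw [LinearMap.comp_apply] at h
    simp only [LinearMap.dualMap_apply, hX 1, LinearMap.sub_apply, LinearMap.add_apply,
      LinearMap.smul_apply, map_add, map_sub, map_smul, h, lkE_one_apply, e,
      Module.End.one_apply, smul_eq_mul]
    ring

theorem lkX_mul_lkX (n : ℕ) {m l : F} (hm : m ≠ 0) (hl : l ≠ 0) (i : Fin 2) :
    lkX n m l i * lkX n m l i = 1 - m • lkX n m l i + (m * l) • lkE n m l i := by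
  have h := lkY_mul_lkX n hm hl i
  rw [lkY, sub_mul, smul_mul_assoc, sub_mul, lkE_mul_lkX n hm hl, one_mul] at h
  rw [← h]
  module

/-- The two sides are compared on `e_k` by induction. As `e_{k+1}` is `x e_k` or `y e_k`, the
induction hypothesis moves the alternating word past one letter, after which a square `x²` or `y²`
remains on each side. The quadratic relation expands both, and the rank-one terms agree because `T`
and `T'` exchange `e_0` with `e_{2n}` and `f_0` with `f_{2n}`. -/
theorem lkX_braid (n : ℕ) {m l : F} (hm : m ≠ 0) (hl : l ≠ 0) :
    altL (lkX n m l 0) (lkX n m l 1) (2 * n + 1) =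
      altL (lkX n m l 1) (lkX n m l 0) (2 * n + 1) := by
  set x := lkX n m l 0 with hx
  set y := lkX n m l 1 with hy
  set T := altL x y (2 * n) with hT
  set T' := altL y x (2 * n) with hT'
  have a1 : altL x y (2 * n + 1) = x * T' := rfl
  have a2 : altL x y (2 * n + 1) = T * x := by rw [altL_succ, if_pos (even_two_mul n)]
  have b1 : altL y x (2 * n + 1) = y * T := rfl
  have b2 : altL y x (2 * n + 1) = T' * y := by rw [altL_succ, if_pos (even_two_mul n)]
  have hT0 : T (lkVec F n 0) = lkVec F n (2 * n) := by
    rw [hT, ← altR_even, altR_lkX_apply n m l le_rfl]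
  have hT1 : T' (lkVec F n (2 * n)) = lkVec F n 0 := altL_lkX_apply_last n hm hl
  have f1 : ∀ u, lkForm n m l (2 * n) (T u) = lkForm n m l 0 u := fun u => by
    simpa using LinearMap.congr_fun (lkForm_comp_altL_lkX n hm hl le_rfl) u
  have f0 : ∀ u, lkForm n m l 0 (T' u) = lkForm n m l (2 * n) u := fun u =>
    LinearMap.congr_fun (lkForm_zero_comp_altL_lkX n hm hl) u
  have xx : ∀ u, x (x u) = u - m • x u + (m * l) • lkForm n m l 0 u • lkVec F n 0 := fun u =>
    LinearMap.congr_fun (lkX_mul_lkX n hm hl 0) u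
  have yy : ∀ u, y (y u) = u - m • y u + (m * l) • lkForm n m l (2 * n) u • lkVec F n (2 * n) :=
    fun u => LinearMap.congr_fun (lkX_mul_lkX n hm hl 1) u
  refine lk_ext fun k hk => ?_
  induction k with
  | zero =>
    rw [a2, b1, Module.End.mul_apply, Module.End.mul_apply, hT0, hx, hy, lkX_zero_zero,
      lkX_one_last, map_smul, hT0]
  | succ k ih =>
    have ih := ih (by omega)
    have ihx : T (x (lkVec F n k)) = y (T (lkVec F n k)) := by rwa [a2, b1] at ih
    have ihy : x (T' (lkVec F n k)) = T' (y (lkVec F n k)) := by rwa [a1, b2] at ih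
    rcases Nat.even_or_odd' k with ⟨p, hp | hp⟩
    · have e : lkVec F n (k + 1) = y (lkVec F n k) := by
        rw [hp, hy, lkX_one_even n m l p (by omega)]
      rw [e, a1, b2, Module.End.mul_apply, Module.End.mul_apply, ← ihy, xx, yy]
      simp only [map_add, map_sub, map_smul, f0, hT1, ihy]
    · have e : lkVec F n (k + 1) = x (lkVec F n k) := by
        rw [hp, hx, lkX_zero_odd n m l p (by omega)]
      rw [e, a2, b1, Module.End.mul_apply, Module.End.mul_apply, ihx, xx, yy]
      simp only [map_add, map_sub, map_smul, f1, hT0, ihx]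

theorem smulRight_mul_mul_smulRight {V : Type*} [AddCommGroup V] [Module F V]
    (f : V →ₗ[F] F) (u : V) (W : Module.End F V) :
    (f.smulRight u * W * f.smulRight u : Module.End F V) = f (W u) • f.smulRight u := by
  refine LinearMap.ext fun x => ?_
  simp [smul_smul, mul_comm]

/-- The images of the generators in the Lawrence–Krammer representation. -/
noncomputable def lkGen (n : ℕ) (m l : F) : BMWGen → Module.End F (Fin (2 * n + 1) → F)
  | .X i => lkX n m l i
  | .Y i => lkY n m l i
  | .E i => lkE n m l i

/-- As `E_i` has rank one, `E_i W E_i` is `E_i` times the value of its form at `W` applied to its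
vector. In each case the word is absorbed by the vector or by the form, whichever it moves without
corrections, leaving one entry of `lkCoeff`. -/
theorem lkGen_rel (n : ℕ) {m l : F} (hm : m ≠ 0) (hl : l ≠ 0) (x y : FreeAlgebra F BMWGen)
    (h : BMWRel n m l x y) :
    FreeAlgebra.lift F (lkGen n m l) x = FreeAlgebra.lift F (lkGen n m l) y := by
  have E0 : lkE n m l 0 = (lkForm n m l 0).smulRight (lkVec F n 0) := rfl
  have E1 : lkE n m l 1 = (lkForm n m l (2 * n)).smulRight (lkVec F n (2 * n)) := rfl
  have hlast : ∀ j, 1 ≤ j → j ≤ n → lkForm n m l (2 * n - (2 * j - 1)) (lkVec F n (2 * n)) = l⁻¹ := by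
    intro j h1 h2
    rw [show 2 * n - (2 * j - 1) = 2 * (n - j) + 1 by omega, lkForm_odd_even m l _ le_rfl,
      if_neg (by omega)]
  have hlast' : ∀ j, 1 ≤ j → j ≤ n → lkForm n m l (2 * n) (lkVec F n (2 * n - (2 * j - 1))) = l := by
    intro j h1 h2
    rw [show 2 * n - (2 * j - 1) = 2 * (n - j) + 1 by omega,
      lkForm_even_odd m l _ (by omega), if_pos (by omega)]
  have hzero : ∀ j, 1 ≤ j → j ≤ n → lkForm n m l 0 (lkVec F n (2 * j - 1)) = l⁻¹ := by
    intro j h1 h2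
    rw [show 2 * j - 1 = 2 * (j - 1) + 1 by omega]
    simpa using lkForm_even_odd m l 0 (show j - 1 < n by omega)
  have hzero' : ∀ j, 1 ≤ j → j ≤ n → lkForm n m l (2 * j - 1) (lkVec F n 0) = l := by
    intro j h1 h2
    rw [show 2 * j - 1 = 2 * (j - 1) + 1 by omega]
    simpa using lkForm_odd_even m l (j - 1) n.zero_le
  cases h with
  | mul_inv i => simpa [lkGen] using lkX_mul_lkY n hm hl i
  | inv_mul i => simpa [lkGen] using lkY_mul_lkX n hm hl i
  | braid => simpa [map_altL, lkGen] using lkX_braid n hm hl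
  | skein i => simp [lkGen, lkY]
  | X_mul_E i => simpa [lkGen] using lkX_mul_lkE n m l i
  | E_mul_X i => simpa [lkGen] using lkE_mul_lkX n hm hl i
  | E_mul_E i =>
    simp only [map_mul, map_smul, FreeAlgebra.lift_ι_apply, lkGen]
    fin_cases i
    · have h := smulRight_mul_mul_smulRight (lkForm n m l 0) (lkVec F n 0) 1
      rwa [mul_one, Module.End.one_apply, lkForm_vec n m l 0 (Nat.succ_pos _), lkCoeff_self] at h
    · have h := smulRight_mul_mul_smulRight (lkForm n m l (2 * n)) (lkVec F n (2 * n)) 1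
      rwa [mul_one, Module.End.one_apply, lkForm_vec n m l _ (Nat.lt_succ_self _),
        lkCoeff_self] at h
  | E_X_E i k h1 h2 =>
    simp only [map_mul, map_smul, map_altL, FreeAlgebra.lift_ι_apply, lkGen]
    fin_cases i
    · change lkE n m l 0 * altL (lkX n m l 1) (lkX n m l 0) (2 * k - 1) * lkE n m l 0 =
        l⁻¹ • lkE n m l 0
      rw [E0, smulRight_mul_mul_smulRight, show 2 * k - 1 = 2 * (k - 1) + 1 by omega, ← altR_odd,
        altR_lkX_apply n m l (by omega), show 2 * (k - 1) + 1 = 2 * k - 1 by omega, hzero k h1 h2]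
    · change lkE n m l 1 * altL (lkX n m l 0) (lkX n m l 1) (2 * k - 1) * lkE n m l 1 =
        l⁻¹ • lkE n m l 1
      rw [E1, smulRight_mul_mul_smulRight, ← LinearMap.comp_apply,
        lkForm_comp_altL_lkX n hm hl (by omega), hlast k h1 h2]
  | E_Y_E i k h1 h2 =>
    simp only [map_mul, map_smul, map_altL, FreeAlgebra.lift_ι_apply, lkGen]
    fin_cases i
    · change lkE n m l 0 * altL (lkY n m l 1) (lkY n m l 0) (2 * k - 1) * lkE n m l 0 =
        l • lkE n m l 0
      rw [E0, smulRight_mul_mul_smulRight, ← LinearMap.comp_apply,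
        lkForm_comp_altL_lkY n hm hl (by omega), hzero' k h1 h2]
    · change lkE n m l 1 * altL (lkY n m l 0) (lkY n m l 1) (2 * k - 1) * lkE n m l 1 =
        l • lkE n m l 1
      rw [E1, smulRight_mul_mul_smulRight, show 2 * k - 1 = 2 * (k - 1) + 1 by omega, ← altR_odd,
        altR_lkY_apply n m l (by omega), show 2 * (k - 1) + 1 = 2 * k - 1 by omega,
        hlast' k h1 h2]
  | X_E =>
    simp only [map_mul, map_altL, FreeAlgebra.lift_ι_apply, lkGen]
    refine LinearMap.ext fun u => ?_
    have h := LinearMap.congr_fun (lkForm_comp_altL_lkX n hm hl le_rfl) u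
    rw [LinearMap.comp_apply, Nat.sub_self] at h
    rw [Module.End.mul_apply, Module.End.mul_apply, lkE_one_apply, h, lkE_zero_apply, map_smul,
      ← altR_even, altR_lkX_apply n m l le_rfl]
  | E_X =>
    simp only [map_mul, map_altL, FreeAlgebra.lift_ι_apply, lkGen]
    refine LinearMap.ext fun u => ?_
    have h := LinearMap.congr_fun (lkForm_zero_comp_altL_lkX n hm hl) u
    rw [LinearMap.comp_apply] at h
    rw [Module.End.mul_apply, Module.End.mul_apply, lkE_zero_apply, h, lkE_one_apply, map_smul,
      altL_lkX_apply_last n hm hl]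

/-- The Lawrence–Krammer representation of the dihedral BMW algebra. -/
noncomputable def lkRep (n : ℕ) {m l : F} (hm : m ≠ 0) (hl : l ≠ 0) :
    BMW n m l →ₐ[F] Module.End F (Fin (2 * n + 1) → F) :=
  BMW.lift n m l (lkGen n m l) (lkGen_rel n hm hl)

theorem lkRep_gen (n : ℕ) {m l : F} (hm : m ≠ 0) (hl : l ≠ 0) (g : BMWGen) :
    lkRep n hm hl (BMW.gen n m l g) = lkGen n m l g := by
  rw [lkRep, BMW.gen, BMW.lift_mk, FreeAlgebra.lift_ι_apply]

end LawrenceKrammerRelations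

/-! ### The ideal of the BMW algebra spanned by the bottom cell -/

section BMWAlgebra

variable {F : Type*} [Field F] {n : ℕ} {m l : F}

theorem BMW.mk_surjective : Function.Surjective (BMW.mk n m l) :=
  RingQuot.mkAlgHom_surjective F _

theorem BMW.induction {P : BMW n m l → Prop} (halg : ∀ c, P (algebraMap F _ c))
    (hgen : ∀ g, P (BMW.gen n m l g)) (hadd : ∀ a b, P a → P b → P (a + b))
    (hmul : ∀ a b, P a → P b → P (a * b)) (b : BMW n m l) : P b := by
  obtain ⟨a, rfl⟩ := BMW.mk_surjective b
  induction a using FreeAlgebra.induction with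
  | grade0 r => simpa using halg r
  | grade1 g => exact hgen g
  | mul a b ha hb => rw [map_mul]; exact hmul _ _ ha hb
  | add a b ha hb => rw [map_add]; exact hadd _ _ ha hb

theorem BMW.rev_gen (g : BMWGen) : BMW.rev n m l (BMW.gen n m l g) = BMW.gen n m l g := by
  change (BMW.revHom n m l (BMW.mk n m l _)).unop = _
  rw [BMW.revHom, BMW.lift_mk, FreeAlgebra.lift_ι_apply, MulOpposite.unop_op]

theorem BMW.rev_mul (a b : BMW n m l) :
    BMW.rev n m l (a * b) = BMW.rev n m l b * BMW.rev n m l a := by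
  change (BMW.revHom n m l (a * b)).unop = _
  rw [map_mul, MulOpposite.unop_mul]
  rfl

theorem BMW.rev_algebraMap (c : F) :
    BMW.rev n m l (algebraMap F _ c) = algebraMap F _ c := by
  change (BMW.revHom n m l (algebraMap F _ c)).unop = _
  rw [AlgHom.commutes]
  rfl

theorem BMW.rev_one : BMW.rev n m l 1 = 1 := by
  simpa using BMW.rev_algebraMap (n := n) (m := m) (l := l) 1

theorem BMW.rev_rev (a : BMW n m l) : BMW.rev n m l (BMW.rev n m l a) = a := by
  induction a using BMW.induction with
  | halg c => rw [rev_algebraMap, rev_algebraMap]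
  | hgen g => rw [rev_gen, rev_gen]
  | hadd a b ha hb => rw [map_add, map_add, ha, hb]
  | hmul a b ha hb => rw [rev_mul, rev_mul, ha, hb]

theorem BMW.rev_altR {a b : BMW n m l} (ha : BMW.rev n m l a = a) (hb : BMW.rev n m l b = b)
    (N : ℕ) : BMW.rev n m l (altR a b N) = altL b a N := by
  induction N generalizing a b with
  | zero => exact BMW.rev_one
  | succ N ih =>
    change BMW.rev n m l (altR b a N * b) = b * altL a b N
    rw [rev_mul, ih hb ha, hb]

noncomputable abbrev BMW.Y (n : ℕ) (m l : F) (i : Fin 2) : BMW n m l := BMW.gen n m l (.Y i)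

theorem BMW.X_mul_Y (i : Fin 2) : BMW.X n m l i * BMW.Y n m l i = 1 := by
  simpa [BMW.gen] using BMW.mk_rel (BMWRel.mul_inv (n := n) (m := m) (l := l) i)

theorem BMW.Y_mul_X (i : Fin 2) : BMW.Y n m l i * BMW.X n m l i = 1 := by
  simpa [BMW.gen] using BMW.mk_rel (BMWRel.inv_mul (n := n) (m := m) (l := l) i)

theorem BMW.X_sub_Y (i : Fin 2) :
    BMW.X n m l i - BMW.Y n m l i = m • (BMW.E n m l i - 1) := by
  simpa [BMW.gen] using BMW.mk_rel (BMWRel.skein (n := n) (m := m) (l := l) i)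

theorem BMW.X_mul_E (i : Fin 2) :
    BMW.X n m l i * BMW.E n m l i = l • BMW.E n m l i := by
  simpa [BMW.gen] using BMW.mk_rel (BMWRel.X_mul_E (n := n) (m := m) (l := l) i)

theorem BMW.E_mul_X (i : Fin 2) :
    BMW.E n m l i * BMW.X n m l i = l • BMW.E n m l i := by
  simpa [BMW.gen] using BMW.mk_rel (BMWRel.E_mul_X (n := n) (m := m) (l := l) i)

theorem BMW.E_mul_E (i : Fin 2) :
    BMW.E n m l i * BMW.E n m l i = ((l - l⁻¹) / m + 1) • BMW.E n m l i := by
  simpa [BMW.gen] using BMW.mk_rel (BMWRel.E_mul_E (n := n) (m := m) (l := l) i)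

theorem BMW.E_X_E (i : Fin 2) {k : ℕ} (hk : k < n) :
    BMW.E n m l i * altL (BMW.X n m l (1 - i)) (BMW.X n m l i) (2 * k + 1) * BMW.E n m l i =
      l⁻¹ • BMW.E n m l i := by
  have h := BMW.mk_rel (BMWRel.E_X_E (n := n) (m := m) (l := l) i (k + 1) (by omega) hk)
  rw [show 2 * (k + 1) - 1 = 2 * k + 1 from rfl] at h
  simpa [BMW.gen, map_altL] using h

theorem BMW.E_Y_E (i : Fin 2) {k : ℕ} (hk : k < n) :
    BMW.E n m l i * altL (BMW.Y n m l (1 - i)) (BMW.Y n m l i) (2 * k + 1) * BMW.E n m l i =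
      l • BMW.E n m l i := by
  have h := BMW.mk_rel (BMWRel.E_Y_E (n := n) (m := m) (l := l) i (k + 1) (by omega) hk)
  rw [show 2 * (k + 1) - 1 = 2 * k + 1 from rfl] at h
  simpa [BMW.gen, map_altL] using h

theorem BMW.X_E : altL (BMW.X n m l 0) (BMW.X n m l 1) (2 * n) * BMW.E n m l 0 =
    BMW.E n m l 1 * altL (BMW.X n m l 0) (BMW.X n m l 1) (2 * n) := by
  simpa [BMW.gen, map_altL] using BMW.mk_rel (BMWRel.X_E (n := n) (m := m) (l := l))

/-- The elements `[⋯ X_0 X_1]_k E_0`, which for `k ≤ 2n` span the left ideal of `E_0`. -/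
noncomputable def BMW.col (n : ℕ) (m l : F) (k : ℕ) : BMW n m l :=
  altR (BMW.X n m l 0) (BMW.X n m l 1) k * BMW.E n m l 0

theorem BMW.col_zero : BMW.col n m l 0 = BMW.E n m l 0 := one_mul _

theorem BMW.col_even_succ (p : ℕ) :
    BMW.col n m l (2 * p + 1) = BMW.X n m l 1 * BMW.col n m l (2 * p) := by
  rw [col, altR_succ, if_pos (even_two_mul p), mul_assoc, col]

theorem BMW.col_odd_succ (p : ℕ) :
    BMW.col n m l (2 * p + 2) = BMW.X n m l 0 * BMW.col n m l (2 * p + 1) := by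
  rw [col, altR_succ, if_neg (Nat.not_even_two_mul_add_one p), mul_assoc, col]

theorem BMW.col_last : BMW.col n m l (2 * n) =
    BMW.E n m l 1 * altL (BMW.X n m l 0) (BMW.X n m l 1) (2 * n) := by
  rw [col, altR_even, X_E]

/-- The span of the elements `[⋯ X_0 X_1]_k E_0`, `k ≤ 2n`. -/
noncomputable def BMW.colSpan (n : ℕ) (m l : F) : Submodule F (BMW n m l) :=
  Submodule.span F (Set.range fun k : Fin (2 * n + 1) => BMW.col n m l k)

theorem BMW.col_mem {k : ℕ} (hk : k ≤ 2 * n) : BMW.col n m l k ∈ BMW.colSpan n m l :=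
  Submodule.subset_span ⟨⟨k, by omega⟩, rfl⟩

/-- For odd `k` this is a defining relation. A nonempty even word begins with `X_0`, which `E_0`
absorbs at the cost of `l`, leaving an odd word. -/
theorem BMW.E_zero_mul_col {k : ℕ} (hk : k ≤ 2 * n) :
    ∃ c : F, BMW.E n m l 0 * BMW.col n m l k = c • BMW.col n m l 0 := by
  have ho : ∀ p < n, BMW.E n m l 0 * BMW.col n m l (2 * p + 1) = l⁻¹ • BMW.E n m l 0 := by
    intro p hp
    have h := BMW.E_X_E (m := m) (l := l) 0 hp
    rwa [show (1 : Fin 2) - 0 = 1 from rfl, ← altR_odd, mul_assoc] at h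
  rw [col_zero]
  rcases Nat.even_or_odd' k with ⟨p, rfl | rfl⟩
  · cases p with
    | zero => exact ⟨_, by rw [mul_zero, col_zero, E_mul_E]⟩
    | succ p =>
      refine ⟨l * l⁻¹, ?_⟩
      rw [mul_add_one, col_odd_succ, ← mul_assoc, E_mul_X, smul_mul_assoc, ho p (by omega),
        smul_smul]
  · exact ⟨_, ho p (by omega)⟩

theorem BMW.altR_Y_mul_col_last {j : ℕ} (hj : j ≤ 2 * n) :
    altR (BMW.Y n m l 1) (BMW.Y n m l 0) j * BMW.col n m l (2 * n) =
      BMW.col n m l (2 * n - j) := by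
  induction j with
  | zero => exact one_mul _
  | succ j ih =>
    rw [altR_succ, mul_assoc, ih (by omega)]
    rcases Nat.even_or_odd' j with ⟨p, rfl | rfl⟩
    · rw [if_pos (even_two_mul p), show 2 * n - 2 * p = 2 * (n - p - 1) + 2 by omega,
        col_odd_succ, ← mul_assoc, Y_mul_X, one_mul]
      congr 1
      omega
    · rw [if_neg (Nat.not_even_two_mul_add_one p),
        show 2 * n - (2 * p + 1) = 2 * (n - p - 1) + 1 by omega, col_even_succ, ← mul_assoc,
        Y_mul_X, one_mul]
      congr 1
      omega

/-- An odd column is an odd word in the inverses applied to the last column, and the last column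
begins with `E_1`; so the relation `E_1 [X_0⁻¹X_1⁻¹⋯] E_1 = l E_1` applies. An even column below the
last reduces to the next odd one through `E_1 X_1 = l E_1`, which is where `l` is cancelled. -/
theorem BMW.E_one_mul_col (hl : l ≠ 0) {k : ℕ} (hk : k ≤ 2 * n) :
    ∃ c : F, BMW.E n m l 1 * BMW.col n m l k = c • BMW.col n m l (2 * n) := by
  have ho : ∀ p < n, BMW.E n m l 1 * BMW.col n m l (2 * p + 1) = l • BMW.col n m l (2 * n) := by
    intro p hp
    have h := BMW.E_Y_E (m := m) (l := l) 1 (show n - p - 1 < n by omega)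
    rw [show (1 : Fin 2) - 1 = 0 from rfl, ← altR_odd] at h
    rw [show 2 * p + 1 = 2 * n - (2 * (n - p - 1) + 1) by omega,
      ← altR_Y_mul_col_last (by omega), col_last, ← mul_assoc, ← mul_assoc, h, smul_mul_assoc]
  rcases Nat.even_or_odd' k with ⟨p, rfl | rfl⟩
  · rcases (show p ≤ n by omega).eq_or_lt with rfl | hp
    · exact ⟨_, by rw [col_last, ← mul_assoc, E_mul_E, smul_mul_assoc]⟩
    · refine ⟨1, ?_⟩
      have h := ho p hp
      rw [col_even_succ, ← mul_assoc, E_mul_X, smul_mul_assoc] at h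
      rw [smul_right_injective _ hl h, one_smul]
  · exact ⟨_, ho p (by omega)⟩

theorem BMW.E_mul_mem_colSpan (hl : l ≠ 0) (i : Fin 2) {k : ℕ} (hk : k ≤ 2 * n) :
    BMW.E n m l i * BMW.col n m l k ∈ BMW.colSpan n m l := by
  fin_cases i
  · obtain ⟨c, hc⟩ := BMW.E_zero_mul_col (m := m) (l := l) hk
    exact hc ▸ Submodule.smul_mem _ _ (col_mem (Nat.zero_le _))
  · obtain ⟨c, hc⟩ := BMW.E_one_mul_col (m := m) hl hk
    exact hc ▸ Submodule.smul_mem _ _ (col_mem le_rfl)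

theorem BMW.X_mul_X (i : Fin 2) : BMW.X n m l i * BMW.X n m l i =
    1 - m • BMW.X n m l i + (m * l) • BMW.E n m l i := by
  have h := congrArg (· * BMW.X n m l i) (BMW.X_sub_Y (n := n) (m := m) (l := l) i)
  simp only [sub_mul, Y_mul_X, smul_mul_assoc, E_mul_X, one_mul] at h
  rw [sub_eq_iff_eq_add] at h
  rw [h]
  module

theorem BMW.X_mul_X_mul_mem_colSpan (hl : l ≠ 0) (i : Fin 2) {k : ℕ} (hk : k ≤ 2 * n)
    (h : BMW.X n m l i * BMW.col n m l k ∈ BMW.colSpan n m l) :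
    BMW.X n m l i * (BMW.X n m l i * BMW.col n m l k) ∈ BMW.colSpan n m l := by
  rw [← mul_assoc, X_mul_X, add_mul, sub_mul, one_mul, smul_mul_assoc, smul_mul_assoc]
  exact Submodule.add_mem _ (Submodule.sub_mem _ (col_mem hk) (Submodule.smul_mem _ _ h))
    (Submodule.smul_mem _ _ (E_mul_mem_colSpan hl i hk))

/-- Three things can happen: `X_i` moves the column one step up; or the column is itself `X_i` times
its predecessor, and the quadratic relation applies; or it is the end column (`0` for `X_0`, `2n`
for `X_1`), on which `X_i` is the scalar `l`. -/
theorem BMW.X_mul_mem_colSpan (hl : l ≠ 0) (i : Fin 2) {k : ℕ} (hk : k ≤ 2 * n) :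
    BMW.X n m l i * BMW.col n m l k ∈ BMW.colSpan n m l := by
  have h0 : ∀ p < n, BMW.X n m l 0 * BMW.col n m l (2 * p + 1) ∈ BMW.colSpan n m l :=
    fun p hp => col_odd_succ (n := n) (m := m) (l := l) p ▸ col_mem (by omega)
  have h1 : ∀ p < n, BMW.X n m l 1 * BMW.col n m l (2 * p) ∈ BMW.colSpan n m l :=
    fun p hp => col_even_succ (n := n) (m := m) (l := l) p ▸ col_mem (by omega)
  fin_cases i <;> rcases Nat.even_or_odd' k with ⟨p, rfl | rfl⟩
  · cases p with
    | zero =>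
      simp only [Fin.zero_eta, mul_zero, col_zero, X_mul_E]
      exact Submodule.smul_mem _ _ (col_zero (n := n) (m := m) (l := l) ▸ col_mem (Nat.zero_le _))
    | succ p =>
      rw [mul_add_one, col_odd_succ]
      exact X_mul_X_mul_mem_colSpan hl 0 (by omega) (h0 p (by omega))
  · exact h0 p (by omega)
  · rcases (show p ≤ n by omega).eq_or_lt with rfl | hp
    · simp only [Fin.mk_one, col_last]
      rw [← mul_assoc, X_mul_E, smul_mul_assoc, ← col_last]
      exact Submodule.smul_mem _ _ (col_mem le_rfl)
    · exact h1 p hp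
  · rw [col_even_succ]
    exact X_mul_X_mul_mem_colSpan hl 1 (by omega) (h1 p (by omega))

theorem BMW.mul_mem_colSpan (hl : l ≠ 0) (b : BMW n m l) {x : BMW n m l}
    (hx : x ∈ BMW.colSpan n m l) : b * x ∈ BMW.colSpan n m l := by
  induction b using BMW.induction generalizing x with
  | halg c => rw [← Algebra.smul_def]; exact Submodule.smul_mem _ _ hx
  | hadd a b ha hb => rw [add_mul]; exact Submodule.add_mem _ (ha hx) (hb hx)
  | hmul a b ha hb => rw [mul_assoc]; exact ha (hb hx)
  | hgen g =>
    induction hx using Submodule.span_induction with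
    | zero => rw [mul_zero]; exact Submodule.zero_mem _
    | add x y _ _ hx hy => rw [mul_add]; exact Submodule.add_mem _ hx hy
    | smul c x _ hx => rw [mul_smul_comm]; exact Submodule.smul_mem _ _ hx
    | mem x hx =>
      obtain ⟨k, rfl⟩ := hx
      have hk : (k : ℕ) ≤ 2 * n := Nat.lt_succ_iff.1 k.2
      cases g with
      | X i => exact X_mul_mem_colSpan hl i hk
      | E i => exact E_mul_mem_colSpan hl i hk
      | Y i =>
        have h : BMW.Y n m l i = BMW.X n m l i - m • (BMW.E n m l i - 1) := by
          rw [← X_sub_Y, sub_sub_cancel]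
        change BMW.Y n m l i * BMW.col n m l k ∈ _
        rw [h, sub_mul, smul_mul_assoc, sub_mul, one_mul]
        exact Submodule.sub_mem _ (X_mul_mem_colSpan hl i hk) (Submodule.smul_mem _ _
          (Submodule.sub_mem _ (E_mul_mem_colSpan hl i hk) (col_mem hk)))

theorem BMW.exists_mul_col (hl : l ≠ 0) (b : BMW n m l) :
    ∃ r : Fin (2 * n + 1) → Fin (2 * n + 1) → F, ∀ i : Fin (2 * n + 1),
      b * BMW.col n m l i = ∑ i' : Fin (2 * n + 1), r i' i • BMW.col n m l i' := by
  have h : ∀ i : Fin (2 * n + 1), ∃ c : Fin (2 * n + 1) → F,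
      ∑ i' : Fin (2 * n + 1), c i' • BMW.col n m l i' = b * BMW.col n m l i := fun i =>
    (Submodule.mem_span_range_iff_exists_fun F).1
      (BMW.mul_mem_colSpan hl b (col_mem (Nat.lt_succ_iff.1 i.2)))
  choose c hc using h
  exact ⟨fun i' i => c i i', fun i => (hc i).symm⟩

/-- The elements `[⋯ X_0 X_1]_i E_0 [X_1 X_0 ⋯]_j`. -/
noncomputable def BMW.lkElement (n : ℕ) (m l : F) (i j : Fin (2 * n + 1)) : BMW n m l :=
  altR (BMW.X n m l 0) (BMW.X n m l 1) i * BMW.E n m l 0 *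
    altL (BMW.X n m l 1) (BMW.X n m l 0) j

theorem BMW.lkElement_eq (i j : Fin (2 * n + 1)) : BMW.lkElement n m l i j =
    BMW.col n m l i * altL (BMW.X n m l 1) (BMW.X n m l 0) j := rfl

theorem BMW.rev_lkElement (i j : Fin (2 * n + 1)) :
    BMW.rev n m l (BMW.lkElement n m l i j) = BMW.lkElement n m l j i := by
  have hX : ∀ i, BMW.rev n m l (BMW.X n m l i) = BMW.X n m l i := fun i => rev_gen _
  rw [lkElement, rev_mul, rev_mul, rev_altR (hX 0) (hX 1), rev_gen, ← rev_altR (hX 0) (hX 1),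
    rev_rev, lkElement, mul_assoc]

/-- The span of the elements `[⋯ X_0 X_1]_i E_0 [X_1 X_0 ⋯]_j`. -/
noncomputable def BMW.lkSpan (n : ℕ) (m l : F) : Submodule F (BMW n m l) :=
  Submodule.span F (Set.range fun x : Fin (2 * n + 1) × Fin (2 * n + 1) =>
    BMW.lkElement n m l x.1 x.2)

/-- Left multiplication affects only the column, so the coefficients do not involve `j`. This is
(C3) for the bottom cell, with no error term. -/
theorem BMW.exists_mul_lkElement (hl : l ≠ 0) (b : BMW n m l) :
    ∃ r : Fin (2 * n + 1) → Fin (2 * n + 1) → F, ∀ i j : Fin (2 * n + 1),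
      b * BMW.lkElement n m l i j = ∑ i' : Fin (2 * n + 1), r i' i • BMW.lkElement n m l i' j := by
  obtain ⟨r, hr⟩ := BMW.exists_mul_col hl b
  refine ⟨r, fun i j => ?_⟩
  simp only [lkElement_eq, ← mul_assoc, hr, Finset.sum_mul, smul_mul_assoc]

theorem BMW.lkElement_mem (i j : Fin (2 * n + 1)) :
    BMW.lkElement n m l i j ∈ BMW.lkSpan n m l :=
  Submodule.subset_span ⟨(i, j), rfl⟩

theorem BMW.mul_mem_lkSpan (hl : l ≠ 0) (b : BMW n m l) {x : BMW n m l}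
    (hx : x ∈ BMW.lkSpan n m l) : b * x ∈ BMW.lkSpan n m l := by
  obtain ⟨r, hr⟩ := BMW.exists_mul_lkElement hl b
  induction hx using Submodule.span_induction with
  | zero => rw [mul_zero]; exact Submodule.zero_mem _
  | add x y _ _ hx hy => rw [mul_add]; exact Submodule.add_mem _ hx hy
  | smul c x _ hx => rw [mul_smul_comm]; exact Submodule.smul_mem _ _ hx
  | mem x hx =>
    obtain ⟨⟨i, j⟩, rfl⟩ := hx
    exact hr i j ▸ Submodule.sum_mem _ fun i' _ => Submodule.smul_mem _ _ (lkElement_mem i' j)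

theorem BMW.rev_mem_lkSpan {x : BMW n m l} (hx : x ∈ BMW.lkSpan n m l) :
    BMW.rev n m l x ∈ BMW.lkSpan n m l := by
  induction hx using Submodule.span_induction with
  | zero => rw [map_zero]; exact Submodule.zero_mem _
  | add x y _ _ hx hy => rw [map_add]; exact Submodule.add_mem _ hx hy
  | smul c x _ hx => rw [map_smul]; exact Submodule.smul_mem _ _ hx
  | mem x hx =>
    obtain ⟨⟨i, j⟩, rfl⟩ := hx
    exact rev_lkElement (m := m) (l := l) i j ▸ lkElement_mem j i

theorem BMW.mem_lkSpan_mul (hl : l ≠ 0) (b : BMW n m l) {x : BMW n m l}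
    (hx : x ∈ BMW.lkSpan n m l) : x * b ∈ BMW.lkSpan n m l := by
  have h := rev_mem_lkSpan (mul_mem_lkSpan hl (BMW.rev n m l b) (rev_mem_lkSpan hx))
  rwa [rev_mul, rev_rev, rev_rev] at h

theorem BMW.E_mem_lkSpan (hl : l ≠ 0) (i : Fin 2) : BMW.E n m l i ∈ BMW.lkSpan n m l := by
  have h0 : BMW.E n m l 0 ∈ BMW.lkSpan n m l := by
    have h := lkElement_mem (n := n) (m := m) (l := l) 0 0
    rwa [lkElement_eq, Fin.val_zero, col_zero, altL, mul_one] at h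
  fin_cases i
  · exact h0
  -- `E_1` is the conjugate of `E_0` by the alternating word of length `2n`.
  · have h := mem_lkSpan_mul hl (altL (BMW.Y n m l 1) (BMW.Y n m l 0) (2 * n))
      (mul_mem_lkSpan hl (altL (BMW.X n m l 0) (BMW.X n m l 1) (2 * n)) h0)
    rwa [X_E, mul_assoc, ← altR_even, altR_mul_altL_eq_one (X_mul_Y 0) (X_mul_Y 1),
      mul_one] at h

end BMWAlgebra

/-! ### The kernel of the map to the Hecke algebra -/

section Kernel

variable {F : Type*} [Field F] {n : ℕ} {v l : F}

theorem toHecke_gen (hv : v ≠ 0) (g : BMWGen) :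
    toHecke n v l hv (BMW.gen n (v - v⁻¹) l g) = toHeckeGen n v g := by
  rw [toHecke, BMW.gen, BMW.lift_mk, FreeAlgebra.lift_ι_apply]

/-- The two-sided ideal spanned by the elements `[⋯ X_0 X_1]_i E_0 [X_1 X_0 ⋯]_j`. -/
noncomputable def BMW.lkIdeal {m l : F} (hl : l ≠ 0) : Ideal (BMW n m l) where
  carrier := BMW.lkSpan n m l
  add_mem' := Submodule.add_mem _
  zero_mem' := Submodule.zero_mem _
  smul_mem' b _ hx := BMW.mul_mem_lkSpan hl b hx

instance BMW.lkIdeal_isTwoSided {m l : F} (hl : l ≠ 0) :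
    (BMW.lkIdeal (n := n) (m := m) hl).IsTwoSided :=
  ⟨fun b hx => BMW.mem_lkSpan_mul hl b hx⟩

theorem BMW.X_quadratic (i : Fin 2) (hv : v ≠ 0) :
    (BMW.X n (v - v⁻¹) l i + algebraMap F _ v) * (BMW.X n (v - v⁻¹) l i - algebraMap F _ v⁻¹) =
      ((v - v⁻¹) * l) • BMW.E n (v - v⁻¹) l i := by
  have h := BMW.X_mul_X (n := n) (m := v - v⁻¹) (l := l) i
  simp only [Algebra.algebraMap_eq_smul_one, add_mul, mul_sub, smul_mul_assoc, mul_smul_comm,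
    one_mul, mul_one, smul_add, inv_smul_smul₀ hv, h]
  module

/-- The homomorphism from the Hecke algebra to the quotient of the BMW algebra by the ideal
generated by the `E_i`. -/
noncomputable def heckeToQuotient (hv : v ≠ 0) (hl : l ≠ 0) :
    Hecke n v →ₐ[F] BMW n (v - v⁻¹) l ⧸ BMW.lkIdeal (n := n) (m := v - v⁻¹) hl :=
  Hecke.lift n v (fun i => Ideal.Quotient.mkₐ F (BMW.lkIdeal hl) (BMW.X n (v - v⁻¹) l i)) (by
    rintro x y h
    cases h with
    | braid =>
      have h : altL (BMW.X n (v - v⁻¹) l 0) (BMW.X n (v - v⁻¹) l 1) (2 * n + 1) =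
          altL (BMW.X n (v - v⁻¹) l 1) (BMW.X n (v - v⁻¹) l 0) (2 * n + 1) := by
        simpa [BMW.gen, map_altL] using
          BMW.mk_rel (BMWRel.braid (n := n) (m := v - v⁻¹) (l := l))
      have h' := congrArg (Ideal.Quotient.mkₐ F (BMW.lkIdeal (n := n) (m := v - v⁻¹) hl)) h
      simpa only [map_altL, FreeAlgebra.lift_ι_apply] using h'
    | quadratic i =>
      have h : Ideal.Quotient.mkₐ F (BMW.lkIdeal hl)
          ((BMW.X n (v - v⁻¹) l i + algebraMap F _ v) *
            (BMW.X n (v - v⁻¹) l i - algebraMap F _ v⁻¹)) = 0 := by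
        rw [BMW.X_quadratic i hv]
        exact Ideal.Quotient.eq_zero_iff_mem.2
          (Submodule.smul_mem (BMW.lkSpan n (v - v⁻¹) l) _ (BMW.E_mem_lkSpan hl i))
      simpa only [map_mul, map_add, map_sub, map_zero, FreeAlgebra.lift_ι_apply,
        AlgHom.commutes] using h)

theorem heckeToQuotient_x (hv : v ≠ 0) (hl : l ≠ 0) (i : Fin 2) :
    heckeToQuotient hv hl (Hecke.x n v i) =
      Ideal.Quotient.mkₐ F (BMW.lkIdeal hl) (BMW.X n (v - v⁻¹) l i) := by
  rw [heckeToQuotient, Hecke.x, Hecke.lift_mk, FreeAlgebra.lift_ι_apply]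

/-- The quotient map by the ideal factors through `π`; therefore the ideal contains `ker π`. -/
theorem heckeToQuotient_toHecke (hv : v ≠ 0) (hl : l ≠ 0) (b : BMW n (v - v⁻¹) l) :
    heckeToQuotient hv hl (toHecke n v l hv b) = Ideal.Quotient.mkₐ F (BMW.lkIdeal hl) b := by
  have hE : ∀ i, Ideal.Quotient.mkₐ F (BMW.lkIdeal hl) (BMW.E n (v - v⁻¹) l i) = 0 := fun i =>
    Ideal.Quotient.eq_zero_iff_mem.2 (BMW.E_mem_lkSpan hl i)
  induction b using BMW.induction with
  | halg c => simp only [AlgHom.commutes]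
  | hadd a b ha hb => rw [map_add, map_add, map_add, ha, hb]
  | hmul a b ha hb => rw [map_mul, map_mul, map_mul, ha, hb]
  | hgen g =>
    rw [toHecke_gen]
    cases g with
    | X i => exact heckeToQuotient_x hv hl i
    | E i => rw [toHeckeGen, map_zero]; exact (hE i).symm
    | Y i =>
      have h : BMW.gen n (v - v⁻¹) l (.Y i) =
          BMW.X n (v - v⁻¹) l i - (v - v⁻¹) • (BMW.E n (v - v⁻¹) l i - 1) := by
        rw [← BMW.X_sub_Y, sub_sub_cancel]
      rw [toHeckeGen, map_add, heckeToQuotient_x, AlgHom.commutes, h]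
      have e : Ideal.Quotient.mkₐ F (BMW.lkIdeal hl) (BMW.E n (v - v⁻¹) l i - 1) = -1 := by
        rw [map_sub, hE, zero_sub, map_one]
      rw [map_sub (Ideal.Quotient.mkₐ F (BMW.lkIdeal hl)), map_smul, e, smul_neg, sub_neg_eq_add,
        Algebra.algebraMap_eq_smul_one]

theorem mem_lkSpan_of_toHecke_eq_zero (hv : v ≠ 0) (hl : l ≠ 0) {b : BMW n (v - v⁻¹) l}
    (hb : toHecke n v l hv b = 0) : b ∈ BMW.lkSpan n (v - v⁻¹) l := by
  have h := heckeToQuotient_toHecke hv hl b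
  rw [hb, map_zero] at h
  exact Ideal.Quotient.eq_zero_iff_mem.1 h.symm

theorem toHecke_lkElement (hv : v ≠ 0) (i j : Fin (2 * n + 1)) :
    toHecke n v l hv (BMW.lkElement n (v - v⁻¹) l i j) = 0 := by
  rw [BMW.lkElement, map_mul, map_mul, toHecke_gen, toHeckeGen, mul_zero, zero_mul]

theorem Hecke.mk_surjective : Function.Surjective (Hecke.mk n v) :=
  RingQuot.mkAlgHom_surjective F _

theorem Hecke.induction {P : Hecke n v → Prop} (halg : ∀ c, P (algebraMap F _ c))
    (hx : ∀ i, P (Hecke.x n v i)) (hadd : ∀ a b, P a → P b → P (a + b))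
    (hmul : ∀ a b, P a → P b → P (a * b)) (b : Hecke n v) : P b := by
  obtain ⟨a, rfl⟩ := Hecke.mk_surjective b
  induction a using FreeAlgebra.induction with
  | grade0 r => simpa using halg r
  | grade1 g => exact hx g
  | mul a b ha hb => rw [map_mul]; exact hmul _ _ ha hb
  | add a b ha hb => rw [map_add]; exact hadd _ _ ha hb

theorem toHecke_surjective (hv : v ≠ 0) : Function.Surjective (toHecke n v l hv) := by
  intro b
  induction b using Hecke.induction with
  | halg c => exact ⟨algebraMap F _ c, AlgHom.commutes _ _⟩
  | hx i => exact ⟨_, toHecke_gen hv (.X i)⟩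
  | hadd a b ha hb =>
    obtain ⟨a, rfl⟩ := ha
    obtain ⟨b, rfl⟩ := hb
    exact ⟨a + b, map_add _ _ _⟩
  | hmul a b ha hb =>
    obtain ⟨a, rfl⟩ := ha
    obtain ⟨b, rfl⟩ := hb
    exact ⟨a * b, map_mul _ _ _⟩

theorem Hecke.rev_x (i : Fin 2) : Hecke.rev n v (Hecke.x n v i) = Hecke.x n v i := by
  change (Hecke.revHom n v (Hecke.mk n v _)).unop = _
  rw [Hecke.revHom, Hecke.lift_mk, FreeAlgebra.lift_ι_apply, MulOpposite.unop_op]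

theorem Hecke.rev_mul (a b : Hecke n v) :
    Hecke.rev n v (a * b) = Hecke.rev n v b * Hecke.rev n v a := by
  change (Hecke.revHom n v (a * b)).unop = _
  rw [map_mul, MulOpposite.unop_mul]
  rfl

theorem Hecke.rev_algebraMap (c : F) :
    Hecke.rev n v (algebraMap F _ c) = algebraMap F _ c := by
  change (Hecke.revHom n v (algebraMap F _ c)).unop = _
  rw [AlgHom.commutes]
  rfl

theorem Hecke.rev_rev (a : Hecke n v) : Hecke.rev n v (Hecke.rev n v a) = a := by
  induction a using Hecke.induction with
  | halg c => rw [rev_algebraMap, rev_algebraMap]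
  | hx i => rw [rev_x, rev_x]
  | hadd a b ha hb => rw [map_add, map_add, ha, hb]
  | hmul a b ha hb => rw [rev_mul, rev_mul, ha, hb]

theorem toHecke_rev (hv : v ≠ 0) (b : BMW n (v - v⁻¹) l) :
    toHecke n v l hv (BMW.rev n (v - v⁻¹) l b) = Hecke.rev n v (toHecke n v l hv b) := by
  induction b using BMW.induction with
  | halg c => rw [BMW.rev_algebraMap, AlgHom.commutes, Hecke.rev_algebraMap]
  | hadd a b ha hb => simp only [map_add, ha, hb]
  | hmul a b ha hb => rw [BMW.rev_mul, map_mul, map_mul, Hecke.rev_mul, ha, hb]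
  | hgen g =>
    rw [BMW.rev_gen, toHecke_gen]
    cases g with
    | X i => exact (Hecke.rev_x i).symm
    | E i => exact (map_zero _).symm
    | Y i => rw [toHeckeGen, map_add, Hecke.rev_x, Hecke.rev_algebraMap]

end Kernel

/-! ### Linear independence of the bottom cell -/

section Independence

variable {F : Type*} [Field F] {n : ℕ}

theorem lkForm_linearIndependent {m l : F}
    (hdet : (Matrix.of fun j k : Fin (2 * n + 1) => lkCoeff m l j k).det ≠ 0) :
    LinearIndependent F (fun j : Fin (2 * n + 1) => lkForm n m l j) := by
  refine Fintype.linearIndependent_iff.2 fun c hc => ?_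
  refine congrFun (Matrix.eq_zero_of_vecMul_eq_zero hdet (funext fun k => ?_))
  have h := LinearMap.congr_fun hc (lkVec F n k)
  simp only [LinearMap.sum_apply, LinearMap.smul_apply, lkForm_vec n m l _ k.2] at h
  exact h

/-- A word in the inverses times `E_0` is a combination of columns. Reversing this identity and
applying the representation expresses `f_0 ∘ [X_1⁻¹X_0⁻¹⋯]_j`, which is `f_j`, through the forms
`f_0 ∘ [X_1X_0⋯]_k`. -/
theorem lkForm_mem_span {m l : F} (hm : m ≠ 0) (hl : l ≠ 0) (j : Fin (2 * n + 1)) :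
    lkForm n m l j ∈ Submodule.span F (Set.range fun k : Fin (2 * n + 1) =>
      lkForm n m l 0 ∘ₗ altL (lkX n m l 1) (lkX n m l 0) k) := by
  have hmem : altR (BMW.Y n m l 0) (BMW.Y n m l 1) j * BMW.E n m l 0 ∈ BMW.colSpan n m l :=
    BMW.mul_mem_colSpan hl _ (BMW.col_zero (n := n) (m := m) (l := l) ▸ BMW.col_mem (Nat.zero_le _))
  obtain ⟨c, hc⟩ := (Submodule.mem_span_range_iff_exists_fun F).1 hmem
  have h := congrArg (fun b => lkRep n hm hl (BMW.rev n m l b)) hc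
  simp only [map_sum, map_smul, BMW.col, BMW.rev_mul, BMW.rev_gen,
    BMW.rev_altR (BMW.rev_gen _) (BMW.rev_gen _), map_mul, map_altL, lkRep_gen, lkGen] at h
  refine (Submodule.mem_span_range_iff_exists_fun F).2 ⟨c, LinearMap.ext fun x => ?_⟩
  have hx := congrFun (LinearMap.congr_fun h x) 0
  have h1 := LinearMap.congr_fun
    (lkForm_comp_altL_lkY n hm hl (Nat.lt_succ_iff.1 j.2)) x
  rw [LinearMap.comp_apply] at h1
  simpa [lkE_zero_apply, lkVec, h1] using hx

/-- These `2n + 1` forms span the dual space, because the independent `f_j` already do and lie in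
their span. -/
theorem lkForm_comp_altL_linearIndependent {m l : F} (hm : m ≠ 0) (hl : l ≠ 0)
    (hdet : (Matrix.of fun j k : Fin (2 * n + 1) => lkCoeff m l j k).det ≠ 0) :
    LinearIndependent F (fun k : Fin (2 * n + 1) =>
      lkForm n m l 0 ∘ₗ altL (lkX n m l 1) (lkX n m l 0) k) := by
  have hcard : Fintype.card (Fin (2 * n + 1)) =
      Module.finrank F (Module.Dual F (Fin (2 * n + 1) → F)) := by
    rw [Subspace.dual_finrank_eq, Module.finrank_fintype_fun_eq_card]
  refine linearIndependent_of_top_le_span_of_card_eq_finrank ?_ hcard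
  rw [← (lkForm_linearIndependent hdet).span_eq_top_of_card_eq_finrank' hcard]
  exact Submodule.span_le.2 (Set.range_subset_iff.2 (lkForm_mem_span hm hl))

/-- The image of `C_{i,j}` is of rank at most one, with values in the line of `e_i`. Reading off
coordinate `i` turns a relation among the `C_{i,j}` into a relation among the forms for that fixed
`i`. -/
theorem lkElement_linearIndependent {m l : F} (hm : m ≠ 0) (hl : l ≠ 0)
    (hdet : (Matrix.of fun j k : Fin (2 * n + 1) => lkCoeff m l j k).det ≠ 0) :
    LinearIndependent F (fun x : Fin (2 * n + 1) × Fin (2 * n + 1) =>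
      BMW.lkElement n m l x.1 x.2) := by
  refine Fintype.linearIndependent_iff.2 fun c hc => ?_
  have hrow := lkForm_comp_altL_linearIndependent hm hl hdet
  rw [Fintype.linearIndependent_iff] at hrow
  rintro ⟨i, j⟩
  refine hrow (fun k => c (i, k)) (LinearMap.ext fun x => ?_) j
  have hC : ∀ i j, lkRep n hm hl (BMW.lkElement n m l i j) x =
      lkForm n m l 0 (altL (lkX n m l 1) (lkX n m l 0) j x) • lkVec F n i := by
    intro i j
    rw [BMW.lkElement, map_mul, map_mul, map_altR, map_altL]
    simp only [lkRep_gen, lkGen, Module.End.mul_apply, lkE_zero_apply, map_smul,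
      altR_lkX_apply n m l (Nat.lt_succ_iff.1 i.2)]
  have h := congrFun (LinearMap.congr_fun (congrArg (lkRep n hm hl) hc) x) i
  simp only [map_sum, map_smul, map_zero, LinearMap.sum_apply, LinearMap.smul_apply, hC,
    Fintype.sum_prod_type, Finset.sum_apply, Pi.smul_apply, lkVec, Fin.val_inj, smul_eq_mul,
    mul_ite, mul_one, mul_zero, Finset.sum_ite_irrel, Finset.sum_const_zero, Finset.sum_ite_eq,
    Finset.mem_univ, if_true, LinearMap.zero_apply, Pi.zero_apply] at h
  simpa using h

/-- The matrix `(lkCoeff j k)`, multiplied by `v l (v - v⁻¹)`, over the polynomials in `v, l`. -/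
noncomputable def lkPolyMatrix (N : ℕ) : Matrix (Fin N) (Fin N) (MvPolynomial (Fin 2) ℚ) :=
  Matrix.of fun j k =>
    if k = j then .X 0 * (.X 1 ^ 2 - 1) + (.X 0 ^ 2 - 1) * .X 1
    else if (k : ℕ) % 2 = j % 2 then (.X 0 ^ 2 - 1) * .X 1
    else if k < j then (.X 0 ^ 2 - 1) * .X 1 ^ 2 else .X 0 ^ 2 - 1

/-- At `v = 1` every entry off the diagonal vanishes, having the factor `v² - 1`, and the diagonal
becomes `l² - 1`; the choice `l = 2` makes it `3`. -/
theorem det_lkPolyMatrix_ne_zero (N : ℕ) : (lkPolyMatrix N).det ≠ 0 := by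
  intro h
  have h' := congrArg (MvPolynomial.eval ![1, 2]) h
  have e : (MvPolynomial.eval ![1, 2]).mapMatrix (lkPolyMatrix N) =
      Matrix.diagonal fun _ => (3 : ℚ) := by
    ext j k
    rcases eq_or_ne k j with rfl | hkj
    · norm_num [lkPolyMatrix]
    · simp only [RingHom.mapMatrix_apply, Matrix.map_apply, lkPolyMatrix, Matrix.of_apply,
        if_neg hkj, Matrix.diagonal_apply_ne _ hkj.symm]
      split_ifs <;> simp
  rw [RingHom.map_det, e, Matrix.det_diagonal, map_zero, Finset.prod_const] at h'
  exact pow_ne_zero _ (by norm_num) h'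

theorem ne_zero_of_algebraicIndependent [CharZero F] {v l : F}
    (h : AlgebraicIndependent ℚ ![v, l]) : v - v⁻¹ ≠ 0 ∧ l ≠ 0 := by
  have hinj := (injective_iff_map_eq_zero _).1 (algebraicIndependent_iff_injective_aeval.1 h)
  constructor
  · intro h0
    -- The extra factor `v²` also covers `v = 0`, where `v - v⁻¹` vanishes by the convention `0⁻¹ =
    -- 0`.
    have h1 : v ^ 2 * (v ^ 2 - 1) = 0 := by
      by_cases hv : v = 0
      · simp [hv]
      · have : v ^ 2 - 1 = v * (v - v⁻¹) := by field_simp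
        rw [this, h0, mul_zero, mul_zero]
    have h2 := hinj (.X 0 ^ 2 * (.X 0 ^ 2 - 1)) (by simpa using h1)
    have h3 := congrArg (MvPolynomial.eval ![2, 0]) h2
    norm_num at h3
  · intro h0
    have h2 := hinj (.X 1) (by simpa using h0)
    exact MvPolynomial.X_ne_zero _ h2

theorem det_lkCoeff_ne_zero [CharZero F] {v l : F} (hv : v ≠ 0)
    (h : AlgebraicIndependent ℚ ![v, l]) (N : ℕ) :
    (Matrix.of fun j k : Fin N => lkCoeff (v - v⁻¹) l j k).det ≠ 0 := by
  intro h0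
  obtain ⟨hm, hl⟩ := ne_zero_of_algebraicIndependent h
  have hinj := (injective_iff_map_eq_zero _).1 (algebraicIndependent_iff_injective_aeval.1 h)
  refine det_lkPolyMatrix_ne_zero N (hinj _ ?_)
  have e : (MvPolynomial.aeval ![v, l] : MvPolynomial (Fin 2) ℚ →ₐ[ℚ] F).mapMatrix
      (lkPolyMatrix N) = (v * l * (v - v⁻¹)) •
        Matrix.of fun j k : Fin N => lkCoeff (v - v⁻¹) l j k := by
    ext j k
    have hm' : v ^ 2 - 1 ≠ 0 := by
      have : v ^ 2 - 1 = v * (v - v⁻¹) := by field_simp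
      rw [this]
      exact mul_ne_zero hv hm
    simp only [AlgHom.mapMatrix_apply, Matrix.map_apply, lkPolyMatrix, Matrix.of_apply,
      Matrix.smul_apply, lkCoeff, Fin.val_inj, Fin.lt_def, smul_eq_mul]
    split_ifs <;> simp <;> field_simp
  rw [AlgHom.map_det, e, Matrix.det_smul, h0, mul_zero]

end Independence

/-! ### Lifting a cell datum from the Hecke algebra -/

section Lifting

universe u

variable {F : Type*} [Field F] {n : ℕ} {v l : F}

theorem rev_liftCell {M : Type*} [LinearOrder M] {m : F} (D : M → M → BMW n m l) (S T : M) :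
    BMW.rev n m l (liftCell n m l D S T) = liftCell n m l D T S := by
  rcases lt_trichotomy S T with h | rfl | h
  · simp only [liftCell, if_pos h, if_neg h.not_gt]
  · simp only [liftCell, lt_irrefl, if_false, map_smul, map_add, BMW.rev_rev]
    rw [add_comm]
  · simp only [liftCell, if_pos h, if_neg h.not_gt, BMW.rev_rev]

/-- `π` commutes with reversal, so reversed lifts cover the reversed basis elements. On the diagonal
both summands map to `C S S`, and the factor `2⁻¹` restores it. -/
theorem toHecke_liftCell [CharZero F] (hv : v ≠ 0) {M : Type*} [LinearOrder M]
    {C : M → M → Hecke n v} (hC : ∀ S T, Hecke.rev n v (C S T) = C T S)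
    {D : M → M → BMW n (v - v⁻¹) l} (hD : ∀ S T, S ≤ T → toHecke n v l hv (D S T) = C S T)
    (S T : M) : toHecke n v l hv (liftCell n (v - v⁻¹) l D S T) = C S T := by
  rcases lt_trichotomy S T with h | rfl | h
  · rw [liftCell, if_pos h, hD S T h.le]
  · rw [liftCell, if_neg (lt_irrefl _), if_neg (lt_irrefl _), map_smul, map_add, toHecke_rev,
      hD S S le_rfl, hC, ← two_smul F, smul_smul, inv_mul_cancel₀ two_ne_zero, one_smul]
  · rw [liftCell, if_neg h.not_gt, if_pos h, toHecke_rev, hD T S h.le, hC]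

variable {Λ : Type u}

/-- The index set of the lifted cell datum is the disjoint union of the index set of the extra
cell and that of the given cell datum. -/
def cellIndexEquiv (n : ℕ) (M : Λ → Type) :
    (Fin (2 * n + 1) × Fin (2 * n + 1)) ⊕ (Σ μ : Λ, M μ × M μ) ≃
      (Σ μ : WithBot Λ, cellIndex n M μ × cellIndex n M μ) where
  toFun := Sum.elim (fun x => ⟨⊥, x⟩) (fun x => ⟨(x.1 : WithBot Λ), x.2⟩)
  invFun x := WithBot.recBotCoe
    (C := fun μ => cellIndex n M μ × cellIndex n M μ →
      (Fin (2 * n + 1) × Fin (2 * n + 1)) ⊕ (Σ μ : Λ, M μ × M μ))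
    (fun x => Sum.inl x) (fun μ x => Sum.inr ⟨μ, x⟩) x.1 x.2
  left_inv := by rintro (x | x) <;> rfl
  right_inv := by
    rintro ⟨μ, x⟩
    induction μ using WithBot.recBotCoe <;> rfl

theorem cellElement_comp_cellIndexEquiv (m : F) (M : Λ → Type) [∀ μ, LinearOrder (M μ)]
    (D : ∀ μ, M μ → M μ → BMW n m l) :
    (fun x : (Σ μ : WithBot Λ, cellIndex n M μ × cellIndex n M μ) =>
        cellElement n m l M D x.1 x.2.1 x.2.2) ∘ cellIndexEquiv n M =
      Sum.elim (fun x => BMW.lkElement n m l x.1 x.2)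
        (fun x => liftCell n m l (D x.1) x.2.1 x.2.2) := by
  ext (x | x) <;> rfl

variable [CharZero F] [PartialOrder Λ]

/-- Every cell datum of the Hecke algebra with word reversal lifts to the BMW algebra. -/
theorem isCellDatum_cellElement (hv : v ≠ 0) (hvl : AlgebraicIndependent ℚ ![v, l])
    (M : Λ → Type) [∀ μ, Fintype (M μ)] [∀ μ, LinearOrder (M μ)]
    (C : ∀ μ, M μ → M μ → Hecke n v) (D : ∀ μ, M μ → M μ → BMW n (v - v⁻¹) l)
    (hC : IsCellDatum Λ M C (Hecke.rev n v))
    (hD : ∀ (μ : Λ) (S T : M μ), S ≤ T → toHecke n v l hv (D μ S T) = C μ S T) :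
    IsCellDatum (WithBot Λ) (cellIndex n M) (cellElement n (v - v⁻¹) l M D)
      (BMW.rev n (v - v⁻¹) l) := by
  obtain ⟨hm, hl⟩ := ne_zero_of_algebraicIndependent hvl
  set π := toHecke n v l hv with hπ
  have hlift : ∀ (μ : Λ) (S T : M μ), π (liftCell n (v - v⁻¹) l (D μ) S T) = C μ S T :=
    fun μ S T => toHecke_liftCell hv (hC.star_C μ) (hD μ) S T
  have hcomp : (π.toLinearMap ∘ fun x : (Σ μ : Λ, M μ × M μ) =>
      liftCell n (v - v⁻¹) l (D x.1) x.2.1 x.2.2) = fun x => C x.1 x.2.1 x.2.2 :=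
    funext fun x => hlift x.1 x.2.1 x.2.2
  have hker : BMW.lkSpan n (v - v⁻¹) l ≤ LinearMap.ker π.toLinearMap :=
    Submodule.span_le.2 (Set.range_subset_iff.2 fun x => toHecke_lkElement hv x.1 x.2)
  have hind : LinearIndependent F
      (fun x : (Σ μ : WithBot Λ, cellIndex n M μ × cellIndex n M μ) =>
        cellElement n (v - v⁻¹) l M D x.1 x.2.1 x.2.2) := by
    rw [← linearIndependent_equiv (cellIndexEquiv n M), cellElement_comp_cellIndexEquiv]
    have h2 : LinearIndependent F (π.toLinearMap ∘ fun x : (Σ μ : Λ, M μ × M μ) =>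
        liftCell n (v - v⁻¹) l (D x.1) x.2.1 x.2.2) := hcomp ▸ hC.linearIndependent
    -- The images of the lifts under `π` are independent, so the span of the lifts meets `ker π`,
    -- and hence the bottom cell, only in `0`.
    exact (lkElement_linearIndependent hm hl (det_lkCoeff_ne_zero hv hvl _)).sum_type
      (LinearIndependent.of_comp _ h2)
      ((Submodule.range_ker_disjoint h2).symm.mono_left hker)
  refine ⟨hind.injective, hind, ?_, BMW.rev_mul, BMW.rev_rev, ?_, ?_⟩
  · rw [← (cellIndexEquiv n M).surjective.range_comp, cellElement_comp_cellIndexEquiv,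
      Set.Sum.elim_range, Submodule.span_union, eq_top_iff]
    intro b _
    -- Some combination of lifts has the same image as `b`; the difference lies in `ker π`, which
    -- the bottom cell spans.
    have hb : π b ∈ (Submodule.span F (Set.range fun x : (Σ μ : Λ, M μ × M μ) =>
        liftCell n (v - v⁻¹) l (D x.1) x.2.1 x.2.2)).map π.toLinearMap := by
      rw [Submodule.map_span, ← Set.range_comp, hcomp, hC.span_eq_top]
      trivial
    obtain ⟨c, hc, hcb⟩ := hb
    have h0 : π (b - c) = 0 := by rw [map_sub, sub_eq_zero]; exact hcb.symm
    rw [← sub_add_cancel b c]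
    exact Submodule.add_mem_sup (mem_lkSpan_of_toHecke_eq_zero hv hl h0) hc
  · intro μ
    induction μ using WithBot.recBotCoe with
    | bot => exact BMW.rev_lkElement
    | coe μ => exact rev_liftCell (D μ)
  · intro a μ
    induction μ using WithBot.recBotCoe with
    | bot =>
      obtain ⟨r, hr⟩ := BMW.exists_mul_lkElement hl a
      refine ⟨r, fun (S T : Fin (2 * n + 1)) => ?_⟩
      change a * BMW.lkElement n (v - v⁻¹) l S T -
        ∑ S' : Fin (2 * n + 1), r S' S • BMW.lkElement n (v - v⁻¹) l S' T ∈ _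
      rw [hr, sub_self]
      exact Submodule.zero_mem _
    | coe μ =>
      obtain ⟨r, hr⟩ := hC.mul_C (π a) μ
      refine ⟨r, fun (S T : M μ) => ?_⟩
      set L := Submodule.span F {x : BMW n (v - v⁻¹) l | ∃ κ : WithBot Λ, κ < μ ∧
        ∃ P Q : cellIndex n M κ, x = cellElement n (v - v⁻¹) l M D κ P Q} with hL
      change a * liftCell n (v - v⁻¹) l (D μ) S T -
        ∑ S' : M μ, r S' S • liftCell n (v - v⁻¹) l (D μ) S' T ∈ L
      set b := a * liftCell n (v - v⁻¹) l (D μ) S T -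
        ∑ S' : M μ, r S' S • liftCell n (v - v⁻¹) l (D μ) S' T with hb
      -- The error term in (C3) is controlled only after `π`, by (C3) in the Hecke algebra. What is
      -- lost lies in `ker π`, and `L` contains it because the bottom cell is below `μ`.
      have hπb : π b ∈ L.map π.toLinearMap := by
        have h := hr S T
        have e : π b = π a * C μ S T - ∑ S' : M μ, r S' S • C μ S' T := by
          simp only [hb, map_sub, map_mul, map_sum, map_smul, hlift]
        rw [e]
        refine Submodule.span_le.2 ?_ h
        rintro x ⟨κ, hκ, P, Q, rfl⟩
        exact ⟨_, Submodule.subset_span ⟨κ, WithBot.coe_lt_coe.2 hκ, P, Q, rfl⟩, hlift κ P Q⟩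
      obtain ⟨c, hc, hcb⟩ := hπb
      have h0 : π (b - c) = 0 := by rw [map_sub, sub_eq_zero]; exact hcb.symm
      have hle : BMW.lkSpan n (v - v⁻¹) l ≤ L := Submodule.span_le.2 <|
        Set.range_subset_iff.2 fun x =>
          Submodule.subset_span ⟨⊥, WithBot.bot_lt_coe μ, x.1, x.2, rfl⟩
      rw [← sub_add_cancel b c]
      exact L.add_mem (hle (mem_lkSpan_of_toHecke_eq_zero hv hl h0)) hc

theorem toHecke_cellElement (hv : v ≠ 0)
    (M : Λ → Type) [∀ μ, Fintype (M μ)] [∀ μ, LinearOrder (M μ)]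
    (C : ∀ μ, M μ → M μ → Hecke n v) (D : ∀ μ, M μ → M μ → BMW n (v - v⁻¹) l)
    (hC : IsCellDatum Λ M C (Hecke.rev n v))
    (hD : ∀ (μ : Λ) (S T : M μ), S ≤ T → toHecke n v l hv (D μ S T) = C μ S T)
    (μ : Λ) (S T : M μ) :
    toHecke n v l hv (cellElement n (v - v⁻¹) l M D (μ : WithBot Λ) S T) = C μ S T :=
  toHecke_liftCell hv (hC.star_C μ) (hD μ) S T

end Lifting

open Polynomial

/-! ### The polynomial governing the braid relation -/

section BraidPolynomial

variable (F : Type*) [Field F]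

/-- The polynomial `Q_k` with `Q_k(2 + q + q⁻¹) = q^(-k) + ⋯ + q^k`. -/
noncomputable def braidPoly : ℕ → F[X]
  | 0 => 1
  | 1 => X - 1
  | k + 2 => (X - 2) * braidPoly (k + 1) - braidPoly k

variable {F}

/-- The recursion reaches back two steps, so consecutive indices are carried together. -/
theorem braidPoly_monic_natDegree (k : ℕ) :
    (braidPoly F k).Monic ∧ (braidPoly F k).natDegree = k ∧
      (braidPoly F (k + 1)).Monic ∧ (braidPoly F (k + 1)).natDegree = k + 1 := by
  induction k with
  | zero =>
    have h : braidPoly F 1 = X - C 1 := by simp [braidPoly]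
    rw [zero_add, h]
    exact ⟨monic_one, natDegree_one, monic_X_sub_C 1, natDegree_X_sub_C 1⟩
  | succ k ih =>
    obtain ⟨h1, h2, h3, h4⟩ := ih
    have e : braidPoly F (k + 1 + 1) = (X - C 2) * braidPoly F (k + 1) - braidPoly F k := by
      rw [braidPoly, show (C 2 : F[X]) = 2 from rfl]
    have hm : ((X - C 2) * braidPoly F (k + 1)).Monic := (monic_X_sub_C 2).mul h3
    have hd : ((X - C 2) * braidPoly F (k + 1)).natDegree = k + 1 + 1 := by
      rw [(monic_X_sub_C 2).natDegree_mul h3, natDegree_X_sub_C, h4, add_comm]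
    have hlt : (braidPoly F k).degree < ((X - C 2) * braidPoly F (k + 1)).degree := by
      rw [degree_eq_natDegree h1.ne_zero, degree_eq_natDegree hm.ne_zero, hd, h2]
      exact_mod_cast (by omega)
    refine ⟨h3, h4, e ▸ hm.sub_of_left hlt, ?_⟩
    rw [e, natDegree_sub_eq_left_of_natDegree_lt (by omega), hd]

theorem eval_braidPoly {q : F} (hq : q ≠ 0) (k : ℕ) :
    (q - 1) * (q ^ k * (braidPoly F k).eval (2 + q + q⁻¹)) = q ^ (2 * k + 1) - 1 := by
  induction k using Nat.twoStepInduction with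
  | zero => simp [braidPoly]
  | one =>
    simp only [braidPoly, eval_sub, eval_X, eval_one]
    field_simp
    ring
  | more k ih ih' =>
    have e : (q - 1) * (q ^ (k + 2) * (braidPoly F (k + 2)).eval (2 + q + q⁻¹)) =
        (q ^ 2 + 1) * ((q - 1) * (q ^ (k + 1) * (braidPoly F (k + 1)).eval (2 + q + q⁻¹))) -
          q ^ 2 * ((q - 1) * (q ^ k * (braidPoly F k).eval (2 + q + q⁻¹))) := by
      simp only [braidPoly, eval_sub, eval_mul, eval_X, eval_ofNat]
      field_simp
      ring
    rw [e, ih, ih']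
    ring

theorem braidPoly_map {K : Type*} [Field K] (f : F →+* K) (k : ℕ) :
    (braidPoly F k).map f = braidPoly K k := by
  induction k using Nat.twoStepInduction with
  | zero => simp [braidPoly]
  | one => simp [braidPoly]
  | more k ih ih' => simp [braidPoly, ih, ih']

theorem braidPoly_eq_prod {n : ℕ} {c : ℕ → F} (hc : Set.InjOn c (Finset.range n))
    (h : ∀ j < n, (braidPoly F n).eval (c j) = 0) :
    braidPoly F n = ∏ j ∈ Finset.range n, (X - C (c j)) := by
  obtain ⟨hm, hd, -⟩ := braidPoly_monic_natDegree (F := F) n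
  have hm' : (∏ j ∈ Finset.range n, (X - C (c j))).Monic := monic_prod_X_sub_C _ _
  have hd' : (∏ j ∈ Finset.range n, (X - C (c j))).natDegree = n := by
    rw [natDegree_finsetProd_X_sub_C_eq_card, Finset.card_range]
  classical
  refine eq_of_degree_sub_lt_of_eval_finset_eq ((Finset.range n).image c) ?_ fun x hx => ?_
  · rw [Finset.card_image_of_injOn hc, Finset.card_range]
    refine (degree_sub_lt_left ?_ hm.ne_zero ?_).trans_le ?_
    · rw [degree_eq_natDegree hm.ne_zero, degree_eq_natDegree hm'.ne_zero, hd, hd']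
    · rw [hm.leadingCoeff, hm'.leadingCoeff]
    · rw [degree_eq_natDegree hm.ne_zero, hd]
  · obtain ⟨j, hj, rfl⟩ := Finset.mem_image.1 hx
    rw [h j (Finset.mem_range.1 hj), eval_prod, Finset.prod_eq_zero hj (by simp)]

end BraidPolynomial

/-! ### The braid relation for a pair of quadratic elements -/

section QuadraticPair

variable {F A : Type*} [Field F] [Ring A] [Algebra F A]

/-- For `a² = δ a` and `b² = δ b`, this element commutes with `a` and `b`. -/
def pairCasimir (δ : F) (a b : A) : A := a * b + b * a - δ • (a + b) + δ ^ 2 • 1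

variable {δ : F} {a b : A}

theorem pairCasimir_comm : pairCasimir δ a b = pairCasimir δ b a := by
  rw [pairCasimir, pairCasimir, add_comm (a * b), add_comm a b]

/-- Once `a² = δ a` is used, every term but `aba` cancels. The result is symmetric under reversal,
whence centrality; and where `t` acts by a scalar `c` it says `aba = c a`. -/
theorem pairCasimir_mul_left (ha : a * a = δ • a) : pairCasimir δ a b * a = a * b * a := by
  simp only [pairCasimir, add_mul, sub_mul, smul_mul_assoc, mul_assoc, ha, one_mul, mul_smul_comm]
  module

theorem mul_pairCasimir_left (ha : a * a = δ • a) : a * pairCasimir δ a b = a * b * a := by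
  simp only [pairCasimir, mul_add, mul_sub, mul_smul_comm, ← mul_assoc, ha, mul_one,
    smul_mul_assoc]
  module

theorem commute_pairCasimir_left (ha : a * a = δ • a) : Commute (pairCasimir δ a b) a :=
  (pairCasimir_mul_left ha).trans (mul_pairCasimir_left ha).symm

theorem commute_pairCasimir_right (hb : b * b = δ • b) : Commute (pairCasimir δ a b) b :=
  pairCasimir_comm (δ := δ) (a := a) (b := b) ▸ commute_pairCasimir_left hb

theorem sub_smul_one_mul_self {v : F} (hv : v ≠ 0) (ha : a * a = (v + v⁻¹) • a) :
    (a - v • 1) * (a - v • 1) = 1 - (v - v⁻¹) • (a - v • 1) := by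
  have h : (v - v⁻¹) • v • (1 : A) = v • v • 1 - 1 := by
    rw [sub_smul, inv_smul_smul₀ hv]
  simp only [sub_mul, mul_sub, ha, smul_mul_assoc, mul_smul_comm, one_mul, mul_one]
  rw [smul_sub (v - v⁻¹), h]
  module

/-- With `x = a - v` and `y = b - v`, this is the Cayley–Hamilton identity for `xy`, of determinant
`1` and trace `t - 2` as in the two-dimensional representations. -/
theorem pair_square_add_one {v : F} (hv : v ≠ 0) (ha : a * a = (v + v⁻¹) • a)
    (hb : b * b = (v + v⁻¹) • b) :
    ((a - v • 1) * (b - v • 1)) * ((a - v • 1) * (b - v • 1)) + 1 =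
      (pairCasimir (v + v⁻¹) a b - 2) * ((a - v • 1) * (b - v • 1)) := by
  have hx := sub_smul_one_mul_self hv ha
  have hy := sub_smul_one_mul_self hv hb
  have hs : pairCasimir (v + v⁻¹) a b - 2 = (a - v • 1) * (b - v • 1) +
      (b - v • 1) * (a - v • 1) + (v - v⁻¹) • ((a - v • 1) + (b - v • 1)) +
        (v - v⁻¹) ^ 2 • 1 := by
    have h2 : (2 : A) = (2 : F) • 1 := by rw [two_smul, one_add_one_eq_two]
    have e1 : (v + v⁻¹) ^ 2 = v * v + 2 + v⁻¹ * v⁻¹ := by field_simp; ring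
    have e2 : (v - v⁻¹) ^ 2 = v * v - 2 + v⁻¹ * v⁻¹ := by field_simp; ring
    have e3 : (v - v⁻¹) • v • (1 : A) = (v * v - 1) • 1 := by
      rw [smul_smul]; congr 1; field_simp
    simp only [pairCasimir, h2, e1, e2, sub_mul, mul_sub, smul_mul_assoc, mul_smul_comm, one_mul,
      mul_one, smul_sub, smul_add, e3]
    module
  rw [hs]
  generalize a - v • 1 = x at *
  generalize b - v • 1 = y at *
  have hx' : ∀ z, x * (x * z) = z - (v - v⁻¹) • (x * z) := fun z => by
    rw [← mul_assoc, hx, sub_mul, one_mul, smul_mul_assoc]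
  simp only [add_mul, smul_mul_assoc, mul_assoc, hx', hy, mul_sub, mul_smul_comm,
    one_mul]
  module

/-- By the Cayley–Hamilton identity, odd alternating words obey the two-step recursion that defines
`braidPoly`, with the central `t` as its variable; only the lengths `1` and `3` need a computation.
-/
theorem altL_sub_altL {v : F} (hv : v ≠ 0) (ha : a * a = (v + v⁻¹) • a)
    (hb : b * b = (v + v⁻¹) • b) (k : ℕ) :
    altL (a - v • 1) (b - v • 1) (2 * k + 1) - altL (b - v • 1) (a - v • 1) (2 * k + 1) =
      aeval (pairCasimir (v + v⁻¹) a b) (braidPoly F k) * (a - b) := by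
  have h1 := pair_square_add_one hv ha hb
  have h2 := pair_square_add_one hv hb ha
  rw [pairCasimir_comm] at h2
  induction k using Nat.twoStepInduction with
  | zero => simp [altL, braidPoly]
  | one =>
    have hδ : ∀ z : A, v • v⁻¹ • z = z := smul_inv_smul₀ hv
    have e2 : (aeval (pairCasimir (v + v⁻¹) a b)) (braidPoly F 1) * (a - b) =
        a * b * a - b * a * b - (a - b) := by
      rw [braidPoly, map_sub, aeval_X, map_one, sub_mul, mul_sub, one_mul,
        pairCasimir_mul_left ha, pairCasimir_comm, pairCasimir_mul_left hb]
    rw [e2]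
    simp only [altL, mul_one, sub_mul, mul_sub, smul_mul_assoc, mul_smul_comm, one_mul, smul_sub,
      ha, hb, mul_assoc, add_smul, smul_add, hδ]
    module
  | more k ih ih' =>
    have r : ∀ x y : A, (x * y) * (x * y) + 1 = (pairCasimir (v + v⁻¹) a b - 2) * (x * y) →
        altL x y (2 * (k + 2) + 1) = (pairCasimir (v + v⁻¹) a b - 2) * altL x y (2 * (k + 1) + 1) -
          altL x y (2 * k + 1) := by
      intro x y h
      have e : ∀ N, altL x y (N + 2) = x * y * altL x y N := fun N => (mul_assoc x y _).symm
      rw [show 2 * (k + 2) + 1 = 2 * k + 1 + 2 + 2 by ring,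
        show 2 * (k + 1) + 1 = 2 * k + 1 + 2 by ring, e, e, ← mul_assoc (x * y) (x * y),
        ← mul_assoc _ (x * y), eq_sub_of_add_eq h, sub_mul, one_mul]
    rw [r _ _ h1, r _ _ h2, braidPoly, map_sub, map_mul, map_sub, aeval_X,
      sub_mul _ _ (a - b), ← ih, mul_assoc, ← ih', show aeval (pairCasimir (v + v⁻¹) a b) (2 : F[X]) = 2 from map_ofNat _ 2]
    noncomm_ring

end QuadraticPair

/-! ### The cells in terms of the two quadratic generators -/

section Cells

variable {F A : Type*} [Field F] [Ring A] [Algebra F A]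

/-- The product of the first `k` factors `t - c_j`, where `t` is `pairCasimir δ a b`. -/
noncomputable def cellFactor (δ : F) (c : ℕ → F) (a b : A) (k : ℕ) : A :=
  aeval (pairCasimir δ a b) (∏ j ∈ Finset.range k, (X - C (c j)))

/-- The index set of the `i`-th cell of the dihedral Hecke algebra has one or two elements. -/
def cellSize (n i : ℕ) : ℕ := if i = 0 ∨ i = n + 1 then 1 else 2

/-- The elements of the `i`-th cell of the dihedral Hecke algebra. -/
noncomputable def heckeCell (δ : F) (c : ℕ → F) (a b : A) : ℕ → ℕ → ℕ → A
  | 0, _, _ => 1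
  | k + 1, S, T => cellFactor δ c a b k * ((if S = 0 then 1 else b) * a * (if T = 0 then 1 else b))

/-- The span of the elements of the cells after the `i`-th. -/
noncomputable def heckeCellSpan (n : ℕ) (δ : F) (c : ℕ → F) (a b : A) (i : ℕ) : Submodule F A :=
  Submodule.span F {x | ∃ κ, i < κ ∧ κ ≤ n + 1 ∧ ∃ P Q, P < cellSize n κ ∧ Q < cellSize n κ ∧
    x = heckeCell δ c a b κ P Q}

variable {δ : F} {c : ℕ → F} {a b : A}

theorem map_pairCasimir {B : Type*} [Ring B] [Algebra F B] (f : A →ₐ[F] B) :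
    f (pairCasimir δ a b) = pairCasimir δ (f a) (f b) := by
  simp [pairCasimir]

theorem map_cellFactor {B : Type*} [Ring B] [Algebra F B] (f : A →ₐ[F] B) (k : ℕ) :
    f (cellFactor δ c a b k) = cellFactor δ c (f a) (f b) k := by
  rw [cellFactor, ← aeval_algHom_apply, map_pairCasimir, cellFactor]

theorem map_heckeCell {B : Type*} [Ring B] [Algebra F B] (f : A →ₐ[F] B) (i S T : ℕ) :
    f (heckeCell δ c a b i S T) = heckeCell δ c (f a) (f b) i S T := by
  cases i with
  | zero => simp [heckeCell]
  | succ k => simp [heckeCell, map_cellFactor, apply_ite f]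

theorem cellFactor_zero : cellFactor δ c a b 0 = 1 := by simp [cellFactor]

theorem cellFactor_succ (k : ℕ) : cellFactor δ c a b (k + 1) =
    cellFactor δ c a b k * (pairCasimir δ a b - c k • 1) := by
  rw [cellFactor, Finset.prod_range_succ, map_mul, map_sub, aeval_X, aeval_C,
    Algebra.algebraMap_eq_smul_one, cellFactor]

theorem commute_cellFactor {x : A} (hx : Commute (pairCasimir δ a b) x) (k : ℕ) :
    Commute (cellFactor δ c a b k) x := by
  induction k with
  | zero => rw [cellFactor_zero]; exact Commute.one_left x
  | succ k ih =>
    rw [cellFactor_succ]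
    exact ih.mul_left (hx.sub_left ((Commute.one_left x).smul_left (c k)))

/-- The next factor is `t - c_k`, so behind the first `k` factors `aba = t a` may be replaced by
`c_k a`, modulo the next cell. -/
theorem cellFactor_mul_left (ha : a * a = δ • a) (k : ℕ) (z : A) :
    cellFactor δ c a b k * (a * (b * (a * z))) =
      cellFactor δ c a b (k + 1) * (a * z) + c k • (cellFactor δ c a b k * (a * z)) := by
  rw [cellFactor_succ, mul_assoc (cellFactor δ c a b k), sub_mul,
    ← mul_assoc (pairCasimir δ a b) a z,
    pairCasimir_mul_left ha, smul_mul_assoc, one_mul, mul_sub, mul_smul_comm, sub_add_cancel,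
    mul_assoc, mul_assoc]

theorem heckeCell_mem_span {n i κ P Q : ℕ} (h : i < κ) (h' : κ ≤ n + 1) (hP : P < cellSize n κ)
    (hQ : Q < cellSize n κ) : heckeCell δ c a b κ P Q ∈ heckeCellSpan n δ c a b i :=
  Submodule.subset_span ⟨κ, h, h', P, Q, hP, hQ, rfl⟩

theorem cellSize_middle {n k : ℕ} (hk : k < n) : cellSize n (k + 1) = 2 :=
  if_neg (by omega)

theorem cellSize_last (n : ℕ) : cellSize n (n + 1) = 1 := if_pos (Or.inr rfl)

theorem cellSize_pos (n i : ℕ) : 0 < cellSize n i := by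
  unfold cellSize; split_ifs <;> norm_num

variable {n : ℕ}

/-- Only `a`, `ab`, `ba`, `bab` appear in the cells, so `b` itself must be recovered. Writing `R_k`
for the product of the first `k` factors, `R_k bab = R_{k+1} b + c_k R_k b` can be solved for `R_k
b` as `c_k ≠ 0`. The descent starts at `R_n b = R_n a`, the last cell. -/
theorem cellFactor_mul_right_mem (hb : b * b = δ • b) (hc : ∀ j < n, c j ≠ 0)
    (hn : cellFactor δ c a b n * a = cellFactor δ c a b n * b) {i k : ℕ} (hk : k ≤ n)
    (hi : i ≤ k) : cellFactor δ c a b k * b ∈ heckeCellSpan n δ c a b i := by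
  induction hk using Nat.decreasingInduction with
  | self =>
    rw [← hn]
    have h := heckeCell_mem_span (δ := δ) (c := c) (a := a) (b := b) (n := n)
      (Nat.lt_succ_of_le hi) le_rfl (cellSize_pos _ _) (cellSize_pos _ _)
    simpa [heckeCell] using h
  | of_succ k hk ih =>
    have h1 : heckeCell δ c a b (k + 1) 1 1 ∈ heckeCellSpan n δ c a b i :=
      heckeCell_mem_span (by omega) (by omega) (by rw [cellSize_middle hk]; norm_num)
        (by rw [cellSize_middle hk]; norm_num)
    have e : heckeCell δ c a b (k + 1) 1 1 =
        cellFactor δ c a b (k + 1) * b + c k • (cellFactor δ c a b k * b) := by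
      simp only [heckeCell, one_ne_zero, if_false]
      rw [← pairCasimir_mul_left hb, pairCasimir_comm, cellFactor_succ, mul_assoc, sub_mul,
        smul_mul_assoc, one_mul, mul_sub, mul_smul_comm, sub_add_cancel]
    rw [← inv_smul_smul₀ (hc k hk) (cellFactor δ c a b k * b), eq_sub_of_add_eq' e.symm]
    exact Submodule.smul_mem _ _ (Submodule.sub_mem _ h1 (ih (by omega)))

theorem cellFactor_mul_left_mem (hb : b * b = δ • b)
    (hn : cellFactor δ c a b n * a = cellFactor δ c a b n * b) {k T : ℕ} (hk : k < n)
    (hT : T < 2) : cellFactor δ c a b (k + 1) * (a * (if T = 0 then 1 else b)) ∈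
      heckeCellSpan n δ c a b (k + 1) := by
  rcases (show k + 1 ≤ n from hk).eq_or_lt with h | h
  · have h0 : cellFactor δ c a b n * a ∈ heckeCellSpan n δ c a b (k + 1) := by
      have h := heckeCell_mem_span (δ := δ) (c := c) (a := a) (b := b) (n := n) (i := k + 1)
        (show k + 1 < n + 1 by omega) le_rfl (cellSize_pos _ _) (cellSize_pos _ _)
      simpa [heckeCell] using h
    subst h
    split_ifs
    · rwa [mul_one]
    · rw [← mul_assoc, hn, mul_assoc, hb, mul_smul_comm, ← hn]
      exact Submodule.smul_mem _ _ h0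
  · have h := heckeCell_mem_span (δ := δ) (c := c) (a := a) (b := b) (n := n) (i := k + 1)
      (Nat.lt_succ_self _) (show k + 1 + 1 ≤ n + 1 by omega) (cellSize_pos _ _)
      (Q := T) (by rwa [cellSize_middle h])
    simpa [heckeCell] using h

theorem left_mul_heckeCell (ha : a * a = δ • a) (hb : b * b = δ • b)
    (hn : cellFactor δ c a b n * a = cellFactor δ c a b n * b) {i : ℕ} (hi : i ≤ n + 1) :
    ∃ r : ℕ → ℕ → F, ∀ S < cellSize n i, ∀ T < cellSize n i,
      a * heckeCell δ c a b i S T - ∑ S' ∈ Finset.range (cellSize n i),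
        r S' S • heckeCell δ c a b i S' T ∈ heckeCellSpan n δ c a b i := by
  have hR : ∀ k z, a * (cellFactor δ c a b k * z) = cellFactor δ c a b k * (a * z) := fun k z =>
    (commute_cellFactor (commute_pairCasimir_left ha) k).symm.left_comm z
  have haa : ∀ z, a * (a * z) = δ • (a * z) := fun z => by
    rw [← mul_assoc, ha, smul_mul_assoc]
  rcases i with _ | k
  · refine ⟨0, fun S _ T _ => ?_⟩
    have h := heckeCell_mem_span (δ := δ) (c := c) (a := a) (b := b) (n := n) (i := 0)
      Nat.one_pos (Nat.le_add_left 1 n) (cellSize_pos _ _) (cellSize_pos _ _)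
    simpa [heckeCell, cellFactor_zero] using h
  rcases (show k ≤ n by omega).eq_or_lt with rfl | hk
  · refine ⟨fun _ _ => δ, fun S hS T hT => ?_⟩
    rw [cellSize_last, Nat.lt_one_iff] at hS hT
    simp [hS, hT, cellSize_last, heckeCell, hR, ha]
  -- The left index `0` stands for `a` and `1` for `ba`; here `a·a = δ a` and `a·ba ≡ c_k a`.
  · refine ⟨fun S' S => if S' = 0 then (if S = 0 then δ else c k) else 0, fun S hS T hT => ?_⟩
    rw [cellSize_middle hk] at hS hT ⊢
    rw [Finset.sum_range_succ, Finset.sum_range_one]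
    interval_cases S
    · simp only [heckeCell]
      generalize (if T = 0 then (1 : A) else b) = w
      simp [hR, mul_assoc, haa]
    · have e := cellFactor_mul_left_mem hb hn hk hT
      simp only [heckeCell]
      generalize (if T = 0 then (1 : A) else b) = w at *
      simpa [hR, mul_assoc, cellFactor_mul_left ha] using e

theorem right_mul_heckeCell (hb : b * b = δ • b) (hc : ∀ j < n, c j ≠ 0)
    (hn : cellFactor δ c a b n * a = cellFactor δ c a b n * b) {i : ℕ} (hi : i ≤ n + 1) :
    ∃ r : ℕ → ℕ → F, ∀ S < cellSize n i, ∀ T < cellSize n i,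
      b * heckeCell δ c a b i S T - ∑ S' ∈ Finset.range (cellSize n i),
        r S' S • heckeCell δ c a b i S' T ∈ heckeCellSpan n δ c a b i := by
  have hRc : ∀ k, Commute (cellFactor δ c a b k) b := fun k =>
    commute_cellFactor (commute_pairCasimir_right hb) k
  have hR : ∀ k z, b * (cellFactor δ c a b k * z) = cellFactor δ c a b k * (b * z) := fun k z =>
    (hRc k).symm.left_comm z
  have hbb : ∀ z, b * (b * z) = δ • (b * z) := fun z => by
    rw [← mul_assoc, hb, smul_mul_assoc]
  rcases i with _ | k
  · refine ⟨0, fun S _ T _ => ?_⟩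
    have h := cellFactor_mul_right_mem hb hc hn (Nat.zero_le n) le_rfl
    simpa [heckeCell, cellFactor_zero] using h
  rcases (show k ≤ n by omega).eq_or_lt with rfl | hk
  · refine ⟨fun _ _ => δ, fun S hS T hT => ?_⟩
    rw [cellSize_last, Nat.lt_one_iff] at hS hT
    have e : b * (cellFactor δ c a b k * a) = δ • (cellFactor δ c a b k * a) := by
      rw [hn, hR, hb, mul_smul_comm]
    simp [hS, hT, cellSize_last, heckeCell, e]
  -- Multiplication by `b` sends `a` to `ba` and `ba` to `δ ba`, exactly.
  · refine ⟨fun S' S => if S' = 0 then 0 else (if S = 0 then 1 else δ), fun S hS T hT => ?_⟩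
    rw [cellSize_middle hk] at hS hT ⊢
    rw [Finset.sum_range_succ, Finset.sum_range_one]
    interval_cases S
    · simp [heckeCell, hR, mul_assoc]
    · simp [heckeCell, hR, mul_assoc, hbb]

end Cells

/-- In a linear relation `φ i` kills the later blocks, and the earlier coefficients vanish by
induction, so only block `i` is left. -/
theorem linearIndependent_of_triangular {F A ι : Type*} {W : Type*} [Field F] [AddCommGroup A]
    [Module F A] [AddCommGroup W] [Module F W] [LinearOrder ι] [Fintype ι] {η : ι → Type*}
    [∀ i, Fintype (η i)] (f : (Σ i, η i) → A) (φ : ι → A →ₗ[F] W)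
    (h0 : ∀ i j, i < j → ∀ x, φ i (f ⟨j, x⟩) = 0)
    (hi : ∀ i, LinearIndependent F fun x => φ i (f ⟨i, x⟩)) : LinearIndependent F f := by
  refine Fintype.linearIndependent_iff.2 fun g hg => ?_
  suffices h : ∀ i, ∀ x, g ⟨i, x⟩ = 0 from fun x => h x.1 x.2
  intro i
  induction i using WellFoundedLT.induction with
  | ind i ih =>
    refine Fintype.linearIndependent_iff.1 (hi i) (fun x => g ⟨i, x⟩) ?_
    have h := congrArg (φ i) hg
    rw [map_sum, Fintype.sum_sigma, map_zero, Finset.sum_eq_single i] at h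
    · simpa only [map_smul] using h
    · intro j _ hj
      refine Finset.sum_eq_zero fun x _ => ?_
      rcases lt_or_gt_of_ne hj with hj | hj
      · rw [ih j hj, zero_smul, map_zero]
      · rw [map_smul, h0 i j hj, smul_zero]
    · intro h; exact absurd (Finset.mem_univ i) h

/-! ### Representations of the dihedral Hecke algebra -/

section PairRepresentations

variable {F : Type*} [Field F] {n : ℕ} {v : F}

/-- The Kazhdan–Lusztig generators `x_i + v` of the dihedral Hecke algebra. -/
noncomputable def Hecke.b (n : ℕ) (v : F) (i : Fin 2) : Hecke n v := Hecke.x n v i + v • 1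

theorem Hecke.b_mul_b (i : Fin 2) :
    Hecke.b n v i * Hecke.b n v i = (v + v⁻¹) • Hecke.b n v i := by
  have h := Hecke.x_quadratic n v i
  have e : Hecke.x n v i - algebraMap F _ v⁻¹ = Hecke.b n v i - (v + v⁻¹) • 1 := by
    rw [Hecke.b, Algebra.algebraMap_eq_smul_one]
    module
  rw [e, Algebra.algebraMap_eq_smul_one, ← Hecke.b, mul_sub, mul_smul_comm, mul_one] at h
  exact sub_eq_zero.1 h

theorem Hecke.x_eq_b_sub (i : Fin 2) : Hecke.x n v i = Hecke.b n v i - v • 1 := by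
  rw [Hecke.b, add_sub_cancel_right]

theorem Hecke.aeval_braidPoly (hv : v ≠ 0) :
    aeval (pairCasimir (v + v⁻¹) (Hecke.b n v 0) (Hecke.b n v 1)) (braidPoly F n) *
      (Hecke.b n v 0 - Hecke.b n v 1) = 0 := by
  rw [← altL_sub_altL hv (b_mul_b 0) (b_mul_b 1), ← x_eq_b_sub, ← x_eq_b_sub, x_braid,
    sub_self]

/-- The homomorphism from the dihedral Hecke algebra determined by the images of the
Kazhdan–Lusztig generators. -/
noncomputable def Hecke.ofPair {A : Type*} [Ring A] [Algebra F A] (hv : v ≠ 0) {a b : A}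
    (ha : a * a = (v + v⁻¹) • a) (hb : b * b = (v + v⁻¹) • b)
    (h : aeval (pairCasimir (v + v⁻¹) a b) (braidPoly F n) * (a - b) = 0) : Hecke n v →ₐ[F] A :=
  Hecke.lift n v (fun i => ![a - v • 1, b - v • 1] i) (by
    have key : ∀ z : A, z * z = (v + v⁻¹) • z →
        (z - v • 1 + algebraMap F A v) * (z - v • 1 - algebraMap F A v⁻¹) = 0 := by
      intro z hz
      rw [Algebra.algebraMap_eq_smul_one, Algebra.algebraMap_eq_smul_one, sub_add_cancel,
        sub_sub, ← add_smul, mul_sub, mul_smul_comm, mul_one, hz, sub_self]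
    rintro x y hxy
    cases hxy with
    | braid =>
      rw [← sub_eq_zero]
      simpa [map_altL] using (altL_sub_altL hv ha hb n).trans h
    | quadratic i => fin_cases i <;> simpa using key _ ‹_›)

theorem Hecke.ofPair_b {A : Type*} [Ring A] [Algebra F A] (hv : v ≠ 0) {a b : A}
    (ha : a * a = (v + v⁻¹) • a) (hb : b * b = (v + v⁻¹) • b)
    (h : aeval (pairCasimir (v + v⁻¹) a b) (braidPoly F n) * (a - b) = 0) :
    Hecke.ofPair hv ha hb h (Hecke.b n v 0) = a ∧ Hecke.ofPair hv ha hb h (Hecke.b n v 1) = b := by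
  have hx : ∀ i, Hecke.ofPair hv ha hb h (Hecke.x n v i) = ![a - v • 1, b - v • 1] i := fun i => by
    rw [Hecke.ofPair, Hecke.x, Hecke.lift_mk, FreeAlgebra.lift_ι_apply]
  constructor <;> rw [Hecke.b, map_add, map_smul, map_one, hx] <;> simp

/-- The first matrix of an irreducible two-dimensional representation. -/
def pairMatrixLeft (δ : F) : Matrix (Fin 2) (Fin 2) F := !![δ, 1; 0, 0]

/-- The second matrix of an irreducible two-dimensional representation. -/
def pairMatrixRight (δ γ : F) : Matrix (Fin 2) (Fin 2) F := !![0, 0; γ, δ]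

theorem pairMatrixLeft_mul_self (δ : F) :
    pairMatrixLeft δ * pairMatrixLeft δ = δ • pairMatrixLeft δ := by
  ext i j
  fin_cases i <;> fin_cases j <;> simp [pairMatrixLeft]

theorem pairMatrixRight_mul_self (δ γ : F) :
    pairMatrixRight δ γ * pairMatrixRight δ γ = δ • pairMatrixRight δ γ := by
  ext i j
  fin_cases i <;> fin_cases j <;> simp [pairMatrixRight]

/-- `t` acts by the scalar `γ`, so each root `γ` of `braidPoly F n` yields a representation of the
Hecke algebra. -/
theorem pairCasimir_pairMatrix (δ γ : F) :
    pairCasimir δ (pairMatrixLeft δ) (pairMatrixRight δ γ) = algebraMap F _ γ := by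
  rw [Algebra.algebraMap_eq_smul_one]
  ext i j
  fin_cases i <;> fin_cases j <;>
    simp [pairMatrixLeft, pairMatrixRight, pairCasimir] <;> ring

theorem pairCasimir_smul_one {A : Type*} [Ring A] [Algebra F A] (δ : F) :
    pairCasimir δ (δ • (1 : A)) (δ • 1) = algebraMap F A (δ ^ 2) := by
  simp only [pairCasimir, Algebra.algebraMap_eq_smul_one, mul_smul_comm, mul_one]
  module

theorem cellFactor_eq_algebraMap {A : Type*} [Ring A] [Algebra F A] {δ γ : F} {a b : A}
    (h : pairCasimir δ a b = algebraMap F A γ) (c : ℕ → F) (k : ℕ) :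
    cellFactor δ c a b k = algebraMap F A (∏ j ∈ Finset.range k, (γ - c j)) := by
  rw [cellFactor, h, aeval_algebraMap_apply, coe_aeval_eq_eval, eval_prod]
  simp

theorem linearIndependent_pair_of_ne_zero {W : Type*} [AddCommGroup W] [Module F W] {N : ℕ}
    (hN : N = 1) (f : ℕ → ℕ → W) (hf : f 0 0 ≠ 0) :
    LinearIndependent F fun x : Fin N × Fin N => f x.1 x.2 := by
  subst hN
  refine Fintype.linearIndependent_iff.2 fun g hg => ?_
  have h : g (0, 0) = 0 := by simpa [Fintype.sum_prod_type, hf] using hg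
  rintro ⟨i, j⟩
  rwa [Subsingleton.elim i 0, Subsingleton.elim j 0]

/-- Up to the nonzero scalar from `cellFactor`, the matrices are `a`, `ab`, with top rows `(δ, 1)`,
`(γ, δ)` and bottom row zero, and `ba`, `bab`, with `γ` times these rows at the bottom. Both pairs
are independent exactly because `δ² ≠ γ` and `γ ≠ 0`. -/
theorem heckeCell_pairMatrix_linearIndependent {δ γ : F} (hγ : γ ≠ 0) (hδ : δ ^ 2 - γ ≠ 0)
    (c : ℕ → F) {k N : ℕ} (hk : ∀ j < k, γ ≠ c j) (hN : N = 2) :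
    LinearIndependent F fun x : Fin N × Fin N =>
      heckeCell δ c (pairMatrixLeft δ) (pairMatrixRight δ γ) (k + 1) x.1 x.2 := by
  subst hN
  refine Fintype.linearIndependent_iff.2 fun g hg => ?_
  have hp : ∏ j ∈ Finset.range k, (γ - c j) ≠ 0 :=
    Finset.prod_ne_zero_iff.2 fun j hj => sub_ne_zero.2 (hk j (Finset.mem_range.1 hj))
  simp only [heckeCell, cellFactor_eq_algebraMap (pairCasimir_pairMatrix δ γ),
    ← Algebra.smul_def, smul_comm _ (∏ j ∈ Finset.range k, (γ - c j)),
    ← Finset.smul_sum, smul_eq_zero_iff_right hp] at hg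
  have h := fun i j => congrFun (congrFun hg i) j
  simp only [Fintype.sum_prod_type, Fin.sum_univ_two, pairMatrixLeft, pairMatrixRight] at h
  have h00 := h 0 0
  have h01 := h 0 1
  have h10 := h 1 0
  have h11 := h 1 1
  simp at h00 h01 h10 h11
  have key : ∀ x y : F, x * δ + y * γ = 0 → x + y * δ = 0 → x = 0 ∧ y = 0 := by
    intro x y h1 h2
    have h3 : y * (δ ^ 2 - γ) = 0 := by linear_combination δ * h2 - h1
    have h4 : y = 0 := (mul_eq_zero.1 h3).resolve_right hδ
    exact ⟨by simpa [h4] using h2, h4⟩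
  obtain ⟨e1, e2⟩ := key _ _ h00 h01
  obtain ⟨e3, e4⟩ := key (g (1, 0)) (g (1, 1))
    (mul_left_cancel₀ hγ (by linear_combination h10))
    (mul_left_cancel₀ hγ (by linear_combination h11))
  rintro ⟨i, j⟩
  fin_cases i <;> fin_cases j <;> assumption

end PairRepresentations

/-! ### The cell datum of the dihedral Hecke algebra -/

section HeckeCellDatum

variable {F : Type*} [Field F] {n : ℕ} {v : F}

/-- The indices of the cells of the dihedral Hecke algebra, ordered by decreasing index. -/
abbrev HeckeCellIndex (n : ℕ) : Type := (Fin (n + 2))ᵒᵈ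

/-- The number of a cell of the dihedral Hecke algebra. -/
def HeckeCellIndex.number (μ : HeckeCellIndex n) : ℕ := (OrderDual.ofDual μ : Fin (n + 2))

theorem HeckeCellIndex.number_le (μ : HeckeCellIndex n) : μ.number ≤ n + 1 :=
  Nat.lt_succ_iff.1 (OrderDual.ofDual μ : Fin (n + 2)).2

/-- The index set of a cell of the dihedral Hecke algebra. -/
abbrev HeckeCellSet (n : ℕ) (μ : HeckeCellIndex n) : Type :=
  Fin (cellSize n (HeckeCellIndex.number μ))

/-- The cellular basis of the dihedral Hecke algebra. -/
noncomputable def heckeBasis (n : ℕ) (v : F) (c : ℕ → F) (μ : HeckeCellIndex n)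
    (S T : HeckeCellSet n μ) : Hecke n v :=
  heckeCell (v + v⁻¹) c (Hecke.b n v 0) (Hecke.b n v 1) (HeckeCellIndex.number μ) S T

theorem heckeCellSpan_eq (c : ℕ → F) (μ : HeckeCellIndex n) :
    heckeCellSpan n (v + v⁻¹) c (Hecke.b n v 0) (Hecke.b n v 1) (HeckeCellIndex.number μ) =
      Submodule.span F {x | ∃ κ : HeckeCellIndex n, κ < μ ∧
        ∃ P Q : HeckeCellSet n κ, x = heckeBasis n v c κ P Q} := by
  rw [heckeCellSpan]
  congr 1
  ext x
  constructor
  · rintro ⟨κ, h1, h2, P, Q, hP, hQ, rfl⟩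
    exact ⟨OrderDual.toDual ⟨κ, by omega⟩, h1, ⟨P, hP⟩, ⟨Q, hQ⟩, rfl⟩
  · rintro ⟨κ, h, P, Q, rfl⟩
    exact ⟨HeckeCellIndex.number κ, h, HeckeCellIndex.number_le κ, P, Q, P.2, Q.2, rfl⟩

/-- The condition (C3) of a cell datum for one element `a`. -/
def ActsOnCells {R A : Type*} [CommRing R] [Ring A] [Algebra R A] {Λ : Type*} [PartialOrder Λ]
    {M : Λ → Type*} [∀ μ, Fintype (M μ)] (C : ∀ μ, M μ → M μ → A) (a : A) : Prop :=
  ∀ μ, ∃ r : M μ → M μ → R, ∀ S T : M μ, a * C μ S T - ∑ S' : M μ, r S' S • C μ S' T ∈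
    Submodule.span R {x : A | ∃ κ : Λ, κ < μ ∧ ∃ P Q : M κ, x = C κ P Q}

section ActsOnCells

variable {R A : Type*} [CommRing R] [Ring A] [Algebra R A] {Λ : Type*} [PartialOrder Λ]
    {M : Λ → Type*} [∀ μ, Fintype (M μ)] {C : ∀ μ, M μ → M μ → A} {a b : A}

theorem actsOnCells_algebraMap (c : R) : ActsOnCells (R := R) C (algebraMap R A c) := by
  classical
  refine fun μ => ⟨fun S' S => if S' = S then c else 0, fun S T => ?_⟩
  rw [← Algebra.smul_def]
  simp [ite_smul]

theorem ActsOnCells.add (ha : ActsOnCells (R := R) C a) (hb : ActsOnCells (R := R) C b) :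
    ActsOnCells (R := R) C (a + b) := by
  intro μ
  obtain ⟨r, hr⟩ := ha μ
  obtain ⟨s, hs⟩ := hb μ
  refine ⟨r + s, fun S T => ?_⟩
  have h := Submodule.add_mem _ (hr S T) (hs S T)
  simp only [Pi.add_apply, add_smul, Finset.sum_add_distrib, add_mul]
  rwa [add_sub_add_comm]

theorem ActsOnCells.mul_mem_span (ha : ActsOnCells (R := R) C a) (μ : Λ) {x : A}
    (hx : x ∈ Submodule.span R {x : A | ∃ κ : Λ, κ < μ ∧ ∃ P Q : M κ, x = C κ P Q}) :
    a * x ∈ Submodule.span R {x : A | ∃ κ : Λ, κ < μ ∧ ∃ P Q : M κ, x = C κ P Q} := by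
  induction hx using Submodule.span_induction with
  | zero => rw [mul_zero]; exact Submodule.zero_mem _
  | add x y _ _ hx hy => rw [mul_add]; exact Submodule.add_mem _ hx hy
  | smul c x _ hx => rw [mul_smul_comm]; exact Submodule.smul_mem _ _ hx
  | mem x hx =>
    obtain ⟨κ, hκ, P, Q, rfl⟩ := hx
    obtain ⟨r, hr⟩ := ha κ
    rw [← sub_add_cancel (a * C κ P Q) (∑ S' : M κ, r S' P • C κ S' Q)]
    refine Submodule.add_mem _ (Submodule.span_mono ?_ (hr P Q)) (Submodule.sum_mem _ fun S' _ =>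
      Submodule.smul_mem _ _ (Submodule.subset_span ⟨κ, hκ, S', Q, rfl⟩))
    rintro x ⟨κ', h, P', Q', rfl⟩
    exact ⟨κ', h.trans hκ, P', Q', rfl⟩

/-- An element satisfying (C3) preserves the span of the lower cells, so the error terms stay there
and the coefficient matrices multiply. Thus (C3) need only be checked on generators. -/
theorem ActsOnCells.mul (ha : ActsOnCells (R := R) C a) (hb : ActsOnCells (R := R) C b) :
    ActsOnCells (R := R) C (a * b) := by
  intro μ
  obtain ⟨r, hr⟩ := ha μ
  obtain ⟨s, hs⟩ := hb μ
  refine ⟨fun S' S => ∑ S'', s S'' S * r S' S'', fun S T => ?_⟩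
  have h1 := ha.mul_mem_span μ (hs S T)
  have h2 := Submodule.sum_mem _ fun S'' (_ : S'' ∈ Finset.univ) =>
    Submodule.smul_mem _ (s S'' S) (hr S'' T)
  have h := Submodule.add_mem _ h1 h2
  have e : ∑ S', (∑ S'', s S'' S * r S' S'') • C μ S' T =
      ∑ S'', s S'' S • ∑ S', r S' S'' • C μ S' T := by
    simp only [Finset.sum_smul, Finset.smul_sum, smul_smul]
    exact Finset.sum_comm
  simp only [mul_sub, Finset.mul_sum, mul_smul_comm, smul_sub, Finset.sum_sub_distrib] at h
  rw [sub_add_sub_cancel, ← mul_assoc] at h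
  rwa [e]

theorem ActsOnCells.mul_mem_span_range (ha : ActsOnCells (R := R) C a) {x : A}
    (hx : x ∈ Submodule.span R
      (Set.range fun x : (Σ μ : Λ, M μ × M μ) => C x.1 x.2.1 x.2.2)) :
    a * x ∈ Submodule.span R
      (Set.range fun x : (Σ μ : Λ, M μ × M μ) => C x.1 x.2.1 x.2.2) := by
  induction hx using Submodule.span_induction with
  | zero => rw [mul_zero]; exact Submodule.zero_mem _
  | add x y _ _ hx hy => rw [mul_add]; exact Submodule.add_mem _ hx hy
  | smul c x _ hx => rw [mul_smul_comm]; exact Submodule.smul_mem _ _ hx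
  | mem x hx =>
    obtain ⟨⟨κ, P, Q⟩, rfl⟩ := hx
    obtain ⟨r, hr⟩ := ha κ
    change a * C κ P Q ∈ _
    rw [← sub_add_cancel (a * C κ P Q) (∑ S' : M κ, r S' P • C κ S' Q)]
    refine Submodule.add_mem _ (Submodule.span_mono ?_ (hr P Q)) (Submodule.sum_mem _ fun S' _ =>
      Submodule.smul_mem _ _ (Submodule.subset_span ⟨⟨κ, S', Q⟩, rfl⟩))
    rintro x ⟨κ', h, P', Q', rfl⟩
    exact ⟨⟨κ', P', Q'⟩, rfl⟩

end ActsOnCells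

variable {c : ℕ → F}

theorem Hecke.rev_b (i : Fin 2) : Hecke.rev n v (Hecke.b n v i) = Hecke.b n v i := by
  rw [b, ← Algebra.algebraMap_eq_smul_one, map_add, rev_x, rev_algebraMap]

theorem Hecke.rev_one : Hecke.rev n v 1 = 1 := by
  simpa using Hecke.rev_algebraMap (n := n) (v := v) 1

theorem Hecke.rev_cellFactor (k : ℕ) :
    Hecke.rev n v (cellFactor (v + v⁻¹) c (b n v 0) (b n v 1) k) =
      cellFactor (v + v⁻¹) c (b n v 0) (b n v 1) k := by
  have ht : Hecke.rev n v (pairCasimir (v + v⁻¹) (b n v 0) (b n v 1)) =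
      pairCasimir (v + v⁻¹) (b n v 0) (b n v 1) := by
    simp only [pairCasimir, map_add, map_sub, map_smul, rev_mul, rev_b, rev_one]
    rw [add_comm (b n v 1 * b n v 0)]
  induction k with
  | zero => rw [cellFactor_zero, rev_one]
  | succ k ih =>
    rw [cellFactor_succ, rev_mul, ih, map_sub, ht, map_smul, rev_one]
    exact ((commute_cellFactor (Commute.refl _) k).sub_right
      ((Commute.one_right _).smul_right (c k))).symm.eq

theorem Hecke.rev_heckeBasis (μ : HeckeCellIndex n) (S T : HeckeCellSet n μ) :
    Hecke.rev n v (heckeBasis n v c μ S T) = heckeBasis n v c μ T S := by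
  have h : ∀ i S T : ℕ, Hecke.rev n v (heckeCell (v + v⁻¹) c (b n v 0) (b n v 1) i S T) =
      heckeCell (v + v⁻¹) c (b n v 0) (b n v 1) i T S := by
    intro i S T
    cases i with
    | zero => exact rev_one
    | succ k =>
      have hw : ∀ S : ℕ, Hecke.rev n v (if S = 0 then 1 else b n v 1) =
          if S = 0 then 1 else b n v 1 := fun S => by
        split_ifs
        · exact rev_one
        · exact rev_b 1
      have h0 := commute_cellFactor (c := c) (commute_pairCasimir_left (b := b n v 1)
        (b_mul_b (n := n) (v := v) 0)) k
      have h1 := commute_cellFactor (c := c) (commute_pairCasimir_right (a := b n v 0)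
        (b_mul_b (n := n) (v := v) 1)) k
      have h2 : ∀ S : ℕ, Commute (cellFactor (v + v⁻¹) c (b n v 0) (b n v 1) k)
          (if S = 0 then 1 else b n v 1) := fun S => by
        split_ifs
        · exact Commute.one_right _
        · exact h1
      simp only [heckeCell, rev_mul, rev_cellFactor, hw, rev_b, ← mul_assoc]
      rw [mul_assoc, mul_assoc, mul_assoc, mul_assoc]
      simpa only [mul_assoc] using (((h2 T).mul_right h0).mul_right (h2 S)).symm.eq
  exact h _ _ _

theorem cellFactor_mul_b_eq (hv : v ≠ 0)
    (hQ : braidPoly F n = ∏ j ∈ Finset.range n, (X - C (c j))) :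
    cellFactor (v + v⁻¹) c (Hecke.b n v 0) (Hecke.b n v 1) n * Hecke.b n v 0 =
      cellFactor (v + v⁻¹) c (Hecke.b n v 0) (Hecke.b n v 1) n * Hecke.b n v 1 := by
  rw [← sub_eq_zero, ← mul_sub, cellFactor, ← hQ, Hecke.aeval_braidPoly hv]

theorem actsOnCells_heckeBasis (hv : v ≠ 0)
    (hQ : braidPoly F n = ∏ j ∈ Finset.range n, (X - C (c j))) (hc : ∀ j < n, c j ≠ 0)
    (a : Hecke n v) : ActsOnCells (R := F) (heckeBasis n v c) a := by
  have hn := cellFactor_mul_b_eq hv hQ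
  have hb : ∀ i, ActsOnCells (R := F) (heckeBasis n v c) (Hecke.b n v i) := by
    intro i μ
    have hμ := HeckeCellIndex.number_le μ
    have h : ∃ r : ℕ → ℕ → F, ∀ S < cellSize n (HeckeCellIndex.number μ),
        ∀ T < cellSize n (HeckeCellIndex.number μ),
        Hecke.b n v i * heckeCell (v + v⁻¹) c (Hecke.b n v 0) (Hecke.b n v 1)
            (HeckeCellIndex.number μ) S T -
          ∑ S' ∈ Finset.range (cellSize n (HeckeCellIndex.number μ)), r S' S •
            heckeCell (v + v⁻¹) c (Hecke.b n v 0) (Hecke.b n v 1) (HeckeCellIndex.number μ) S' T ∈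
        heckeCellSpan n (v + v⁻¹) c (Hecke.b n v 0) (Hecke.b n v 1) (HeckeCellIndex.number μ) := by
      fin_cases i
      · exact left_mul_heckeCell (Hecke.b_mul_b 0) (Hecke.b_mul_b 1) hn hμ
      · exact right_mul_heckeCell (Hecke.b_mul_b 1) hc hn hμ
    obtain ⟨r, hr⟩ := h
    refine ⟨fun S' S => r S' S, fun S T => ?_⟩
    have h := hr S S.2 T T.2
    rw [heckeCellSpan_eq, Finset.sum_range] at h
    exact h
  induction a using Hecke.induction with
  | halg c => exact actsOnCells_algebraMap c
  | hadd a b ha hb => exact ha.add hb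
  | hmul a b ha hb => exact ha.mul hb
  | hx i =>
    rw [Hecke.x_eq_b_sub, sub_eq_add_neg, ← neg_smul, ← Algebra.algebraMap_eq_smul_one]
    exact (hb i).add (actsOnCells_algebraMap _)

/-- Each cell has its own representation that kills all later cells: `b_i ↦ 0` for the unit, the
matrix pair with `t = c_k` for cell `k + 1`, and `b_i ↦ δ` for the last. The scalar ones are also
put into `2 × 2` matrices, so that all have the same target. -/
theorem heckeBasis_linearIndependent (hv : v ≠ 0)
    (hQ : braidPoly F n = ∏ j ∈ Finset.range n, (X - C (c j))) (hc : ∀ j < n, c j ≠ 0)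
    (hinj : Set.InjOn c (Finset.range n)) (hδ : v + v⁻¹ ≠ 0)
    (hcδ : ∀ j < n, (v + v⁻¹) ^ 2 - c j ≠ 0) :
    LinearIndependent F fun x : (Σ μ : HeckeCellIndex n, HeckeCellSet n μ × HeckeCellSet n μ) =>
      heckeBasis n v c x.1 x.2.1 x.2.2 := by
  set δ := v + v⁻¹ with hδ_def
  have hrep : ∀ i : Fin (n + 2), ∃ φ : Hecke n v →ₐ[F] Matrix (Fin 2) (Fin 2) F,
      (∀ j : Fin (n + 2), i < j → ∀ S T : ℕ,
        φ (heckeCell δ c (Hecke.b n v 0) (Hecke.b n v 1) j S T) = 0) ∧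
      LinearIndependent F fun x : Fin (cellSize n i) × Fin (cellSize n i) =>
        φ (heckeCell δ c (Hecke.b n v 0) (Hecke.b n v 1) i x.1 x.2) := by
    rintro ⟨i, hi⟩
    rcases i with _ | k
    · obtain ⟨φ, h0, h1⟩ : ∃ φ : Hecke n v →ₐ[F] Matrix (Fin 2) (Fin 2) F,
          φ (Hecke.b n v 0) = 0 ∧ φ (Hecke.b n v 1) = 0 :=
        ⟨_, Hecke.ofPair_b hv (by simp) (by simp) (by simp)⟩
      refine ⟨φ, fun j hj S T => ?_, ?_⟩
      rotate_left
      · simp only [map_heckeCell]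
        exact linearIndependent_pair_of_ne_zero (if_pos (Or.inl rfl))
          (heckeCell δ c _ _ 0) (by simp [heckeCell])
      · obtain ⟨k, hk⟩ := Nat.exists_eq_succ_of_ne_zero (show (j : ℕ) ≠ 0 from
          Nat.pos_iff_ne_zero.1 hj)
        rw [map_heckeCell, h0, h1, hk]
        simp [heckeCell]
    rcases (show k ≤ n by omega).eq_or_lt with rfl | hk
    · have hδδ : (δ • 1 : Matrix (Fin 2) (Fin 2) F) * (δ • 1) = δ • δ • 1 := by
        rw [smul_mul_assoc, one_mul]
      obtain ⟨φ, h0, h1⟩ : ∃ φ : Hecke k v →ₐ[F] Matrix (Fin 2) (Fin 2) F,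
          φ (Hecke.b k v 0) = δ • 1 ∧ φ (Hecke.b k v 1) = δ • 1 :=
        ⟨_, Hecke.ofPair_b hv hδδ hδδ (by simp)⟩
      refine ⟨φ, fun j hj S T => ?_, ?_⟩
      rotate_left
      · simp only [map_heckeCell, h0, h1]
        refine linearIndependent_pair_of_ne_zero (cellSize_last k)
          (heckeCell δ c (δ • 1) (δ • 1) (k + 1)) ?_
        have hp : ∏ j ∈ Finset.range k, (δ ^ 2 - c j) ≠ 0 :=
          Finset.prod_ne_zero_iff.2 fun j hj => hcδ j (Finset.mem_range.1 hj)
        simp only [heckeCell, cellFactor_eq_algebraMap (pairCasimir_smul_one δ), if_true, one_mul,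
          mul_one, ← Algebra.smul_def]
        exact smul_ne_zero hp (smul_ne_zero hδ one_ne_zero)
      · exact absurd hj (not_lt.2 (Nat.lt_succ_iff.1 j.2))
    · have hQk : (braidPoly F n).eval (c k) = 0 := by
        rw [hQ, eval_prod, Finset.prod_eq_zero (Finset.mem_range.2 hk) (by simp)]
      obtain ⟨φ, h0, h1⟩ : ∃ φ : Hecke n v →ₐ[F] Matrix (Fin 2) (Fin 2) F,
          φ (Hecke.b n v 0) = pairMatrixLeft δ ∧ φ (Hecke.b n v 1) = pairMatrixRight δ (c k) :=
        ⟨_, Hecke.ofPair_b hv (pairMatrixLeft_mul_self δ) (pairMatrixRight_mul_self δ (c k))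
          (by rw [pairCasimir_pairMatrix, aeval_algebraMap_apply, coe_aeval_eq_eval, hQk,
            map_zero, zero_mul])⟩
      refine ⟨φ, fun j hj S T => ?_, ?_⟩
      rotate_left
      · simp only [map_heckeCell, h0, h1]
        refine heckeCell_pairMatrix_linearIndependent (hc k hk) (hcδ k hk) c (fun j hj h => ?_)
          (cellSize_middle hk)
        exact hj.ne' (hinj (by simpa using hk) (by simpa using hj.trans hk) h)
      -- All later cells contain the factor `t - c_k`, which is zero in this representation.
      · have hj' : k + 1 < (j : ℕ) := hj
        obtain ⟨k', hk'⟩ := Nat.exists_eq_succ_of_ne_zero (show (j : ℕ) ≠ 0 by omega)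
        rw [map_heckeCell, h0, h1, hk', heckeCell,
          cellFactor_eq_algebraMap (pairCasimir_pairMatrix δ (c k)),
          Finset.prod_eq_zero (Finset.mem_range.2 (show k < k' by omega)) (sub_self _), map_zero,
          zero_mul]
  choose φ hφ0 hφ using hrep
  exact linearIndependent_of_triangular (ι := Fin (n + 2))
    (η := fun i => Fin (cellSize n i) × Fin (cellSize n i))
    (fun x => heckeCell δ c (Hecke.b n v 0) (Hecke.b n v 1) x.1 x.2.1 x.2.2)
    (fun i => (φ i).toLinearMap) (fun i j hij x => hφ0 i j hij _ _) hφ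

theorem isCellDatum_heckeBasis (hv : v ≠ 0)
    (hQ : braidPoly F n = ∏ j ∈ Finset.range n, (X - C (c j))) (hc : ∀ j < n, c j ≠ 0)
    (hinj : Set.InjOn c (Finset.range n)) (hδ : v + v⁻¹ ≠ 0)
    (hcδ : ∀ j < n, (v + v⁻¹) ^ 2 - c j ≠ 0) :
    IsCellDatum (HeckeCellIndex n) (HeckeCellSet n) (heckeBasis n v c) (Hecke.rev n v) := by
  have hind := heckeBasis_linearIndependent hv hQ hc hinj hδ hcδ
  have hact := actsOnCells_heckeBasis hv hQ hc
  refine ⟨hind.injective, hind, ?_, Hecke.rev_mul, Hecke.rev_rev, Hecke.rev_heckeBasis, hact⟩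
  rw [eq_top_iff]
  intro a _
  -- The span of all cells is a left ideal by (C3), and cell number `0` is the unit.
  rw [← mul_one a]
  refine (hact a).mul_mem_span_range (Submodule.subset_span ?_)
  exact ⟨⟨OrderDual.toDual 0, ⟨0, cellSize_pos _ _⟩, ⟨0, cellSize_pos _ _⟩⟩, rfl⟩

end HeckeCellDatum

/-! ### The roots of the braid polynomial -/

section RootsOfUnity

variable {F : Type*} [Field F] {n : ℕ} {v : F}

theorem pow_ne_one_of_algebraicIndependent [CharZero F] {l : F}
    (h : AlgebraicIndependent ℚ ![v, l]) {k : ℕ} (hk : k ≠ 0) : v ^ k ≠ 1 := by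
  intro h0
  have hinj := (injective_iff_map_eq_zero _).1 (algebraicIndependent_iff_injective_aeval.1 h)
  have h2 := hinj (.X 0 ^ k - 1) (by simp [h0])
  have h3 := congrArg (MvPolynomial.eval ![2, 0]) h2
  simp only [map_sub, map_pow, MvPolynomial.eval_X, Matrix.cons_val_zero, map_one, map_zero] at h3
  exact (one_lt_pow₀ (one_lt_two (α := ℚ)) hk).ne' (sub_eq_zero.1 h3)

theorem exists_pow_add_inv_pow {K : Type*} [Field K] [Algebra F K] {ζ : K} (hζ : ζ ≠ 0)
    (h : ζ + ζ⁻¹ ∈ Set.range (algebraMap F K)) (k : ℕ) :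
    ∃ s : F, algebraMap F K s = ζ ^ k + (ζ ^ k)⁻¹ := by
  obtain ⟨a, ha⟩ := h
  induction k using Nat.twoStepInduction with
  | zero => exact ⟨2, by rw [map_ofNat]; norm_num⟩
  | one => exact ⟨a, by simpa using ha⟩
  | more k ih ih' =>
    obtain ⟨s, hs⟩ := ih
    obtain ⟨s', hs'⟩ := ih'
    -- This is the Chebyshev recursion `s_{k+2} = (ζ + ζ⁻¹) s_{k+1} - s_k`.
    refine ⟨a * s' - s, ?_⟩
    rw [map_sub, map_mul, ha, hs, hs']
    field_simp
    ring

theorem add_inv_eq_add_inv_iff {K : Type*} [Field K] {x y : K} (hx : x ≠ 0) (hy : y ≠ 0) :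
    x + x⁻¹ = y + y⁻¹ ↔ x = y ∨ x * y = 1 := by
  have e : x + x⁻¹ - (y + y⁻¹) = (x - y) * (x * y - 1) * (x * y)⁻¹ := by
    field_simp
    ring
  rw [← sub_eq_zero, e, mul_eq_zero, mul_eq_zero, sub_eq_zero, sub_eq_zero]
  simp [hx, hy]

/-- If `F` contains `ζ + ζ⁻¹`, the dihedral Hecke algebra has a cell datum with word reversal. -/
theorem exists_isCellDatum_heckeBasis [CharZero F] {l : F} (hv : v ≠ 0)
    (hvl : AlgebraicIndependent ℚ ![v, l]) {K : Type*} [Field K] [Algebra F K] {ζ : K}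
    (hζ : IsPrimitiveRoot ζ (2 * n + 1)) (h : ζ + ζ⁻¹ ∈ Set.range (algebraMap F K)) :
    ∃ c : ℕ → F, IsCellDatum (HeckeCellIndex n) (HeckeCellSet n) (heckeBasis n v c)
      (Hecke.rev n v) := by
  have hζ0 : ζ ≠ 0 := hζ.ne_zero (by omega)
  have : CharZero K := charZero_of_injective_algebraMap (algebraMap F K).injective
  choose s hs using exists_pow_add_inv_pow hζ0 h
  -- The shift by one omits the trivial root of unity; for `j < n` the exponents `1, …, n` meet each
  -- pair `ζ^k, ζ^(-k)` once.
  set c : ℕ → F := fun j => 2 + s (j + 1) with hc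
  have hcK : ∀ j, algebraMap F K (c j) = 2 + ζ ^ (j + 1) + (ζ ^ (j + 1))⁻¹ := fun j => by
    rw [hc, map_add, hs, map_ofNat, add_assoc]
  have hpow : ∀ j, (ζ ^ (j + 1)) ^ (2 * n + 1) = 1 := fun j => by
    rw [← pow_mul, mul_comm, pow_mul, hζ.pow_eq_one, one_pow]
  have hne : ∀ j, ζ ^ (j + 1) ≠ 0 := fun j => pow_ne_zero _ hζ0
  have hinj : Set.InjOn c (Finset.range n) := by
    intro i hi j hj hij
    have hi' : i < n := by simpa using hi
    have hj' : j < n := by simpa using hj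
    have e := congrArg (algebraMap F K) hij
    rw [hcK, hcK, add_assoc, add_assoc, add_right_inj, add_inv_eq_add_inv_iff (hne i) (hne j)] at e
    rcases e with e | e
    · exact Nat.succ_injective (hζ.pow_inj (by omega) (by omega) e)
    -- Two exponents between `1` and `n` add up to at most `2n`, less than the order of `ζ`.
    · rw [← pow_add] at e
      exact absurd e (hζ.pow_ne_one_of_pos_of_lt (by omega) (by omega))
  have hQ : braidPoly F n = ∏ j ∈ Finset.range n, (X - C (c j)) := by
    refine braidPoly_eq_prod hinj fun j hj => ?_
    apply (algebraMap F K).injective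
    rw [map_zero, ← eval₂_at_apply, ← eval_map, braidPoly_map, hcK]
    have e := eval_braidPoly (hne j) n
    rw [hpow, sub_self, mul_eq_zero, mul_eq_zero] at e
    refine (e.resolve_left ?_).resolve_left (pow_ne_zero _ (hne j))
    exact sub_ne_zero.2 (hζ.pow_ne_one_of_pos_of_lt (by omega) (by omega))
  have hc0 : ∀ j < n, c j ≠ 0 := by
    intro j _ h0
    have e := hcK j
    rw [h0, map_zero] at e
    -- If `c_j` were zero, `ζ^(j+1)` would be `-1`, which is impossible in a group of odd order `2n
    -- + 1`.
    have h1 : (ζ ^ (j + 1) + 1) ^ 2 = 0 := by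
      have h2 : (ζ ^ (j + 1) + 1) ^ 2 =
          ζ ^ (j + 1) * (2 + ζ ^ (j + 1) + (ζ ^ (j + 1))⁻¹) := by
        have := hne j
        field_simp
        ring
      rw [h2, ← e, mul_zero]
    have h3 := hpow j
    rw [eq_neg_of_add_eq_zero_left (pow_eq_zero_iff two_ne_zero |>.1 h1),
      (odd_two_mul_add_one n).neg_one_pow] at h3
    norm_num at h3
  have hδ : v + v⁻¹ ≠ 0 := by
    intro h0
    have h1 : v ^ 2 = -1 := by
      have : v ^ 2 + 1 = v * (v + v⁻¹) := by field_simp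
      rw [h0, mul_zero] at this
      exact eq_neg_of_add_eq_zero_left this
    refine pow_ne_one_of_algebraicIndependent hvl four_ne_zero ?_
    rw [show 4 = 2 * 2 from rfl, pow_mul, h1, neg_one_sq]
  have hcδ : ∀ j < n, (v + v⁻¹) ^ 2 - c j ≠ 0 := by
    intro j _ h0
    have hv2 : algebraMap F K v ^ 2 ≠ 0 :=
      pow_ne_zero _ ((map_ne_zero_iff _ (algebraMap F K).injective).2 hv)
    have e := congrArg (algebraMap F K) (sub_eq_zero.1 h0)
    -- As `δ² = 2 + v² + v⁻²`, equality with `c_j` would make `v²` equal to `ζ^(j+1)` or its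
    -- inverse, so that `v` would be a root of unity.
    have e' : algebraMap F K v ^ 2 + (algebraMap F K v ^ 2)⁻¹ =
        ζ ^ (j + 1) + (ζ ^ (j + 1))⁻¹ := by
      have hvK : algebraMap F K v ≠ 0 := (map_ne_zero_iff _ (algebraMap F K).injective).2 hv
      rw [hcK, map_pow, map_add, map_inv₀] at e
      have e2 : (algebraMap F K v + (algebraMap F K v)⁻¹) ^ 2 =
          2 + (algebraMap F K v ^ 2 + (algebraMap F K v ^ 2)⁻¹) := by
        field_simp
        ring
      rw [e2, add_assoc] at e
      exact add_left_cancel e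
    have h1 : (algebraMap F K v ^ 2) ^ (2 * n + 1) = 1 := by
      rcases (add_inv_eq_add_inv_iff hv2 (hne j)).1 e' with h2 | h2
      · rw [h2, hpow]
      · have h3 := congrArg (· ^ (2 * n + 1)) h2
        simpa only [mul_pow, hpow, mul_one, one_pow] using h3
    rw [← pow_mul, ← map_pow] at h1
    exact pow_ne_one_of_algebraicIndependent hvl (k := 2 * (2 * n + 1)) (by omega)
      ((algebraMap F K).injective (h1.trans (map_one _).symm))
  exact ⟨c, isCellDatum_heckeBasis hv hQ hc0 hinj hδ hcδ⟩

end RootsOfUnity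

end DihedralBMW

/-! ### The main theorem -/

theorem mainTheorem7 (n : ℕ) (hn : 1 ≤ n) (F : Type*) [Field F] [CharZero F] (v l : F)
    (hv : v ≠ 0) (hvl : AlgebraicIndependent ℚ ![v, l]) :
    -- every cell datum of the Hecke algebra with word reversal lifts, for every choice of lifts
    (∀ (Λ : Type*) [PartialOrder Λ] (M : Λ → Type) [∀ μ, Fintype (M μ)]
      [∀ μ, LinearOrder (M μ)] (C : ∀ μ, M μ → M μ → DihedralBMW.Hecke n v)
      (D : ∀ μ, M μ → M μ → DihedralBMW.BMW n (v - v⁻¹) l),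
      DihedralBMW.IsCellDatum Λ M C (DihedralBMW.Hecke.rev n v) →
      (∀ (μ : Λ) (S T : M μ), S ≤ T →
        DihedralBMW.toHecke n v l hv (D μ S T) = C μ S T) →
      DihedralBMW.IsCellDatum (WithBot Λ) (DihedralBMW.cellIndex n M)
          (DihedralBMW.cellElement n (v - v⁻¹) l M D) (DihedralBMW.BMW.rev n (v - v⁻¹) l) ∧
        ∀ (μ : Λ) (S T : M μ), DihedralBMW.toHecke n v l hv
          (DihedralBMW.cellElement n (v - v⁻¹) l M D (μ : WithBot Λ) S T) = C μ S T) ∧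
    -- if `F` contains `ζ + ζ⁻¹`, both algebras are cellular with respect to word reversal
    ((∃ ζ : AlgebraicClosure F, IsPrimitiveRoot ζ (2 * n + 1) ∧
        ζ + ζ⁻¹ ∈ Set.range (algebraMap F (AlgebraicClosure F))) →
      DihedralBMW.IsCellularWith (DihedralBMW.Hecke.rev n v) ∧
        DihedralBMW.IsCellularWith (DihedralBMW.BMW.rev n (v - v⁻¹) l)) := by
  refine ⟨fun Λ _ M _ _ C D hC hD =>
    ⟨DihedralBMW.isCellDatum_cellElement hv hvl M C D hC hD,
      DihedralBMW.toHecke_cellElement hv M C D hC hD⟩, ?_⟩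
  rintro ⟨ζ, hζ, h⟩
  obtain ⟨c, hC⟩ := DihedralBMW.exists_isCellDatum_heckeBasis hv hvl hζ h
  choose D hD using fun μ S T =>
    DihedralBMW.toHecke_surjective (l := l) hv (DihedralBMW.heckeBasis n v c μ S T)
  exact ⟨⟨_, _, _, _, _, hC⟩, ⟨_, _, _, _, _,
    DihedralBMW.isCellDatum_cellElement hv hvl _ _ D hC fun μ S T _ => hD μ S T⟩⟩
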